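/- An operator is a tuple $\mathcal A=(A_1,\dots,A_k)$ of matrices $A_i\in\mathbb R^{m\times n}$; its size is $s(\mathcal A)=\sum_{i=1}^k\|A_i\|_F^2$, and for two operators put $\operatorname{dist}(\mathcal A,\mathcal B)=\sum_{i=1}^k\|A_i-B_i\|_F^2$. The operator $\mathcal A$ is $\epsilon$-nearly doubly balanced if, with $s=s(\mathcal A)$, \[ (1-\epsilon)\tfrac{s}{m}I_m\preceq\sum_{i=1}^kA_iA_i^*\preceq(1+\epsilon)\tfrac{s}{m}I_m \quad\text{and}\quad (1-\epsilon)\tfrac{s}{n}I_n\preceq\sum_{i=1}^kA_i^*A_i\preceq(1+\epsilon)\tfrac{s}{n}I_n, \] and doubly balanced if this holds with $\epsilon=0$. It has a $\lambda$-spectral gap if the second largest singular value of the $m^2\times n^2$ matrix $M_{\mathcal A}=\sum_{i=1}^kA_i\otimes A_i$ satisfies $\sigma_2(M_{\mathcal A})\le(1-\lambda)\,s(\mathcal A)/\sqrt{mn}$ (with $\sigma_2:=0$ if there is no second singular value). The gradient flow (continuous operator scaling) started at $\mathcal A^{(0)}$ is the dynamical system, for $t\ge 0$, \[ \frac{d}{dt}A_i=\Big(s(\mathcal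 A)I_m-m\sum_{j=1}^kA_jA_j^*\Big)A_i+A_i\Big(s(\mathcal A)I_n-n\sum_{j=1}^kA_j^*A_j\Big),\qquad 1\le i\le k. \] There is a universal constant $C>0$ such that the following holds. Let $\mathcal A^{(0)}=(A_1,\dots,A_k)$ be an operator with $A_i\in\mathbb R^{m\times n}$ and $m\le n$, which is $\epsilon$-nearly doubly balanced and has a $\lambda$-spectral gap, where $\lambda>0$ and $\lambda^2\ge C\epsilon\ln m$. Then the gradient flow started at $\mathcal A^{(0)}$ exists for all times $t\ge0$, and it converges as $t\to\infty$ to a doubly balanced operator $\mathcal A^{(\infty)}$ with \[ \operatorname{dist}(\mathcal A^{(0)},\mathcal A^{(\infty)})\le\frac{s(\mathcal A^{(0)})\,\epsilon^2}{\lambda}. \] -/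

import Mathlib

open Filter Topology
open scoped Kronecker

noncomputable section

/-- An operator: a tuple of `k` real `m × n` matrices. -/
abbrev MatOperator (m n k : ℕ) : Type := Fin k → Matrix (Fin m) (Fin n) ℝ

namespace MatOperator

variable {m n k : ℕ}

/-- The size `s(A) = ∑ᵢ ‖Aᵢ‖_F²`. -/
def size (A : MatOperator m n k) : ℝ := ∑ i, ∑ a, ∑ b, (A i a b) ^ 2

/-- The squared distance `dist(A, B) = ∑ᵢ ‖Aᵢ - Bᵢ‖_F²` between two operators. -/
def sqDist (A B : MatOperator m n k) : ℝ := ∑ i, ∑ a, ∑ b, (A i a b - B i a b) ^ 2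

/-- `∑ᵢ Aᵢ Aᵢ*`, an `m × m` matrix. -/
def rowGram (A : MatOperator m n k) : Matrix (Fin m) (Fin m) ℝ :=
  ∑ i, A i * (A i).transpose

/-- `∑ᵢ Aᵢ* Aᵢ`, an `n × n` matrix. -/
def colGram (A : MatOperator m n k) : Matrix (Fin n) (Fin n) ℝ :=
  ∑ i, (A i).transpose * A i

/-- `A` is `ε`-nearly doubly balanced:
`(1 - ε) (s/m) I ≼ ∑ᵢ Aᵢ Aᵢ* ≼ (1 + ε) (s/m) I` and
`(1 - ε) (s/n) I ≼ ∑ᵢ Aᵢ* Aᵢ ≼ (1 + ε) (s/n) I` in the Loewner order. -/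
def IsNearlyDoublyBalanced (ε : ℝ) (A : MatOperator m n k) : Prop :=
  (A.rowGram - ((1 - ε) * (A.size / m)) • (1 : Matrix (Fin m) (Fin m) ℝ)).PosSemidef ∧
  (((1 + ε) * (A.size / m)) • (1 : Matrix (Fin m) (Fin m) ℝ) - A.rowGram).PosSemidef ∧
  (A.colGram - ((1 - ε) * (A.size / n)) • (1 : Matrix (Fin n) (Fin n) ℝ)).PosSemidef ∧
  (((1 + ε) * (A.size / n)) • (1 : Matrix (Fin n) (Fin n) ℝ) - A.colGram).PosSemidef

/-- `A` is doubly balanced: the case `ε = 0`. -/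
def IsDoublyBalanced (A : MatOperator m n k) : Prop := A.IsNearlyDoublyBalanced 0

/-- The `m² × n²` matrix `M_A = ∑ᵢ Aᵢ ⊗ Aᵢ`. -/
def repMatrix (A : MatOperator m n k) : Matrix (Fin m × Fin m) (Fin n × Fin n) ℝ :=
  ∑ i, A i ⊗ₖ A i

/-- The second largest singular value (with multiplicity) of `M_A`; Mathlib's list of singular
values is indexed from zero, in descending order, and padded by zeros. -/
def sigmaTwo (A : MatOperator m n k) : ℝ :=
  (Matrix.toEuclideanLin A.repMatrix).singularValues 1

/-- `A` has a `lam`-spectral gap: `σ₂(M_A) ≤ (1 - lam) s(A) / √(mn)`. -/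
def HasSpectralGap (lam : ℝ) (A : MatOperator m n k) : Prop :=
  A.sigmaTwo ≤ (1 - lam) * (A.size / √((m : ℝ) * n))

/-- The error matrix `E = s I_m - m ∑ᵢ Aᵢ Aᵢ*`. -/
def errE (A : MatOperator m n k) : Matrix (Fin m) (Fin m) ℝ :=
  A.size • (1 : Matrix (Fin m) (Fin m) ℝ) - (m : ℝ) • A.rowGram

/-- The error matrix `F = s I_n - n ∑ᵢ Aᵢ* Aᵢ`. -/
def errF (A : MatOperator m n k) : Matrix (Fin n) (Fin n) ℝ :=
  A.size • (1 : Matrix (Fin n) (Fin n) ℝ) - (n : ℝ) • A.colGram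

/-- The right-hand side `E Aᵢ + Aᵢ F` of the gradient flow. -/
def flowField (A : MatOperator m n k) : MatOperator m n k :=
  fun i => A.errE * A i + A i * A.errF

/-- `X` solves the gradient flow `d/dt Aᵢ = E Aᵢ + Aᵢ F` on `[0, ∞)` with `X(0) = A` (entrywise
derivatives, one-sided at time `0`). The values of `X` at negative times are irrelevant. -/
def IsGradientFlow (A : MatOperator m n k) (X : ℝ → MatOperator m n k) : Prop :=
  X 0 = A ∧ ∀ t : ℝ, 0 ≤ t → ∀ i a b,
    HasDerivWithinAt (fun τ => X τ i a b) ((X t).flowField i a b) (Set.Ici 0) t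

end MatOperator

end

/-! Throughout, `‖·‖` on matrices is the operator norm, while `frobSq` is the squared Frobenius
norm. Write s for the size, E and F for the error matrices and Δ = ‖E‖_F²/m + ‖F‖_F²/n for the
imbalance. Along the flow s' = -2Δ and Δ' = -4 v², where v is the speed of the flow. If v² ≥ c²Δ at
all times, then Δ decays exponentially and √Δ decreases at least at the rate 2cv. Hence the
trajectory has length at most √Δ(0)/(2c), and it converges to a zero of Δ, that is, to a doubly
balanced operator. With c² = λs(0)/2 and Δ(0) ≤ 2(εs(0))² this is the asserted distance bound
(`IsGradientFlow.exists_limit`).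

The expansion `size_flowField` of v² consists of two positive terms of total about sΔ and of the
coupling 2∑⟨E, Aᵢ F Aᵢ*⟩. Since E and F are traceless, the spectral gap bounds the coupling form on
them at time 0 by about (1 - λ)s (`HasSpectralGap.coupling_sq_le`). The form drifts by at most a
multiple of s(0) ∫(‖E‖ + ‖F‖) (`IsGradientFlow.abs_coupling_sub_le`), so v² ≥ (λs(0)/2)Δ persists
while this integral and the relative loss of size are at most λ/64.

A bootstrap shows that these thresholds are never reached (`IsGradientFlow.errIntegral_lt`). Below
them, damping keeps the operator norms of E and F at most 2εs(0), and ‖E‖² ≤ mΔ decays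
exponentially. Integrating min(1, √m e^{-λst}) costs only a logarithm, so ∫‖E‖ is of order ε ln m /
λ, which is a small multiple of λ by hypothesis. The damped equation for F bounds ∫‖F‖ by ∫‖E‖ up to
constants, so that no ln n appears.

For m = 1 the logarithm vanishes and ε is not restricted. In that case E = 0, and a rotation makes
the columns orthogonal. Each column then moves along its own line, the product of the squared column
norms is conserved, and the inequality of arithmetic and geometric means gives the bound directly
(`IsGradientFlow.exists_limit_of_one_row`). -/

open scoped Matrix.Norms.L2Operator

/-! ### Algebra of the Frobenius inner product. -/

/-- The Frobenius inner product of two real matrices. -/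
def frobInner {α β : Type*} [Fintype α] [Fintype β] (P Q : Matrix α β ℝ) : ℝ :=
  ∑ a, ∑ b, P a b * Q a b

/-- The squared Frobenius norm of a real matrix. -/
def frobSq {α β : Type*} [Fintype α] [Fintype β] (P : Matrix α β ℝ) : ℝ := frobInner P P

section Frobenius

variable {α β γ : Type*} [Fintype α] [Fintype β] [Fintype γ]

theorem frobInner_eq_trace (P Q : Matrix α β ℝ) :
    frobInner P Q = (P.transpose * Q).trace := by
  simp only [frobInner, Matrix.trace, Matrix.diag, Matrix.mul_apply, Matrix.transpose_apply]
  exact Finset.sum_comm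

theorem frobInner_comm (P Q : Matrix α β ℝ) : frobInner P Q = frobInner Q P := by
  simp only [frobInner, mul_comm]

theorem frobInner_add_left (P P' Q : Matrix α β ℝ) :
    frobInner (P + P') Q = frobInner P Q + frobInner P' Q := by
  simp only [frobInner, Matrix.add_apply, add_mul, Finset.sum_add_distrib]

theorem frobInner_add_right (P Q Q' : Matrix α β ℝ) :
    frobInner P (Q + Q') = frobInner P Q + frobInner P Q' := by
  simp only [frobInner, Matrix.add_apply, mul_add, Finset.sum_add_distrib]

theorem frobInner_smul_left (c : ℝ) (P Q : Matrix α β ℝ) :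
    frobInner (c • P) Q = c * frobInner P Q := by
  simp only [frobInner, Matrix.smul_apply, smul_eq_mul, Finset.mul_sum, mul_assoc]

theorem frobInner_smul_right (c : ℝ) (P Q : Matrix α β ℝ) :
    frobInner P (c • Q) = c * frobInner P Q := by
  rw [frobInner_comm, frobInner_smul_left, frobInner_comm]

theorem frobInner_sub_right (P Q Q' : Matrix α β ℝ) :
    frobInner P (Q - Q') = frobInner P Q - frobInner P Q' := by
  simp only [frobInner, Matrix.sub_apply, mul_sub, Finset.sum_sub_distrib]

theorem frobInner_sum_right {ι : Type*} (s : Finset ι) (P : Matrix α β ℝ)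
    (Q : ι → Matrix α β ℝ) : frobInner P (∑ i ∈ s, Q i) = ∑ i ∈ s, frobInner P (Q i) := by
  simp only [frobInner_eq_trace, Matrix.mul_sum, Matrix.trace_sum]

theorem frobInner_transpose (P Q : Matrix α β ℝ) :
    frobInner P.transpose Q.transpose = frobInner P Q := by
  simp only [frobInner, Matrix.transpose_apply]
  exact Finset.sum_comm

theorem frobInner_mul_left (X : Matrix α β ℝ) (Y : Matrix β γ ℝ) (Z : Matrix α γ ℝ) :
    frobInner (X * Y) Z = frobInner Y (X.transpose * Z) := by
  simp only [frobInner_eq_trace, Matrix.transpose_mul, Matrix.mul_assoc]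

theorem frobInner_mul_right (X : Matrix α β ℝ) (Y : Matrix β γ ℝ) (Z : Matrix α γ ℝ) :
    frobInner (X * Y) Z = frobInner X (Z * Y.transpose) := by
  rw [← frobInner_transpose (X * Y), Matrix.transpose_mul, frobInner_mul_left,
    ← frobInner_transpose]
  simp [Matrix.transpose_mul]

theorem frobInner_one_right [DecidableEq α] (P : Matrix α α ℝ) :
    frobInner P 1 = P.trace := by
  rw [frobInner_eq_trace, Matrix.mul_one, Matrix.trace_transpose]

theorem frobSq_eq_sum (P : Matrix α β ℝ) : frobSq P = ∑ a, ∑ b, (P a b) ^ 2 := by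
  simp only [frobSq, frobInner, sq]

theorem frobSq_nonneg (P : Matrix α β ℝ) : 0 ≤ frobSq P := by
  rw [frobSq_eq_sum]
  positivity

theorem frobSq_transpose (P : Matrix α β ℝ) : frobSq P.transpose = frobSq P :=
  frobInner_transpose P P

theorem frobSq_eq_zero {P : Matrix α β ℝ} : frobSq P = 0 ↔ P = 0 := by
  constructor
  · intro h
    rw [frobSq_eq_sum, Finset.sum_eq_zero_iff_of_nonneg (fun _ _ => by positivity)] at h
    ext a b
    have h2 := h a (Finset.mem_univ a)
    rw [Finset.sum_eq_zero_iff_of_nonneg (fun _ _ => by positivity)] at h2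
    simpa using h2 b (Finset.mem_univ b)
  · rintro rfl
    simp [frobSq_eq_sum]

theorem frobInner_sq_le (P Q : Matrix α β ℝ) : frobInner P Q ^ 2 ≤ frobSq P * frobSq Q := by
  simp only [frobSq_eq_sum, frobInner, ← Fintype.sum_prod_type']
  exact Finset.sum_mul_sq_le_sq_mul_sq _ _ _

theorem sum_frobInner_sq_le {ι : Type*} (s : Finset ι) (P Q : ι → Matrix α β ℝ) :
    (∑ i ∈ s, frobInner (P i) (Q i)) ^ 2 ≤
      (∑ i ∈ s, frobSq (P i)) * ∑ i ∈ s, frobSq (Q i) := by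
  simp only [frobSq_eq_sum, frobInner, ← Fintype.sum_prod_type']
  rw [Finset.sum_sigma', Finset.sum_sigma', Finset.sum_sigma']
  exact Finset.sum_mul_sq_le_sq_mul_sq _ _ _

theorem frobSq_add (P Q : Matrix α β ℝ) :
    frobSq (P + Q) = frobSq P + 2 * frobInner P Q + frobSq Q := by
  simp only [frobSq, frobInner_add_left, frobInner_add_right, frobInner_comm Q P]
  ring

theorem frobSq_smul (c : ℝ) (P : Matrix α β ℝ) : frobSq (c • P) = c ^ 2 * frobSq P := by
  simp only [frobSq, frobInner_smul_left, frobInner_smul_right]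
  ring

end Frobenius

/-! ### Entrywise differentiation of matrix-valued functions. -/

section MatrixCalculus

variable {α β γ : Type*} [Fintype α] [Fintype β] [Fintype γ]
  [DecidableEq α] [DecidableEq β] [DecidableEq γ]

theorem Matrix.hasDerivWithinAt_of_entries {M : ℝ → Matrix α β ℝ} {M' : Matrix α β ℝ}
    {s : Set ℝ} {t : ℝ}
    (h : ∀ a b, HasDerivWithinAt (fun τ => M τ a b) (M' a b) s t) :
    HasDerivWithinAt M M' s t := by
  have h1 : HasDerivWithinAt (fun τ => ∑ a, ∑ b, M τ a b • Matrix.single a b (1 : ℝ))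
      (∑ a, ∑ b, M' a b • Matrix.single a b (1 : ℝ)) s t :=
    HasDerivWithinAt.fun_sum fun a _ => HasDerivWithinAt.fun_sum fun b _ =>
      (h a b).smul_const _
  have key : ∀ N : Matrix α β ℝ, ∑ a, ∑ b, N a b • Matrix.single a b (1 : ℝ) = N := by
    intro N
    conv_rhs => rw [Matrix.matrix_eq_sum_single N]
    simp [Matrix.smul_single]
  simpa only [key] using h1

theorem Matrix.HasDerivWithinAt.entry {M : ℝ → Matrix α β ℝ} {M' : Matrix α β ℝ}
    {s : Set ℝ} {t : ℝ} (h : HasDerivWithinAt M M' s t) (a : α) (b : β) :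
    HasDerivWithinAt (fun τ => M τ a b) (M' a b) s t :=
  (LinearMap.toContinuousLinearMap
    (Matrix.entryLinearMap ℝ ℝ a b)).hasFDerivAt.comp_hasDerivWithinAt t h

theorem Matrix.HasDerivWithinAt.mul {M : ℝ → Matrix α β ℝ} {N : ℝ → Matrix β γ ℝ}
    {M' : Matrix α β ℝ} {N' : Matrix β γ ℝ} {s : Set ℝ} {t : ℝ}
    (hM : HasDerivWithinAt M M' s t) (hN : HasDerivWithinAt N N' s t) :
    HasDerivWithinAt (fun τ => M τ * N τ) (M' * N t + M t * N') s t := by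
  refine Matrix.hasDerivWithinAt_of_entries fun a c => ?_
  simp only [Matrix.mul_apply, Matrix.add_apply, ← Finset.sum_add_distrib]
  exact HasDerivWithinAt.fun_sum fun b _ =>
    (Matrix.HasDerivWithinAt.entry hM a b).mul (Matrix.HasDerivWithinAt.entry hN b c)

theorem Matrix.HasDerivWithinAt.transpose {M : ℝ → Matrix α β ℝ} {M' : Matrix α β ℝ}
    {s : Set ℝ} {t : ℝ} (hM : HasDerivWithinAt M M' s t) :
    HasDerivWithinAt (fun τ => (M τ).transpose) M'.transpose s t :=
  Matrix.hasDerivWithinAt_of_entries fun a c => Matrix.HasDerivWithinAt.entry hM c a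

theorem HasDerivWithinAt.frobInner {M N : ℝ → Matrix α β ℝ} {M' N' : Matrix α β ℝ}
    {s : Set ℝ} {t : ℝ} (hM : HasDerivWithinAt M M' s t) (hN : HasDerivWithinAt N N' s t) :
    HasDerivWithinAt (fun τ => frobInner (M τ) (N τ))
      (frobInner M' (N t) + frobInner (M t) N') s t := by
  simp only [_root_.frobInner, ← Finset.sum_add_distrib]
  exact HasDerivWithinAt.fun_sum fun a _ => HasDerivWithinAt.fun_sum fun b _ =>
    (Matrix.HasDerivWithinAt.entry hM a b).mul (Matrix.HasDerivWithinAt.entry hN a b)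

theorem HasDerivWithinAt.frobSq {M : ℝ → Matrix α β ℝ} {M' : Matrix α β ℝ}
    {s : Set ℝ} {t : ℝ} (hM : HasDerivWithinAt M M' s t) :
    HasDerivWithinAt (fun τ => frobSq (M τ)) (2 * _root_.frobInner (M t) M') s t := by
  have h := hM.frobInner hM
  rw [frobInner_comm M', ← two_mul] at h
  exact h

end MatrixCalculus

/-! ### Gram matrices, error matrices and the coupling form. -/

namespace MatOperator

variable {m n k : ℕ}

theorem size_eq_sum_frobSq (A : MatOperator m n k) : A.size = ∑ i, frobSq (A i) := by
  simp only [size, frobSq_eq_sum]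

theorem size_nonneg (A : MatOperator m n k) : 0 ≤ A.size := by
  unfold size
  positivity

theorem trace_rowGram (A : MatOperator m n k) : A.rowGram.trace = A.size := by
  simp only [rowGram, Matrix.trace_sum, size_eq_sum_frobSq]
  refine Finset.sum_congr rfl fun i _ => ?_
  rw [← frobSq_transpose, frobSq, frobInner_eq_trace, Matrix.transpose_transpose]

theorem trace_colGram (A : MatOperator m n k) : A.colGram.trace = A.size := by
  simp only [colGram, Matrix.trace_sum, size_eq_sum_frobSq]
  refine Finset.sum_congr rfl fun i _ => ?_
  rw [frobSq, frobInner_eq_trace]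

theorem transpose_rowGram (A : MatOperator m n k) : A.rowGram.transpose = A.rowGram := by
  simp [rowGram, Matrix.transpose_sum]

theorem transpose_colGram (A : MatOperator m n k) : A.colGram.transpose = A.colGram := by
  simp [colGram, Matrix.transpose_sum]

theorem transpose_errE (A : MatOperator m n k) : A.errE.transpose = A.errE := by
  simp [errE, transpose_rowGram]

theorem transpose_errF (A : MatOperator m n k) : A.errF.transpose = A.errF := by
  simp [errF, transpose_colGram]

theorem trace_errE (A : MatOperator m n k) : A.errE.trace = 0 := by
  simp only [errE, Matrix.trace_sub, Matrix.trace_smul, Matrix.trace_one, trace_rowGram,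
    Fintype.card_fin, smul_eq_mul]
  ring

theorem trace_errF (A : MatOperator m n k) : A.errF.trace = 0 := by
  simp only [errF, Matrix.trace_sub, Matrix.trace_smul, Matrix.trace_one, trace_colGram,
    Fintype.card_fin, smul_eq_mul]
  ring

/-- The bilinear form `(P, Q) ↦ ∑ᵢ ⟨P, Aᵢ Q Aᵢ*⟩` represented by the matrix `M_A`. -/
def coupling (A : MatOperator m n k) (P : Matrix (Fin m) (Fin m) ℝ)
    (Q : Matrix (Fin n) (Fin n) ℝ) : ℝ :=
  ∑ i, frobInner P (A i * Q * (A i).transpose)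

/-- The map `Q ↦ ∑ᵢ Aᵢ Q Aᵢ*`. -/
def rowMap (A : MatOperator m n k) (Q : Matrix (Fin n) (Fin n) ℝ) : Matrix (Fin m) (Fin m) ℝ :=
  ∑ i, A i * Q * (A i).transpose

/-- The map `P ↦ ∑ᵢ Aᵢ* P Aᵢ`. -/
def colMap (A : MatOperator m n k) (P : Matrix (Fin m) (Fin m) ℝ) : Matrix (Fin n) (Fin n) ℝ :=
  ∑ i, (A i).transpose * P * A i

theorem frobInner_rowMap (A : MatOperator m n k) (P : Matrix (Fin m) (Fin m) ℝ)
    (Q : Matrix (Fin n) (Fin n) ℝ) : frobInner P (A.rowMap Q) = A.coupling P Q := by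
  rw [rowMap, coupling, frobInner_sum_right]

theorem frobInner_colMap (A : MatOperator m n k) (P : Matrix (Fin m) (Fin m) ℝ)
    (Q : Matrix (Fin n) (Fin n) ℝ) : frobInner Q (A.colMap P) = A.coupling P Q := by
  rw [colMap, coupling, frobInner_sum_right]
  refine Finset.sum_congr rfl fun i _ => ?_
  rw [frobInner_comm, Matrix.mul_assoc, frobInner_mul_left, frobInner_mul_right,
    Matrix.transpose_transpose]

/-- The imbalance `‖E‖_F² / m + ‖F‖_F² / n`. -/
noncomputable def imbalance (A : MatOperator m n k) : ℝ := frobSq A.errE / m + frobSq A.errF / n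

theorem imbalance_nonneg (A : MatOperator m n k) : 0 ≤ A.imbalance :=
  add_nonneg (div_nonneg (frobSq_nonneg _) (Nat.cast_nonneg _))
    (div_nonneg (frobSq_nonneg _) (Nat.cast_nonneg _))

theorem sum_frobSq_mul_left (A : MatOperator m n k) (P : Matrix (Fin m) (Fin m) ℝ) :
    ∑ i, frobSq (P * A i) = frobInner P (P * A.rowGram) := by
  rw [rowGram, Matrix.mul_sum, frobInner_sum_right]
  refine Finset.sum_congr rfl fun i _ => ?_
  rw [frobSq, frobInner_mul_right, Matrix.mul_assoc]

theorem sum_frobSq_mul_right (A : MatOperator m n k) (Q : Matrix (Fin n) (Fin n) ℝ) :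
    ∑ i, frobSq (A i * Q) = frobInner Q (A.colGram * Q) := by
  rw [colGram, Matrix.sum_mul, frobInner_sum_right]
  refine Finset.sum_congr rfl fun i _ => ?_
  rw [frobSq, frobInner_mul_left, Matrix.mul_assoc]

theorem sum_frobInner_mul_mul (A : MatOperator m n k) (P : Matrix (Fin m) (Fin m) ℝ)
    (Q : Matrix (Fin n) (Fin n) ℝ) :
    ∑ i, frobInner (P * A i) (A i * Q) = A.coupling P Q := by
  rw [coupling]
  exact Finset.sum_congr rfl fun i _ => frobInner_mul_right _ _ _

/-- The first two terms are sums of squares; only the coupling can be negative. Bounding it is the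
whole task of the spectral gap. -/
theorem size_flowField (A : MatOperator m n k) :
    A.flowField.size = frobInner A.errE (A.errE * A.rowGram) +
      frobInner A.errF (A.colGram * A.errF) + 2 * A.coupling A.errE A.errF := by
  rw [size_eq_sum_frobSq]
  simp only [flowField, frobSq_add, Finset.sum_add_distrib, ← Finset.mul_sum,
    sum_frobSq_mul_left, sum_frobSq_mul_right, sum_frobInner_mul_mul]
  ring

theorem nat_smul_rowGram (A : MatOperator m n k) :
    (m : ℝ) • A.rowGram = A.size • (1 : Matrix (Fin m) (Fin m) ℝ) - A.errE := by
  simp [errE]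

theorem nat_smul_colGram (A : MatOperator m n k) :
    (n : ℝ) • A.colGram = A.size • (1 : Matrix (Fin n) (Fin n) ℝ) - A.errF := by
  simp [errF]

theorem frobInner_errE_rowGram (hm : 0 < m) (A : MatOperator m n k) :
    frobInner A.errE A.rowGram = -(frobSq A.errE / m) := by
  have hm' : (m : ℝ) ≠ 0 := by positivity
  have h : (m : ℝ) * frobInner A.errE A.rowGram = -frobSq A.errE := by
    rw [← frobInner_smul_right, nat_smul_rowGram, frobInner_sub_right, frobInner_smul_right,
      frobInner_one_right, trace_errE, frobSq]
    ring
  field_simp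
  linarith

theorem frobInner_errF_colGram (hn : 0 < n) (A : MatOperator m n k) :
    frobInner A.errF A.colGram = -(frobSq A.errF / n) := by
  have hn' : (n : ℝ) ≠ 0 := by positivity
  have h : (n : ℝ) * frobInner A.errF A.colGram = -frobSq A.errF := by
    rw [← frobInner_smul_right, nat_smul_colGram, frobInner_sub_right, frobInner_smul_right,
      frobInner_one_right, trace_errF, frobSq]
    ring
  field_simp
  linarith

/-- E is traceless, so paired with the row Gram matrix it sees only the part -E/m of that matrix;
the same holds for F and the column Gram matrix. Consequently the size decreases along the flow at
the rate 2Δ. -/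
theorem sum_frobInner_flowField (hm : 0 < m) (hn : 0 < n) (A : MatOperator m n k) :
    ∑ i, frobInner (A i) (A.flowField i) = -A.imbalance := by
  have h1 : ∑ i, frobInner (A i) (A.errE * A i) = frobInner A.errE A.rowGram := by
    rw [rowGram, frobInner_sum_right]
    refine Finset.sum_congr rfl fun i _ => ?_
    rw [frobInner_comm, frobInner_mul_right]
  have h2 : ∑ i, frobInner (A i) (A i * A.errF) = frobInner A.errF A.colGram := by
    rw [colGram, frobInner_sum_right]
    refine Finset.sum_congr rfl fun i _ => ?_
    rw [frobInner_comm, frobInner_mul_left]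
  simp only [flowField, frobInner_add_right, Finset.sum_add_distrib, h1, h2,
    frobInner_errE_rowGram hm, frobInner_errF_colGram hn, imbalance]
  ring

theorem sum_flowField_mul_transpose (A : MatOperator m n k) :
    ∑ i, (A.flowField i * (A i).transpose + A i * (A.flowField i).transpose) =
      A.errE * A.rowGram + A.rowGram * A.errE + (2 : ℝ) • A.rowMap A.errF := by
  have h : ∀ i, A.flowField i * (A i).transpose + A i * (A.flowField i).transpose =
      A.errE * (A i * (A i).transpose) + A i * (A i).transpose * A.errE +
        (2 : ℝ) • (A i * A.errF * (A i).transpose) := by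
    intro i
    simp only [flowField, Matrix.add_mul, Matrix.transpose_add, Matrix.mul_add,
      Matrix.transpose_mul, transpose_errE, transpose_errF, Matrix.mul_assoc, two_smul]
    abel
  simp only [h, Finset.sum_add_distrib, ← Finset.smul_sum, ← Matrix.mul_sum, ← Matrix.sum_mul,
    rowMap, rowGram]

theorem sum_transpose_mul_flowField (A : MatOperator m n k) :
    ∑ i, ((A.flowField i).transpose * A i + (A i).transpose * A.flowField i) =
      A.errF * A.colGram + A.colGram * A.errF + (2 : ℝ) • A.colMap A.errE := by
  have h : ∀ i, (A.flowField i).transpose * A i + (A i).transpose * A.flowField i =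
      A.errF * ((A i).transpose * A i) + (A i).transpose * A i * A.errF +
        (2 : ℝ) • ((A i).transpose * A.errE * A i) := by
    intro i
    simp only [flowField, Matrix.add_mul, Matrix.transpose_add, Matrix.mul_add,
      Matrix.transpose_mul, transpose_errE, transpose_errF, Matrix.mul_assoc, two_smul]
    abel
  simp only [h, Finset.sum_add_distrib, ← Finset.smul_sum, ← Matrix.mul_sum, ← Matrix.sum_mul,
    colMap, colGram]

/-- `E` commutes with the row Gram matrix. -/
theorem errE_mul_rowGram (A : MatOperator m n k) :
    A.errE * A.rowGram = A.rowGram * A.errE := by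
  simp [errE, Matrix.sub_mul, Matrix.mul_sub]

theorem errF_mul_colGram (A : MatOperator m n k) :
    A.errF * A.colGram = A.colGram * A.errF := by
  simp [errF, Matrix.sub_mul, Matrix.mul_sub]

/-! ### Evolution of size, error matrices, imbalance and coupling along the flow. -/

section Flow

variable {A : MatOperator m n k} {X : ℝ → MatOperator m n k}

theorem IsGradientFlow.hasDerivWithinAt (h : A.IsGradientFlow X) {t : ℝ} (ht : 0 ≤ t)
    (i : Fin k) :
    HasDerivWithinAt (fun τ => X τ i) ((X t).flowField i) (Set.Ici 0) t :=
  Matrix.hasDerivWithinAt_of_entries fun a b => h.2 t ht i a b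

theorem IsGradientFlow.hasDerivWithinAt_size (hm : 0 < m) (hn : 0 < n)
    (h : A.IsGradientFlow X) {t : ℝ} (ht : 0 ≤ t) :
    HasDerivWithinAt (fun τ => (X τ).size) (-2 * (X t).imbalance) (Set.Ici 0) t := by
  have h1 : HasDerivWithinAt (fun τ => ∑ i, frobSq (X τ i))
      (∑ i, 2 * frobInner (X t i) ((X t).flowField i)) (Set.Ici 0) t :=
    HasDerivWithinAt.fun_sum fun i _ => (h.hasDerivWithinAt ht i).frobSq
  rw [← Finset.mul_sum, sum_frobInner_flowField hm hn] at h1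
  simp only [size_eq_sum_frobSq]
  convert h1 using 1
  ring

theorem IsGradientFlow.hasDerivWithinAt_rowGram (h : A.IsGradientFlow X) {t : ℝ} (ht : 0 ≤ t) :
    HasDerivWithinAt (fun τ => (X τ).rowGram)
      ((X t).errE * (X t).rowGram + (X t).rowGram * (X t).errE +
        (2 : ℝ) • (X t).rowMap (X t).errF) (Set.Ici 0) t := by
  rw [← sum_flowField_mul_transpose]
  exact HasDerivWithinAt.fun_sum fun i _ => Matrix.HasDerivWithinAt.mul
    (h.hasDerivWithinAt ht i) (Matrix.HasDerivWithinAt.transpose (h.hasDerivWithinAt ht i))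

theorem IsGradientFlow.hasDerivWithinAt_colGram (h : A.IsGradientFlow X) {t : ℝ} (ht : 0 ≤ t) :
    HasDerivWithinAt (fun τ => (X τ).colGram)
      ((X t).errF * (X t).colGram + (X t).colGram * (X t).errF +
        (2 : ℝ) • (X t).colMap (X t).errE) (Set.Ici 0) t := by
  rw [← sum_transpose_mul_flowField]
  exact HasDerivWithinAt.fun_sum fun i _ => Matrix.HasDerivWithinAt.mul
    (Matrix.HasDerivWithinAt.transpose (h.hasDerivWithinAt ht i)) (h.hasDerivWithinAt ht i)

/-- The time derivative of `E` along the flow, apart from the damping term `-2 s E`. -/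
noncomputable def forceE (A : MatOperator m n k) : Matrix (Fin m) (Fin m) ℝ :=
  (2 : ℝ) • (A.errE * A.errE) - (2 * A.imbalance) • (1 : Matrix (Fin m) (Fin m) ℝ) -
    (2 * (m : ℝ)) • A.rowMap A.errF

/-- The time derivative of `F` along the flow, apart from the damping term `-2 s F`. -/
noncomputable def forceF (A : MatOperator m n k) : Matrix (Fin n) (Fin n) ℝ :=
  (2 : ℝ) • (A.errF * A.errF) - (2 * A.imbalance) • (1 : Matrix (Fin n) (Fin n) ℝ) -
    (2 * (n : ℝ)) • A.colMap A.errE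

/-- The damping comes from replacing m times the row Gram matrix by sI - E, which turns each of the
two products with E into sE - E². -/
theorem damping_add_forceE (A : MatOperator m n k) :
    (-2 * A.imbalance) • (1 : Matrix (Fin m) (Fin m) ℝ) -
      (m : ℝ) • (A.errE * A.rowGram + A.rowGram * A.errE + (2 : ℝ) • A.rowMap A.errF) =
        -(2 * A.size) • A.errE + A.forceE := by
  have h1 : (m : ℝ) • (A.errE * A.rowGram) = A.size • A.errE - A.errE * A.errE := by
    rw [← Matrix.mul_smul, nat_smul_rowGram, Matrix.mul_sub, Matrix.mul_smul, Matrix.mul_one]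
  have h2 : (m : ℝ) • (A.rowGram * A.errE) = A.size • A.errE - A.errE * A.errE := by
    rw [← errE_mul_rowGram, h1]
  rw [smul_add, smul_add, h1, h2, forceE]
  module

theorem damping_add_forceF (A : MatOperator m n k) :
    (-2 * A.imbalance) • (1 : Matrix (Fin n) (Fin n) ℝ) -
      (n : ℝ) • (A.errF * A.colGram + A.colGram * A.errF + (2 : ℝ) • A.colMap A.errE) =
        -(2 * A.size) • A.errF + A.forceF := by
  have h1 : (n : ℝ) • (A.errF * A.colGram) = A.size • A.errF - A.errF * A.errF := by
    rw [← Matrix.mul_smul, nat_smul_colGram, Matrix.mul_sub, Matrix.mul_smul, Matrix.mul_one]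
  have h2 : (n : ℝ) • (A.colGram * A.errF) = A.size • A.errF - A.errF * A.errF := by
    rw [← errF_mul_colGram, h1]
  rw [smul_add, smul_add, h1, h2, forceF]
  module

theorem IsGradientFlow.hasDerivWithinAt_errE (hm : 0 < m) (hn : 0 < n)
    (h : A.IsGradientFlow X) {t : ℝ} (ht : 0 ≤ t) :
    HasDerivWithinAt (fun τ => (X τ).errE)
      (-(2 * (X t).size) • (X t).errE + (X t).forceE) (Set.Ici 0) t :=
  (((h.hasDerivWithinAt_size hm hn ht).smul_const
    (1 : Matrix (Fin m) (Fin m) ℝ)).fun_sub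
      ((h.hasDerivWithinAt_rowGram ht).const_smul (m : ℝ))).congr_deriv
    (damping_add_forceE (X t))

theorem IsGradientFlow.hasDerivWithinAt_errF (hm : 0 < m) (hn : 0 < n)
    (h : A.IsGradientFlow X) {t : ℝ} (ht : 0 ≤ t) :
    HasDerivWithinAt (fun τ => (X τ).errF)
      (-(2 * (X t).size) • (X t).errF + (X t).forceF) (Set.Ici 0) t :=
  (((h.hasDerivWithinAt_size hm hn ht).smul_const
    (1 : Matrix (Fin n) (Fin n) ℝ)).fun_sub
      ((h.hasDerivWithinAt_colGram ht).const_smul (n : ℝ))).congr_deriv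
    (damping_add_forceF (X t))

/-- The multiple of the identity in the force is orthogonal to the traceless E. The right-hand side
is written in the terms of `size_flowField`, ready for the derivative of the imbalance. -/
theorem frobInner_errE_deriv (A : MatOperator m n k) :
    frobInner A.errE (-(2 * A.size) • A.errE + A.forceE) =
      -(2 * m) * (frobInner A.errE (A.errE * A.rowGram) + A.coupling A.errE A.errF) := by
  have h : (m : ℝ) * frobInner A.errE (A.errE * A.rowGram) =
      A.size * frobSq A.errE - frobInner A.errE (A.errE * A.errE) := by
    rw [← frobInner_smul_right, ← Matrix.mul_smul, nat_smul_rowGram, Matrix.mul_sub,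
      Matrix.mul_smul, Matrix.mul_one, frobInner_sub_right, frobInner_smul_right, frobSq]
  simp only [forceE, frobInner_add_right, frobInner_sub_right, frobInner_smul_right,
    frobInner_one_right, trace_errE, frobInner_rowMap]
  rw [← frobSq]
  linear_combination 2 * h

theorem frobInner_errF_deriv (A : MatOperator m n k) :
    frobInner A.errF (-(2 * A.size) • A.errF + A.forceF) =
      -(2 * n) * (frobInner A.errF (A.colGram * A.errF) + A.coupling A.errE A.errF) := by
  have h : (n : ℝ) * frobInner A.errF (A.colGram * A.errF) =
      A.size * frobSq A.errF - frobInner A.errF (A.errF * A.errF) := by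
    rw [← frobInner_smul_right, ← Matrix.smul_mul, nat_smul_colGram, Matrix.sub_mul,
      Matrix.smul_mul, Matrix.one_mul, frobInner_sub_right, frobInner_smul_right, frobSq]
  simp only [forceF, frobInner_add_right, frobInner_sub_right, frobInner_smul_right,
    frobInner_one_right, trace_errF, frobInner_colMap]
  rw [← frobSq]
  linear_combination 2 * h

/-- The weights 1/m and 1/n cancel the factors m and n in the derivatives of E and F, and the sum is
exactly -4 times the expansion of `size_flowField`. So Δ/4 acts as the potential of the flow. -/
theorem IsGradientFlow.hasDerivWithinAt_imbalance (hm : 0 < m) (hn : 0 < n)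
    (h : A.IsGradientFlow X) {t : ℝ} (ht : 0 ≤ t) :
    HasDerivWithinAt (fun τ => (X τ).imbalance) (-4 * (X t).flowField.size) (Set.Ici 0) t := by
  have hm' : (m : ℝ) ≠ 0 := by positivity
  have hn' : (n : ℝ) ≠ 0 := by positivity
  have h1 := ((h.hasDerivWithinAt_errE hm hn ht).frobSq.div_const (m : ℝ)).fun_add
    ((h.hasDerivWithinAt_errF hm hn ht).frobSq.div_const (n : ℝ))
  refine h1.congr_deriv ?_
  rw [frobInner_errE_deriv, frobInner_errF_deriv, size_flowField]
  field_simp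
  ring

/-- All factors E and F are moved onto the arguments, so the derivative is again made of values of
the coupling form and is bounded by the same Cauchy-Schwarz estimate. -/
theorem IsGradientFlow.hasDerivWithinAt_coupling (h : A.IsGradientFlow X) {t : ℝ} (ht : 0 ≤ t)
    (P : Matrix (Fin m) (Fin m) ℝ) (Q : Matrix (Fin n) (Fin n) ℝ) :
    HasDerivWithinAt (fun τ => (X τ).coupling P Q)
      ((X t).coupling ((X t).errE * P) Q + (X t).coupling (P * (X t).errE) Q +
        ((X t).coupling P ((X t).errF * Q) + (X t).coupling P (Q * (X t).errF)))
      (Set.Ici 0) t := by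
  have h1 : HasDerivWithinAt (fun τ => (X τ).coupling P Q)
      (∑ i, (frobInner (0 : Matrix (Fin m) (Fin m) ℝ) (X t i * Q * (X t i).transpose) +
        frobInner P (((X t).flowField i * Q +
          X t i * (0 : Matrix (Fin n) (Fin n) ℝ)) * (X t i).transpose +
          X t i * Q * ((X t).flowField i).transpose))) (Set.Ici 0) t :=
    HasDerivWithinAt.fun_sum fun i _ => (hasDerivWithinAt_const t _ P).frobInner
      (Matrix.HasDerivWithinAt.mul (Matrix.HasDerivWithinAt.mul (h.hasDerivWithinAt ht i)
        (hasDerivWithinAt_const t _ Q))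
        (Matrix.HasDerivWithinAt.transpose (h.hasDerivWithinAt ht i)))
  refine h1.congr_deriv ?_
  simp only [coupling, ← Finset.sum_add_distrib]
  refine Finset.sum_congr rfl fun i _ => ?_
  have e1 : frobInner ((X t).errE * P) (X t i * Q * (X t i).transpose) =
      frobInner P ((X t).errE * (X t i * Q * (X t i).transpose)) := by
    rw [frobInner_mul_left, transpose_errE]
  have e2 : frobInner (P * (X t).errE) (X t i * Q * (X t i).transpose) =
      frobInner P (X t i * Q * (X t i).transpose * (X t).errE) := by
    rw [frobInner_mul_right, transpose_errE]
  rw [e1, e2, ← frobInner_add_right, ← frobInner_add_right, ← frobInner_add_right]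
  have e3 : frobInner (0 : Matrix (Fin m) (Fin m) ℝ) (X t i * Q * (X t i).transpose) = 0 := by
    simp [frobInner]
  rw [e3, zero_add]
  congr 1
  simp only [flowField, Matrix.add_mul, Matrix.mul_zero, add_zero, Matrix.transpose_add,
    Matrix.transpose_mul, transpose_errE, transpose_errF, Matrix.mul_add, Matrix.mul_assoc]
  abel

end Flow

end MatOperator

/-! ### Comparison principle for damped equations. -/

/-- A norm comparison for damped equations `f' = -a f + g`: the norm of `f` stays below every
function `B` with `B' ≥ -a ‖f‖ + ‖g‖`. -/
theorem norm_le_of_damped {V : Type*} [NormedAddCommGroup V] [NormedSpace ℝ V]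
    {f g : ℝ → V} {a B B' : ℝ → ℝ} {r T : ℝ} (hf : ContinuousOn f (Set.Icc r T))
    (hf' : ∀ t ∈ Set.Ico r T, HasDerivWithinAt f (-(a t) • f t + g t) (Set.Ici t) t)
    (hB : ContinuousOn B (Set.Icc r T))
    (hB' : ∀ t ∈ Set.Ico r T, HasDerivWithinAt B (B' t) (Set.Ici t) t)
    (h0 : ‖f r‖ ≤ B r) (hle : ∀ t ∈ Set.Ico r T, -(a t) * ‖f t‖ + ‖g t‖ ≤ B' t) :
    ∀ t ∈ Set.Icc r T, ‖f t‖ ≤ B t := by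
  refine fun t ht => image_le_of_liminf_slope_right_le_deriv_boundary hf.norm h0 hB hB' ?_ ht
  intro x hx ρ hρ
  refine Eventually.frequently ?_
  have hlt : -(a x) * ‖f x‖ + ‖g x‖ < ρ := (hle x hx).trans_lt hρ
  set δ := ρ - (-(a x) * ‖f x‖ + ‖g x‖) with hδ
  have hδpos : 0 < δ := by linarith
  have h1 := (hasDerivWithinAt_iff_isLittleO.1 (hf' x hx)).def (half_pos hδpos)
  have h2 : ∀ᶠ z in 𝓝[>] x, ‖f z - f x - (z - x) • (-(a x) • f x + g x)‖ ≤ δ / 2 * ‖z - x‖ :=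
    h1.filter_mono (nhdsWithin_mono x Set.Ioi_subset_Ici_self)
  -- For short steps the factor 1 - (z - x) a(x) is nonnegative, so it comes out of the norm with
  -- its sign. The damping survives and the norm need not be differentiated.
  have h3 : ∀ᶠ z in 𝓝[>] x, (z - x) * |a x| < 1 := by
    have hc : Continuous fun z : ℝ => (z - x) * |a x| := by fun_prop
    have := hc.tendsto x
    simp only [sub_self, zero_mul] at this
    exact (this.eventually (gt_mem_nhds one_pos)).filter_mono nhdsWithin_le_nhds
  filter_upwards [h2, h3, self_mem_nhdsWithin] with z hz1 hz2 hz3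
  have hpos : 0 < z - x := sub_pos.2 hz3
  have hax : 0 ≤ 1 - (z - x) * a x := by
    have := mul_le_mul_of_nonneg_left (le_abs_self (a x)) hpos.le
    linarith
  have hdec : f z = (1 - (z - x) * a x) • f x + (z - x) • g x +
      (f z - f x - (z - x) • (-(a x) • f x + g x)) := by module
  have hn : ‖f z‖ ≤ (1 - (z - x) * a x) * ‖f x‖ + (z - x) * ‖g x‖ + δ / 2 * (z - x) := by
    rw [Real.norm_of_nonneg hpos.le] at hz1
    calc ‖f z‖ ≤ ‖(1 - (z - x) * a x) • f x‖ + ‖(z - x) • g x‖ +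
        ‖f z - f x - (z - x) • (-(a x) • f x + g x)‖ := by
          conv_lhs => rw [hdec]
          exact norm_add₃_le
      _ ≤ _ := by
          rw [norm_smul, norm_smul, Real.norm_of_nonneg hax, Real.norm_of_nonneg hpos.le]
          linarith
  rw [slope_def_field, div_lt_iff₀ hpos]
  nlinarith

/-! ### Convergence of the flow from a lower bound on its speed. -/

namespace MatOperator

variable {m n k : ℕ}

/-- An operator as a vector of a Euclidean space. -/
def vec (A : MatOperator m n k) : EuclideanSpace ℝ (Fin k × Fin m × Fin n) :=
  WithLp.toLp 2 fun p => A p.1 p.2.1 p.2.2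

theorem norm_vec_sub_sq (A B : MatOperator m n k) : ‖A.vec - B.vec‖ ^ 2 = A.sqDist B := by
  rw [EuclideanSpace.norm_sq_eq]
  simp only [vec, sqDist, Fintype.sum_prod_type, PiLp.sub_apply, Real.norm_eq_abs, sq_abs]

theorem norm_vec_sq (A : MatOperator m n k) : ‖A.vec‖ ^ 2 = A.size := by
  rw [EuclideanSpace.norm_sq_eq]
  simp only [vec, size, Fintype.sum_prod_type, Real.norm_eq_abs, sq_abs]

theorem continuous_size : Continuous fun A : MatOperator m n k => A.size := by
  unfold size
  fun_prop

theorem continuous_rowGram : Continuous fun A : MatOperator m n k => A.rowGram := by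
  unfold rowGram
  fun_prop

theorem continuous_colGram : Continuous fun A : MatOperator m n k => A.colGram := by
  unfold colGram
  fun_prop

theorem continuous_errE : Continuous fun A : MatOperator m n k => A.errE :=
  (continuous_size.smul continuous_const).sub (continuous_rowGram.fun_const_smul (m : ℝ))

theorem continuous_errF : Continuous fun A : MatOperator m n k => A.errF :=
  (continuous_size.smul continuous_const).sub (continuous_colGram.fun_const_smul (n : ℝ))

theorem continuous_frobSq {α β : Type*} [Fintype α] [Fintype β] :
    Continuous fun P : Matrix α β ℝ => frobSq P := by
  unfold frobSq frobInner
  fun_prop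

theorem continuous_imbalance : Continuous fun A : MatOperator m n k => A.imbalance :=
  ((continuous_frobSq.comp continuous_errE).div_const _).add
    ((continuous_frobSq.comp continuous_errF).div_const _)

theorem isDoublyBalanced_of_errE_errF (hm : 0 < m) (hn : 0 < n) {A : MatOperator m n k}
    (hE : A.errE = 0) (hF : A.errF = 0) : A.IsDoublyBalanced := by
  have hm' : (m : ℝ) ≠ 0 := by positivity
  have hn' : (n : ℝ) ≠ 0 := by positivity
  have h1 : A.rowGram = (A.size / m) • (1 : Matrix (Fin m) (Fin m) ℝ) := by
    have := A.nat_smul_rowGram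
    rw [hE, sub_zero] at this
    rw [div_eq_inv_mul, mul_smul, ← this, smul_smul, inv_mul_cancel₀ hm', one_smul]
  have h2 : A.colGram = (A.size / n) • (1 : Matrix (Fin n) (Fin n) ℝ) := by
    have := A.nat_smul_colGram
    rw [hF, sub_zero] at this
    rw [div_eq_inv_mul, mul_smul, ← this, smul_smul, inv_mul_cancel₀ hn', one_smul]
  unfold IsDoublyBalanced IsNearlyDoublyBalanced
  rw [sub_zero, add_zero, one_mul, one_mul, h1, h2, sub_self, sub_self]
  exact ⟨.zero, .zero, .zero, .zero⟩

theorem isDoublyBalanced_of_imbalance_eq_zero (hm : 0 < m) (hn : 0 < n) {A : MatOperator m n k}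
    (h : A.imbalance = 0) : A.IsDoublyBalanced := by
  have hm' : (0 : ℝ) < m := by positivity
  have hn' : (0 : ℝ) < n := by positivity
  have h1 : 0 ≤ frobSq A.errE / m := div_nonneg (frobSq_nonneg _) hm'.le
  have h2 : 0 ≤ frobSq A.errF / n := div_nonneg (frobSq_nonneg _) hn'.le
  unfold imbalance at h
  have h3 : frobSq A.errE / m = 0 := by linarith
  have h4 : frobSq A.errF / n = 0 := by linarith
  rw [div_eq_zero_iff, or_iff_left hm'.ne'] at h3
  rw [div_eq_zero_iff, or_iff_left hn'.ne'] at h4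
  exact isDoublyBalanced_of_errE_errF hm hn (frobSq_eq_zero.1 h3) (frobSq_eq_zero.1 h4)

section Flow

variable {A : MatOperator m n k} {X : ℝ → MatOperator m n k}

theorem IsGradientFlow.hasDerivWithinAt_vec (h : A.IsGradientFlow X) {t : ℝ} (ht : 0 ≤ t) :
    HasDerivWithinAt (fun τ => (X τ).vec) (X t).flowField.vec (Set.Ici 0) t := by
  have h1 : HasDerivWithinAt
      (fun τ => fun p : Fin k × Fin m × Fin n => X τ p.1 p.2.1 p.2.2)
      (fun p => (X t).flowField p.1 p.2.1 p.2.2) (Set.Ici 0) t :=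
    hasDerivWithinAt_pi.2 fun p => h.2 t ht _ _ _
  exact (EuclideanSpace.equiv (Fin k × Fin m × Fin n) ℝ).symm.hasFDerivAt.comp_hasDerivWithinAt
    t h1

theorem IsGradientFlow.continuousOn (h : A.IsGradientFlow X) : ContinuousOn X (Set.Ici 0) := by
  refine continuousOn_pi.2 fun i => ?_
  exact fun t ht => (h.hasDerivWithinAt ht i).continuousWithinAt

theorem IsGradientFlow.antitoneOn_size (hm : 0 < m) (hn : 0 < n) (h : A.IsGradientFlow X) :
    AntitoneOn (fun t => (X t).size) (Set.Ici 0) := by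
  refine antitoneOn_of_hasDerivWithinAt_nonpos (convex_Ici 0)
    (continuous_size.comp_continuousOn h.continuousOn)
    (f' := fun t => -2 * (X t).imbalance) (fun t ht => ?_) fun t ht => ?_
  · rw [interior_Ici] at ht ⊢
    exact (h.hasDerivWithinAt_size hm hn (le_of_lt ht)).mono Set.Ioi_subset_Ici_self
  · linarith [(X t).imbalance_nonneg]

/-- The length of a trajectory is controlled by the decrease of the square root of the
imbalance. -/
theorem IsGradientFlow.norm_vec_sub_le (hm : 0 < m) (hn : 0 < n) (h : A.IsGradientFlow X)
    {c : ℝ} (hc : 0 < c) (hV : ∀ t, 0 ≤ t → c ^ 2 * (X t).imbalance ≤ (X t).flowField.size)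
    {r t : ℝ} (hr : 0 ≤ r) (hrt : r ≤ t) :
    2 * c * ‖(X t).vec - (X r).vec‖ ≤ √(X r).imbalance - √(X t).imbalance := by
  -- The square root is not differentiable where the imbalance vanishes. It is regularised by δ; the
  -- extra term c√δ (t - r) pays for this and disappears as δ tends to 0.
  have hδ : ∀ δ : ℝ, 0 < δ → ‖(X t).vec - (X r).vec‖ ≤
      (√((X r).imbalance + δ) - √((X t).imbalance + δ)) / (2 * c) + c * √δ * (t - r) := by
    intro δ hδ
    have hIcc : Set.Icc r t ⊆ Set.Ici 0 := fun τ hτ => hr.trans hτ.1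
    have hpos : ∀ τ, 0 < (X τ).imbalance + δ := fun τ =>
      add_pos_of_nonneg_of_pos (X τ).imbalance_nonneg hδ
    have hcv : ContinuousOn (fun τ => (X τ).vec) (Set.Ici 0) := fun τ hτ =>
      (h.hasDerivWithinAt_vec hτ).continuousWithinAt
    have hci : ContinuousOn (fun τ => (X τ).imbalance) (Set.Ici 0) :=
      continuous_imbalance.comp_continuousOn h.continuousOn
    refine norm_le_of_damped (f := fun τ => (X τ).vec - (X r).vec)
      (g := fun τ => (X τ).flowField.vec) (a := fun _ => 0) (r := r) (T := t)
      (B := fun τ => (√((X r).imbalance + δ) - √((X τ).imbalance + δ)) / (2 * c) +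
        c * √δ * (τ - r))
      (B' := fun τ => (-(-4 * (X τ).flowField.size / (2 * √((X τ).imbalance + δ)))) / (2 * c) +
        c * √δ * 1)
      ((hcv.mono hIcc).sub continuousOn_const) ?_ ?_ ?_ ?_ ?_ t ⟨hrt, le_rfl⟩
    · intro τ hτ
      have hτ0 : 0 ≤ τ := hr.trans hτ.1
      rw [neg_zero, zero_smul, zero_add]
      exact ((h.hasDerivWithinAt_vec hτ0).mono (Set.Ici_subset_Ici.2 hτ0)).sub_const _
    · refine ContinuousOn.add (ContinuousOn.div_const (continuousOn_const.sub
        (ContinuousOn.sqrt ((hci.mono hIcc).add continuousOn_const))) _) (by fun_prop)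
    · intro τ hτ
      have hτ0 : 0 ≤ τ := hr.trans hτ.1
      have h1 := (((h.hasDerivWithinAt_imbalance hm hn hτ0).mono
        (Set.Ici_subset_Ici.2 hτ0)).add_const δ).sqrt (hpos τ).ne'
      exact ((h1.const_sub _).div_const _).add
        (((hasDerivWithinAt_id τ _).sub_const r).const_mul _)
    · simp
    · intro τ hτ
      have hτ0 : 0 ≤ τ := hr.trans hτ.1
      rw [neg_zero, zero_mul, zero_add, mul_one]
      have hV' := hV τ hτ0
      rw [← norm_vec_sq] at hV' ⊢
      set v := ‖(X τ).flowField.vec‖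
      have hv : 0 ≤ v := norm_nonneg _
      set q := √((X τ).imbalance + δ) with hq
      have hq2 : q ^ 2 = (X τ).imbalance + δ := Real.sq_sqrt (hpos τ).le
      have hqpos : 0 < q := Real.sqrt_pos.2 (hpos τ)
      set d := √δ with hd
      have hd2 : d ^ 2 = δ := Real.sq_sqrt hδ.le
      have hdpos : 0 < d := Real.sqrt_pos.2 hδ
      have hdq : d ≤ q := Real.sqrt_le_sqrt (by linarith [(X τ).imbalance_nonneg])
      have e : -(-4 * v ^ 2 / (2 * q)) / (2 * c) = v ^ 2 / (q * c) := by
        field_simp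
        ring
      rw [e, ← sub_le_iff_le_add, le_div_iff₀ (by positivity)]
      have h2 : c ^ 2 * q ^ 2 ≤ v ^ 2 + c ^ 2 * d ^ 2 := by rw [hq2, hd2]; linarith
      have h3 : c ^ 2 * d ^ 2 ≤ c ^ 2 * d * q := by
        have := mul_le_mul_of_nonneg_left hdq (by positivity : 0 ≤ c ^ 2 * d)
        linarith
      -- If v ≤ cq, the left side is at most c²q², which `h2` bounds; otherwise it is at most v².
      have h4 : v * (c * q) ≤ v ^ 2 + c ^ 2 * d ^ 2 := by
        rcases le_total v (c * q) with h5 | h5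
        · have := mul_le_mul_of_nonneg_right h5 (by positivity : 0 ≤ c * q)
          nlinarith
        · have := mul_le_mul_of_nonneg_left h5 hv
          nlinarith [sq_nonneg (c * d)]
      linarith
  have hlim : Tendsto (fun δ : ℝ => (√((X r).imbalance + δ) - √((X t).imbalance + δ)) / (2 * c) +
      c * √δ * (t - r)) (𝓝[>] 0) (𝓝 ((√(X r).imbalance - √(X t).imbalance) / (2 * c))) := by
    have hc : Continuous (fun δ : ℝ =>
        (√((X r).imbalance + δ) - √((X t).imbalance + δ)) / (2 * c) + c * √δ * (t - r)) := by
      fun_prop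
    have := hc.tendsto 0
    simp only [add_zero, Real.sqrt_zero, mul_zero, zero_mul] at this
    exact this.mono_left nhdsWithin_le_nhds
  have hle := ge_of_tendsto hlim (eventually_nhdsWithin_of_forall fun δ hδ' => hδ δ hδ')
  rw [le_div_iff₀ (by positivity)] at hle
  linarith

/-- Exponential decay of the imbalance. -/
theorem IsGradientFlow.imbalance_le_exp (hm : 0 < m) (hn : 0 < n) (h : A.IsGradientFlow X)
    {κ T : ℝ} (hV : ∀ t, 0 ≤ t → t ≤ T → κ * (X t).imbalance ≤ 4 * (X t).flowField.size)
    {t : ℝ} (ht : 0 ≤ t) (htT : t ≤ T) :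
    (X t).imbalance ≤ A.imbalance * Real.exp (-(κ * t)) := by
  have hci : ContinuousOn (fun τ => (X τ).imbalance) (Set.Ici 0) :=
      continuous_imbalance.comp_continuousOn h.continuousOn
  have hanti : AntitoneOn (fun τ => (X τ).imbalance * Real.exp (κ * τ)) (Set.Icc 0 T) := by
    refine antitoneOn_of_hasDerivWithinAt_nonpos (convex_Icc 0 T)
      ((hci.mono Set.Icc_subset_Ici_self).mul (by fun_prop))
      (f' := fun τ => -4 * (X τ).flowField.size * Real.exp (κ * τ) +
        (X τ).imbalance * (Real.exp (κ * τ) * (κ * 1))) (fun τ hτ => ?_) fun τ hτ => ?_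
    · rw [interior_Icc] at hτ ⊢
      exact ((h.hasDerivWithinAt_imbalance hm hn hτ.1.le).mono
        (Set.Ioo_subset_Icc_self.trans Set.Icc_subset_Ici_self)).mul
        (((hasDerivWithinAt_id τ _).const_mul κ).exp)
    · rw [interior_Icc] at hτ
      have := mul_le_mul_of_nonneg_right (hV τ hτ.1.le hτ.2.le) (Real.exp_pos (κ * τ)).le
      linarith
  have h1 := hanti ⟨le_rfl, ht.trans htT⟩ ⟨ht, htT⟩ ht
  simp only [mul_zero, Real.exp_zero, mul_one, h.1] at h1
  rw [Real.exp_neg, ← div_eq_mul_inv, le_div_iff₀ (Real.exp_pos _)]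
  exact h1

/-- If the speed of the flow dominates the imbalance, the flow converges to a doubly balanced
operator. -/
theorem IsGradientFlow.exists_limit (hm : 0 < m) (hn : 0 < n) (h : A.IsGradientFlow X)
    {c : ℝ} (hc : 0 < c) (hV : ∀ t, 0 ≤ t → c ^ 2 * (X t).imbalance ≤ (X t).flowField.size) :
    ∃ B : MatOperator m n k, Tendsto X atTop (𝓝 B) ∧ B.imbalance = 0 ∧
      4 * c ^ 2 * A.sqDist B ≤ A.imbalance := by
  have hdecay : Tendsto (fun t => (X t).imbalance) atTop (𝓝 0) := by
    have h1 : Tendsto (fun t : ℝ => A.imbalance * Real.exp (-(4 * c ^ 2 * t))) atTop (𝓝 0) := by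
      have : Tendsto (fun t : ℝ => 4 * c ^ 2 * t) atTop atTop :=
        tendsto_id.const_mul_atTop (by positivity)
      have := (Real.tendsto_exp_neg_atTop_nhds_zero.comp this).const_mul A.imbalance
      rwa [mul_zero] at this
    refine tendsto_of_tendsto_of_tendsto_of_le_of_le' tendsto_const_nhds h1
      (Eventually.of_forall fun t => (X t).imbalance_nonneg) ?_
    filter_upwards [eventually_ge_atTop 0] with t ht
    exact h.imbalance_le_exp hm hn (fun τ hτ _ => by linarith [hV τ hτ]) ht le_rfl
  have hsq : Tendsto (fun t => √(X t).imbalance) atTop (𝓝 0) := by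
    have := hdecay.sqrt
    rwa [Real.sqrt_zero] at this
  -- The distance travelled after time N is at most √Δ(N)/(2c), and this tends to 0.
  have hcauchy : CauchySeq fun t => (X t).vec := by
    refine Metric.cauchySeq_iff'.2 fun ε hε => ?_
    have h1 : ∀ᶠ t in atTop, √(X t).imbalance < 2 * c * ε :=
      hsq.eventually (gt_mem_nhds (by positivity))
    obtain ⟨N, hN, hN0⟩ := (h1.and (eventually_ge_atTop 0)).exists
    refine ⟨N, fun t ht => ?_⟩
    rw [dist_eq_norm]
    have h2 := h.norm_vec_sub_le hm hn hc hV hN0 ht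
    have h3 := Real.sqrt_nonneg (X t).imbalance
    have h4 : 2 * c * ‖(X t).vec - (X N).vec‖ < 2 * c * ε := by linarith
    exact lt_of_mul_lt_mul_left h4 (by positivity)
  obtain ⟨L, hL⟩ := cauchySeq_tendsto_of_complete hcauchy
  set B : MatOperator m n k := fun i a b => L (i, a, b) with hB
  have hXB : Tendsto X atTop (𝓝 B) := by
    refine tendsto_pi_nhds.2 fun i => tendsto_pi_nhds.2 fun a => tendsto_pi_nhds.2 fun b => ?_
    exact ((EuclideanSpace.proj (𝕜 := ℝ) (i, a, b)).continuous.tendsto L).comp hL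
  refine ⟨B, hXB, ?_, ?_⟩
  · exact tendsto_nhds_unique ((continuous_imbalance.tendsto B).comp hXB) hdecay
  · have hvB : B.vec = L := by
      ext p
      rfl
    have h1 : 2 * c * ‖L - A.vec‖ ≤ √A.imbalance := by
      refine le_of_tendsto ((hL.sub_const A.vec).norm.const_mul (2 * c)) ?_
      filter_upwards [eventually_ge_atTop 0] with t ht
      have h2 := h.norm_vec_sub_le hm hn hc hV le_rfl ht
      rw [h.1] at h2
      linarith [Real.sqrt_nonneg (X t).imbalance]
    have h2 := pow_le_pow_left₀ (by positivity) h1 2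
    rw [Real.sq_sqrt A.imbalance_nonneg, ← hvB, norm_sub_rev, mul_pow, norm_vec_sub_sq] at h2
    linarith

end Flow

end MatOperator

/-! ### Global existence of the flow. -/

/-- A bounded Lipschitz vector field has global forward trajectories. -/
theorem LipschitzWith.exists_forall_hasDerivWithinAt_Ici {V : Type*} [NormedAddCommGroup V]
    [NormedSpace ℝ V] [CompleteSpace V] {v : V → V} {K L : NNReal} (hv : LipschitzWith K v)
    (hL : ∀ x, ‖v x‖ ≤ L) (x₀ : V) :
    ∃ γ : ℝ → V, γ 0 = x₀ ∧ ∀ t, 0 ≤ t → HasDerivWithinAt γ (v (γ t)) (Set.Ici 0) t := by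
  have hloc : ∀ N : ℕ, ∃ α : ℝ → V, α 0 = x₀ ∧ ∀ t ∈ Set.Icc (0 : ℝ) (N + 1),
      HasDerivWithinAt α (v (α t)) (Set.Icc (0 : ℝ) (N + 1)) t := by
    intro N
    have h0 : (0 : ℝ) ∈ Set.Icc (0 : ℝ) (N + 1) := ⟨le_rfl, by positivity⟩
    -- The field is bounded by L everywhere, so a ball of radius L(N + 1) contains every curve of
    -- that speed on an interval of length N + 1.
    have hp : IsPicardLindelof (fun _ => v) (⟨0, h0⟩ : Set.Icc (0 : ℝ) (N + 1)) x₀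
        (L * (N + 1)) 0 L K :=
      { lipschitzOnWith := fun t _ => hv.lipschitzOnWith
        continuousOn := fun x _ => continuousOn_const
        norm_le := fun t _ x _ => hL x
        mul_max_le := by
          have : max ((N : ℝ) + 1 - 0) (0 - 0) = N + 1 := by
            rw [sub_zero, sub_zero, max_eq_left (by positivity)]
          simp only [this]
          push_cast
          simp }
    exact hp.exists_eq_forall_mem_Icc_hasDerivWithinAt₀
  choose α hα0 hα using hloc
  have hIci : ∀ (N : ℕ) (t : ℝ), t ∈ Set.Ico (0 : ℝ) (N + 1) →
      HasDerivWithinAt (α N) (v (α N t)) (Set.Ici t) t := by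
    intro N t ht
    refine (hα N t ⟨ht.1, ht.2.le⟩).mono_of_mem_nhdsWithin ?_
    exact mem_of_superset (Icc_mem_nhdsGE ht.2) (Set.Icc_subset_Icc_left ht.1)
  have hcont : ∀ N : ℕ, ContinuousOn (α N) (Set.Icc (0 : ℝ) (N + 1)) := fun N t ht =>
    (hα N t ht).continuousWithinAt
  have huniq : ∀ (N M : ℕ) (t : ℝ), 0 ≤ t → t ≤ N + 1 → t ≤ M + 1 → α N t = α M t := by
    intro N M t h0 hN hM
    refine ODE_solution_unique (v := fun _ => v) (K := K) (a := 0) (b := t) (fun _ => hv)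
      ((hcont N).mono (Set.Icc_subset_Icc_right hN)) (fun τ hτ => ?_)
      ((hcont M).mono (Set.Icc_subset_Icc_right hM)) (fun τ hτ => ?_)
      ((hα0 N).trans (hα0 M).symm) ⟨h0, le_rfl⟩
    · exact hIci N τ ⟨hτ.1, hτ.2.trans_le hN⟩
    · exact hIci M τ ⟨hτ.1, hτ.2.trans_le hM⟩
  have hγ : ∀ (M : ℕ) (s : ℝ), 0 ≤ s → s ≤ M + 1 → α ⌈s⌉₊ s = α M s := fun M s h0 hM =>
    huniq _ _ s h0 ((Nat.le_ceil s).trans (by linarith)) hM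
  -- The local solution with index ⌈t⌉ lives up to time ⌈t⌉ + 1 > t. Near t it agrees with the glued
  -- curve by uniqueness, so the derivative is inherited.
  refine ⟨fun t => α ⌈t⌉₊ t, by simp [hα0], fun t ht => ?_⟩
  have htlt : t < (⌈t⌉₊ : ℝ) + 1 := (Nat.le_ceil t).trans_lt (by linarith)
  have h1 : HasDerivWithinAt (α ⌈t⌉₊) (v (α ⌈t⌉₊ t)) (Set.Ici 0) t := by
    refine (hα ⌈t⌉₊ t ⟨ht, htlt.le⟩).mono_of_mem_nhdsWithin ?_
    rw [mem_nhdsWithin]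
    exact ⟨Set.Iio ((⌈t⌉₊ : ℝ) + 1), isOpen_Iio, htlt, fun s hs => ⟨hs.2, le_of_lt hs.1⟩⟩
  refine h1.congr_of_eventuallyEq ?_ rfl
  have : Set.Iio ((⌈t⌉₊ : ℝ) + 1) ∈ 𝓝 t := Iio_mem_nhds htlt
  filter_upwards [self_mem_nhdsWithin, mem_nhdsWithin_of_mem_nhds this] with s hs1 hs2
  exact hγ _ s hs1 (le_of_lt hs2)

theorem Matrix.contDiff_of_entries {V α β : Type*} [NormedAddCommGroup V] [NormedSpace ℝ V]
    [Fintype α] [Fintype β] [DecidableEq α] [DecidableEq β] {M : V → Matrix α β ℝ}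
    (h : ∀ a b, ContDiff ℝ 1 fun x => M x a b) : ContDiff ℝ 1 M := by
  have h1 : ContDiff ℝ 1 (fun x => ∑ a, ∑ b, M x a b • Matrix.single a b (1 : ℝ)) :=
    ContDiff.sum fun a _ => ContDiff.sum fun b _ => (h a b).smul contDiff_const
  have key : ∀ N : Matrix α β ℝ, ∑ a, ∑ b, N a b • Matrix.single a b (1 : ℝ) = N := by
    intro N
    conv_rhs => rw [Matrix.matrix_eq_sum_single N]
    simp [Matrix.smul_single]
  simpa only [key] using h1

theorem Matrix.norm_sq_le_frobSq {α β : Type*} [Fintype α] [Fintype β] [DecidableEq β]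
    (P : Matrix α β ℝ) : ‖P‖ ^ 2 ≤ frobSq P := by
  have h0 := frobSq_nonneg P
  have h : ‖P‖ ≤ √(frobSq P) := by
    rw [Matrix.l2_opNorm_def]
    refine ContinuousLinearMap.opNorm_le_bound _ (Real.sqrt_nonneg _) fun x => ?_
    refine le_of_sq_le_sq ?_ (by positivity)
    rw [mul_pow, Real.sq_sqrt h0, EuclideanSpace.norm_sq_eq, EuclideanSpace.norm_sq_eq,
      frobSq_eq_sum, Finset.sum_mul]
    refine Finset.sum_le_sum fun a _ => ?_
    simp only [Real.norm_eq_abs, sq_abs]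
    exact Finset.sum_mul_sq_le_sq_mul_sq Finset.univ (fun b => P a b) (fun b => x b)
  calc ‖P‖ ^ 2 ≤ √(frobSq P) ^ 2 := pow_le_pow_left₀ (norm_nonneg _) h 2
    _ = frobSq P := Real.sq_sqrt h0

namespace MatOperator

variable {m n k : ℕ}

theorem contDiff_entry (i : Fin k) (a : Fin m) (b : Fin n) :
    ContDiff ℝ 1 fun A : MatOperator m n k => A i a b :=
  ((LinearMap.toContinuousLinearMap (Matrix.entryLinearMap ℝ ℝ a b)).comp
    (ContinuousLinearMap.proj (R := ℝ) (φ := fun _ : Fin k => Matrix (Fin m) (Fin n) ℝ)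
      i)).contDiff

theorem contDiff_flowField : ContDiff ℝ 1 fun A : MatOperator m n k => A.flowField := by
  have hsize : ContDiff ℝ 1 fun A : MatOperator m n k => A.size := by
    unfold size
    exact ContDiff.sum fun i _ => ContDiff.sum fun a _ => ContDiff.sum fun b _ =>
      (contDiff_entry i a b).pow 2
  have hE : ∀ a b, ContDiff ℝ 1 fun A : MatOperator m n k => A.errE a b := by
    intro a b
    simp only [errE, rowGram, Matrix.sub_apply, Matrix.smul_apply, Matrix.sum_apply,
      Matrix.mul_apply, Matrix.transpose_apply, smul_eq_mul]
    exact (hsize.mul contDiff_const).sub (contDiff_const.mul (ContDiff.sum fun i _ =>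
      ContDiff.sum fun c _ => (contDiff_entry i a c).mul (contDiff_entry i b c)))
  have hF : ∀ a b, ContDiff ℝ 1 fun A : MatOperator m n k => A.errF a b := by
    intro a b
    simp only [errF, colGram, Matrix.sub_apply, Matrix.smul_apply, Matrix.sum_apply,
      Matrix.mul_apply, Matrix.transpose_apply, smul_eq_mul]
    exact (hsize.mul contDiff_const).sub (contDiff_const.mul (ContDiff.sum fun i _ =>
      ContDiff.sum fun c _ => (contDiff_entry i c a).mul (contDiff_entry i c b)))
  refine contDiff_pi.2 fun i => Matrix.contDiff_of_entries fun a b => ?_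
  simp only [flowField, Matrix.add_apply, Matrix.mul_apply]
  exact (ContDiff.sum fun c _ => (hE a c).mul (contDiff_entry i c b)).add
    (ContDiff.sum fun c _ => (contDiff_entry i a c).mul (hF c b))

theorem norm_le_of_size_le {A : MatOperator m n k} {R : ℝ} (hR : 0 ≤ R) (h : A.size ≤ R ^ 2) :
    ‖A‖ ≤ R := by
  refine (pi_norm_le_iff_of_nonneg hR).2 fun i => ?_
  rw [size_eq_sum_frobSq] at h
  exact le_of_sq_le_sq ((Matrix.norm_sq_le_frobSq (A i)).trans
    ((Finset.single_le_sum (fun j _ => frobSq_nonneg (A j)) (Finset.mem_univ i)).trans h)) hR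

/-- The gradient flow exists for all positive times. -/
theorem exists_isGradientFlow (hm : 0 < m) (hn : 0 < n) (A : MatOperator m n k) :
    ∃ X : ℝ → MatOperator m n k, A.IsGradientFlow X := by
  set R : ℝ := √A.size + 1
  have hRpos : 0 < R := by positivity
  -- The field is cubic, hence not globally Lipschitz, and is cut off outside a ball. Since the
  -- cutoff is nonnegative, the size still does not increase, so the trajectory stays where the
  -- cutoff equals 1 and solves the original equation.
  let φ : ContDiffBump (0 : MatOperator m n k) := ⟨R, R + 1, hRpos, by linarith⟩
  set v : MatOperator m n k → MatOperator m n k := fun Y => φ Y • Y.flowField with hv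
  have hvc : HasCompactSupport v := φ.hasCompactSupport.smul_right
  have hvd : ContDiff ℝ 1 v := φ.contDiff.smul contDiff_flowField
  obtain ⟨K, hK⟩ := hvd.lipschitzWith_of_hasCompactSupport hvc one_ne_zero
  obtain ⟨L, hL⟩ := hvc.exists_bound_of_continuous hvd.continuous
  obtain ⟨X, hX0, hX⟩ := hK.exists_forall_hasDerivWithinAt_Ici
    (L := ⟨max L 0, le_max_right _ _⟩) (fun x => (hL x).trans (le_max_left _ _)) A
  have hXi : ∀ t, 0 ≤ t → ∀ i, HasDerivWithinAt (fun τ => X τ i)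
      (φ (X t) • (X t).flowField i) (Set.Ici 0) t := fun t ht i =>
    (hasDerivWithinAt_pi.1 (hX t ht)) i
  have hsize : ∀ t, 0 ≤ t → HasDerivWithinAt (fun τ => (X τ).size)
      (-2 * φ (X t) * (X t).imbalance) (Set.Ici 0) t := by
    intro t ht
    have h1 : HasDerivWithinAt (fun τ => ∑ i, frobSq (X τ i))
        (∑ i, 2 * frobInner (X t i) (φ (X t) • (X t).flowField i)) (Set.Ici 0) t :=
      HasDerivWithinAt.fun_sum fun i _ => (hXi t ht i).frobSq
    simp only [frobInner_smul_right, ← Finset.mul_sum] at h1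
    rw [sum_frobInner_flowField hm hn] at h1
    simp only [size_eq_sum_frobSq]
    exact h1.congr_deriv (by ring)
  have hanti : AntitoneOn (fun t => (X t).size) (Set.Ici 0) := by
    refine antitoneOn_of_hasDerivWithinAt_nonpos (convex_Ici 0)
      (fun t ht => (hsize t ht).continuousWithinAt)
      (f' := fun t => -2 * φ (X t) * (X t).imbalance) (fun t ht => ?_) fun t ht => ?_
    · rw [interior_Ici] at ht ⊢
      exact (hsize t (le_of_lt ht)).mono Set.Ioi_subset_Ici_self
    · have := mul_nonneg (φ.nonneg (x := X t)) (X t).imbalance_nonneg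
      linarith
  have hone : ∀ t, 0 ≤ t → φ (X t) = 1 := by
    intro t ht
    refine φ.one_of_mem_closedBall (mem_closedBall_zero_iff.2 (norm_le_of_size_le hRpos.le ?_))
    have h1 : (X t).size ≤ (X 0).size := hanti Set.self_mem_Ici ht ht
    rw [hX0] at h1
    have h2 := Real.sq_sqrt A.size_nonneg
    have h3 := Real.sqrt_nonneg A.size
    change (X t).size ≤ (√A.size + 1) ^ 2
    nlinarith
  refine ⟨X, hX0, fun t ht i a b => ?_⟩
  have h1 := Matrix.HasDerivWithinAt.entry (hXi t ht i) a b
  rwa [hone t ht, one_smul] at h1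

end MatOperator

/-! ### Operator norm against Frobenius norm and quadratic form. -/

section OperatorNorm

variable {α β γ : Type*} [Fintype α] [Fintype β] [Fintype γ]
  [DecidableEq α] [DecidableEq β] [DecidableEq γ]

theorem Matrix.dotProduct_mulVec_self_le (P : Matrix α β ℝ) (x : β → ℝ) :
    (P.mulVec x) ⬝ᵥ (P.mulVec x) ≤ ‖P‖ ^ 2 * (x ⬝ᵥ x) := by
  have h := pow_le_pow_left₀ (norm_nonneg _) (Matrix.l2_opNorm_mulVec P (WithLp.toLp 2 x)) 2
  rw [mul_pow, EuclideanSpace.norm_sq_eq, EuclideanSpace.norm_sq_eq] at h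
  simpa [dotProduct, ← sq] using h

theorem frobSq_mul_le_left (P : Matrix α β ℝ) (Q : Matrix β γ ℝ) :
    frobSq (P * Q) ≤ ‖P‖ ^ 2 * frobSq Q := by
  have h : ∀ M : Matrix α γ ℝ, frobSq M = ∑ c, M.col c ⬝ᵥ M.col c := by
    intro M
    rw [← frobSq_transpose]
    simp [frobSq, frobInner, dotProduct]
  have h' : frobSq Q = ∑ c, Q.col c ⬝ᵥ Q.col c := by
    rw [← frobSq_transpose]
    simp [frobSq, frobInner, dotProduct]
  rw [h, h', Finset.mul_sum]
  refine Finset.sum_le_sum fun c _ => ?_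
  have : (P * Q).col c = P.mulVec (Q.col c) := by
    ext a
    simp [Matrix.mul_apply, Matrix.mulVec, dotProduct]
  rw [this]
  exact Matrix.dotProduct_mulVec_self_le P _

theorem Matrix.norm_transpose_real (P : Matrix α β ℝ) : ‖P.transpose‖ = ‖P‖ := by
  rw [← Matrix.conjTranspose_eq_transpose_of_trivial, Matrix.l2_opNorm_conjTranspose]

theorem frobSq_mul_le_right (P : Matrix α β ℝ) (Q : Matrix β γ ℝ) :
    frobSq (P * Q) ≤ frobSq P * ‖Q‖ ^ 2 := by
  rw [← frobSq_transpose, Matrix.transpose_mul, ← frobSq_transpose P, mul_comm,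
    ← Matrix.norm_transpose_real Q]
  exact frobSq_mul_le_left _ _

theorem frobSq_one : frobSq (1 : Matrix α α ℝ) = Fintype.card α := by
  rw [frobSq, frobInner_one_right, Matrix.trace_one]

theorem frobSq_le_card_mul (P : Matrix α α ℝ) : frobSq P ≤ Fintype.card α * ‖P‖ ^ 2 := by
  have h := frobSq_mul_le_left P (1 : Matrix α α ℝ)
  rwa [Matrix.mul_one, frobSq_one, mul_comm] at h

theorem abs_frobInner_mul_left_le (P : Matrix α α ℝ) (Q : Matrix α β ℝ) :
    |frobInner Q (P * Q)| ≤ ‖P‖ * frobSq Q := by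
  refine abs_le_of_sq_le_sq ?_ (mul_nonneg (norm_nonneg _) (frobSq_nonneg _))
  calc frobInner Q (P * Q) ^ 2 ≤ frobSq Q * frobSq (P * Q) := frobInner_sq_le _ _
    _ ≤ frobSq Q * (‖P‖ ^ 2 * frobSq Q) :=
        mul_le_mul_of_nonneg_left (frobSq_mul_le_left _ _) (frobSq_nonneg _)
    _ = _ := by ring

theorem abs_frobInner_mul_right_le (P : Matrix β β ℝ) (Q : Matrix α β ℝ) :
    |frobInner Q (Q * P)| ≤ ‖P‖ * frobSq Q := by
  refine abs_le_of_sq_le_sq ?_ (mul_nonneg (norm_nonneg _) (frobSq_nonneg _))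
  calc frobInner Q (Q * P) ^ 2 ≤ frobSq Q * frobSq (Q * P) := frobInner_sq_le _ _
    _ ≤ frobSq Q * (frobSq Q * ‖P‖ ^ 2) :=
        mul_le_mul_of_nonneg_left (frobSq_mul_le_right _ _) (frobSq_nonneg _)
    _ = _ := by ring

theorem Matrix.abs_dotProduct_mulVec_le (P : Matrix α α ℝ) (x : α → ℝ) :
    |x ⬝ᵥ P.mulVec x| ≤ ‖P‖ * (x ⬝ᵥ x) := by
  have hx : 0 ≤ x ⬝ᵥ x := Finset.sum_nonneg fun i _ => mul_self_nonneg (x i)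
  refine abs_le_of_sq_le_sq ?_ (mul_nonneg (norm_nonneg _) hx)
  have h1 : (x ⬝ᵥ P.mulVec x) ^ 2 ≤ (x ⬝ᵥ x) * (P.mulVec x ⬝ᵥ P.mulVec x) := by
    have := Finset.sum_mul_sq_le_sq_mul_sq Finset.univ x (P.mulVec x)
    simpa [dotProduct, ← sq] using this
  refine h1.trans ((mul_le_mul_of_nonneg_left (P.dotProduct_mulVec_self_le x) hx).trans_eq ?_)
  ring

/-- The operator norm of a symmetric matrix is bounded through its quadratic form. -/
theorem Matrix.norm_le_of_abs_dotProduct_mulVec_le {P : Matrix α α ℝ} (hP : P.transpose = P)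
    {c : ℝ} (hc : 0 ≤ c) (h : ∀ x : α → ℝ, |x ⬝ᵥ P.mulVec x| ≤ c * (x ⬝ᵥ x)) : ‖P‖ ≤ c := by
  rw [Matrix.cstar_norm_def]
  have hsym : (Matrix.toEuclideanCLM (n := α) (𝕜 := ℝ) P : EuclideanSpace ℝ α →ₗ[ℝ]
      EuclideanSpace ℝ α).IsSymmetric := by
    rw [Matrix.coe_toEuclideanCLM_eq_toEuclideanLin, Matrix.isSymmetric_toEuclideanLin_iff,
      Matrix.IsHermitian, Matrix.conjTranspose_eq_transpose_of_trivial, hP]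
  rw [ContinuousLinearMap.norm_eq_iSup_rayleighQuotient _ hsym]
  refine ciSup_le fun x => ?_
  have hx : x.ofLp ⬝ᵥ x.ofLp = ‖x‖ ^ 2 := by
    rw [EuclideanSpace.norm_sq_eq]
    simp [dotProduct, ← sq]
  have hr : (Matrix.toEuclideanCLM (n := α) (𝕜 := ℝ) P).reApplyInnerSelf x =
      x.ofLp ⬝ᵥ P.mulVec x.ofLp := by
    rw [ContinuousLinearMap.reApplyInnerSelf_apply]
    simp [PiLp.inner_apply, dotProduct, Matrix.ofLp_toEuclideanCLM, mul_comm]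
  have h1 := h x.ofLp
  rw [ContinuousLinearMap.rayleighQuotient, hr, abs_div, abs_of_nonneg (sq_nonneg ‖x‖)]
  rw [hx] at h1
  exact div_le_of_le_mul₀ (sq_nonneg _) hc h1

theorem Matrix.norm_one_le : ‖(1 : Matrix α α ℝ)‖ ≤ 1 := by
  refine Matrix.norm_le_of_abs_dotProduct_mulVec_le Matrix.transpose_one zero_le_one fun x => ?_
  have hx : 0 ≤ x ⬝ᵥ x := Finset.sum_nonneg fun i _ => mul_self_nonneg (x i)
  rw [Matrix.one_mulVec, abs_of_nonneg hx, one_mul]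

end OperatorNorm

/-! ### Norm estimates for the coupling, the forces and the imbalance. -/

namespace MatOperator

variable {m n k : ℕ}

theorem frobInner_mul_rowGram_eq (hm : 0 < m) (A : MatOperator m n k)
    (P : Matrix (Fin m) (Fin m) ℝ) :
    frobInner P (P * A.rowGram) = (A.size * frobSq P - frobInner P (P * A.errE)) / m := by
  have hm' : (m : ℝ) ≠ 0 := by positivity
  rw [eq_div_iff hm', mul_comm, ← frobInner_smul_right, ← Matrix.mul_smul, nat_smul_rowGram,
    Matrix.mul_sub, Matrix.mul_smul, Matrix.mul_one, frobInner_sub_right, frobInner_smul_right,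
    frobSq]

theorem frobInner_colGram_mul_eq (hn : 0 < n) (A : MatOperator m n k)
    (Q : Matrix (Fin n) (Fin n) ℝ) :
    frobInner Q (A.colGram * Q) = (A.size * frobSq Q - frobInner Q (A.errF * Q)) / n := by
  have hn' : (n : ℝ) ≠ 0 := by positivity
  rw [eq_div_iff hn', mul_comm, ← frobInner_smul_right, ← Matrix.smul_mul, nat_smul_colGram,
    Matrix.sub_mul, Matrix.smul_mul, Matrix.one_mul, frobInner_sub_right, frobInner_smul_right,
    frobSq]

/-- Cauchy-Schwarz for the families P Aᵢ and Aᵢ Q. This crude bound needs no spectral gap and serves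
to control the drift of the coupling. -/
theorem coupling_sq_le (hm : 0 < m) (hn : 0 < n) (A : MatOperator m n k)
    (P : Matrix (Fin m) (Fin m) ℝ) (Q : Matrix (Fin n) (Fin n) ℝ) :
    A.coupling P Q ^ 2 ≤ ((A.size + ‖A.errE‖) * frobSq P / m) *
      ((A.size + ‖A.errF‖) * frobSq Q / n) := by
  have hm' : (0 : ℝ) < m := by positivity
  have hn' : (0 : ℝ) < n := by positivity
  have h := sum_frobInner_sq_le Finset.univ (fun i => P * A i) (fun i => A i * Q)
  rw [sum_frobInner_mul_mul, sum_frobSq_mul_left, sum_frobSq_mul_right,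
    frobInner_mul_rowGram_eq hm, frobInner_colGram_mul_eq hn] at h
  have h1 := (abs_le.1 (abs_frobInner_mul_right_le A.errE P)).1
  have h2 := (abs_le.1 (abs_frobInner_mul_left_le A.errF Q)).1
  have h3 : 0 ≤ (A.size * frobSq Q - frobInner Q (A.errF * Q)) / n := by
    rw [← frobInner_colGram_mul_eq hn, ← sum_frobSq_mul_right]
    exact Finset.sum_nonneg fun i _ => frobSq_nonneg _
  refine h.trans (mul_le_mul ?_ ?_ h3 ?_)
  · gcongr
    linarith
  · gcongr
    linarith
  · exact div_nonneg (mul_nonneg (add_nonneg A.size_nonneg (norm_nonneg _)) (frobSq_nonneg _))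
      hm'.le

theorem dotProduct_rowGram_mulVec (A : MatOperator m n k) (x : Fin m → ℝ) :
    (m : ℝ) * (x ⬝ᵥ A.rowGram.mulVec x) = A.size * (x ⬝ᵥ x) - x ⬝ᵥ A.errE.mulVec x := by
  rw [← smul_eq_mul, ← dotProduct_smul, ← Matrix.smul_mulVec, nat_smul_rowGram,
    Matrix.sub_mulVec, dotProduct_sub, Matrix.smul_mulVec, Matrix.one_mulVec, dotProduct_smul,
    smul_eq_mul]

theorem dotProduct_colGram_mulVec (A : MatOperator m n k) (x : Fin n → ℝ) :
    (n : ℝ) * (x ⬝ᵥ A.colGram.mulVec x) = A.size * (x ⬝ᵥ x) - x ⬝ᵥ A.errF.mulVec x := by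
  rw [← smul_eq_mul, ← dotProduct_smul, ← Matrix.smul_mulVec, nat_smul_colGram,
    Matrix.sub_mulVec, dotProduct_sub, Matrix.smul_mulVec, Matrix.one_mulVec, dotProduct_smul,
    smul_eq_mul]

/-- The quadratic form of the image of Q is a sum of values of the form of Q at the vectors Aᵢ* x,
hence at most ‖Q‖ times the form of the row Gram matrix, which is (sI - E)/m. -/
theorem norm_rowMap_le (hm : 0 < m) (A : MatOperator m n k) {Q : Matrix (Fin n) (Fin n) ℝ}
    (hQ : Q.transpose = Q) : m * ‖A.rowMap Q‖ ≤ (A.size + ‖A.errE‖) * ‖Q‖ := by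
  have hm' : (0 : ℝ) < m := by positivity
  have hs := A.size_nonneg
  rw [mul_comm, ← le_div_iff₀ hm']
  refine Matrix.norm_le_of_abs_dotProduct_mulVec_le ?_ (by positivity) fun x => ?_
  · simp [rowMap, Matrix.transpose_sum, Matrix.transpose_mul, hQ, Matrix.mul_assoc]
  have h1 : ∀ i, x ⬝ᵥ (A i * Q * (A i).transpose).mulVec x =
      ((A i).transpose.mulVec x) ⬝ᵥ Q.mulVec ((A i).transpose.mulVec x) := by
    intro i
    rw [← Matrix.mulVec_mulVec, ← Matrix.mulVec_mulVec, Matrix.dotProduct_mulVec,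
      ← Matrix.mulVec_transpose]
  have h2 : ∀ i, ((A i).transpose.mulVec x) ⬝ᵥ ((A i).transpose.mulVec x) =
      x ⬝ᵥ (A i * (A i).transpose).mulVec x := by
    intro i
    rw [← Matrix.mulVec_mulVec, Matrix.dotProduct_mulVec x, ← Matrix.mulVec_transpose]
  have h3 : |x ⬝ᵥ (A.rowMap Q).mulVec x| ≤ ‖Q‖ * (x ⬝ᵥ A.rowGram.mulVec x) := by
    rw [rowMap, rowGram, Matrix.sum_mulVec, Matrix.sum_mulVec, dotProduct_sum, dotProduct_sum,
      Finset.mul_sum]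
    refine (Finset.abs_sum_le_sum_abs _ _).trans (Finset.sum_le_sum fun i _ => ?_)
    rw [h1, ← h2]
    exact Matrix.abs_dotProduct_mulVec_le _ _
  have h4 := A.dotProduct_rowGram_mulVec x
  have h5 := (abs_le.1 (A.errE.abs_dotProduct_mulVec_le x)).1
  refine h3.trans ?_
  rw [div_mul_eq_mul_div, le_div_iff₀ hm']
  have := mul_le_mul_of_nonneg_left (by linarith : (m : ℝ) * (x ⬝ᵥ A.rowGram.mulVec x) ≤
    (A.size + ‖A.errE‖) * (x ⬝ᵥ x)) (norm_nonneg Q)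
  linarith

theorem norm_colMap_le (hn : 0 < n) (A : MatOperator m n k) {P : Matrix (Fin m) (Fin m) ℝ}
    (hP : P.transpose = P) : n * ‖A.colMap P‖ ≤ (A.size + ‖A.errF‖) * ‖P‖ := by
  have hn' : (0 : ℝ) < n := by positivity
  have hs := A.size_nonneg
  rw [mul_comm, ← le_div_iff₀ hn']
  refine Matrix.norm_le_of_abs_dotProduct_mulVec_le ?_ (by positivity) fun x => ?_
  · simp [colMap, Matrix.transpose_sum, Matrix.transpose_mul, hP, Matrix.mul_assoc]
  have h1 : ∀ i, x ⬝ᵥ ((A i).transpose * P * A i).mulVec x =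
      ((A i).mulVec x) ⬝ᵥ P.mulVec ((A i).mulVec x) := by
    intro i
    rw [← Matrix.mulVec_mulVec, ← Matrix.mulVec_mulVec, Matrix.dotProduct_mulVec,
      ← Matrix.mulVec_transpose, Matrix.transpose_transpose]
  have h2 : ∀ i, ((A i).mulVec x) ⬝ᵥ ((A i).mulVec x) =
      x ⬝ᵥ ((A i).transpose * A i).mulVec x := by
    intro i
    rw [← Matrix.mulVec_mulVec, Matrix.dotProduct_mulVec x, ← Matrix.mulVec_transpose,
      Matrix.transpose_transpose]
  have h3 : |x ⬝ᵥ (A.colMap P).mulVec x| ≤ ‖P‖ * (x ⬝ᵥ A.colGram.mulVec x) := by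
    rw [colMap, colGram, Matrix.sum_mulVec, Matrix.sum_mulVec, dotProduct_sum, dotProduct_sum,
      Finset.mul_sum]
    refine (Finset.abs_sum_le_sum_abs _ _).trans (Finset.sum_le_sum fun i _ => ?_)
    rw [h1, ← h2]
    exact Matrix.abs_dotProduct_mulVec_le _ _
  have h4 := A.dotProduct_colGram_mulVec x
  have h5 := (abs_le.1 (A.errF.abs_dotProduct_mulVec_le x)).1
  refine h3.trans ?_
  rw [div_mul_eq_mul_div, le_div_iff₀ hn']
  have := mul_le_mul_of_nonneg_left (by linarith : (n : ℝ) * (x ⬝ᵥ A.colGram.mulVec x) ≤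
    (A.size + ‖A.errF‖) * (x ⬝ᵥ x)) (norm_nonneg P)
  linarith

/-- The force exerted by F has leading coefficient 2s, equal to the damping rate of E. This balance
is what keeps the larger of the two error norms from growing at first order. -/
theorem norm_forceE_le (hm : 0 < m) (A : MatOperator m n k) :
    ‖A.forceE‖ ≤ 2 * ‖A.errE‖ ^ 2 + 2 * A.imbalance +
      2 * ((A.size + ‖A.errE‖) * ‖A.errF‖) := by
  have hm' : (0 : ℝ) < m := by positivity
  have hΔ := A.imbalance_nonneg
  have h1 : ‖(2 : ℝ) • (A.errE * A.errE)‖ ≤ 2 * ‖A.errE‖ ^ 2 := by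
    rw [norm_smul, Real.norm_of_nonneg zero_le_two, sq]
    exact mul_le_mul_of_nonneg_left (Matrix.l2_opNorm_mul _ _) zero_le_two
  have h2 : ‖(2 * A.imbalance) • (1 : Matrix (Fin m) (Fin m) ℝ)‖ ≤ 2 * A.imbalance := by
    rw [norm_smul, Real.norm_of_nonneg (by positivity)]
    exact mul_le_of_le_one_right (by positivity) Matrix.norm_one_le
  have h3 : ‖(2 * (m : ℝ)) • A.rowMap A.errF‖ ≤ 2 * ((A.size + ‖A.errE‖) * ‖A.errF‖) := by
    rw [norm_smul, Real.norm_of_nonneg (by positivity), mul_assoc]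
    exact mul_le_mul_of_nonneg_left (A.norm_rowMap_le hm A.transpose_errF) zero_le_two
  rw [forceE]
  refine (norm_sub_le _ _).trans (add_le_add ((norm_sub_le _ _).trans (add_le_add h1 h2)) h3)

theorem norm_forceF_le (hn : 0 < n) (A : MatOperator m n k) :
    ‖A.forceF‖ ≤ 2 * ‖A.errF‖ ^ 2 + 2 * A.imbalance +
      2 * ((A.size + ‖A.errF‖) * ‖A.errE‖) := by
  have hn' : (0 : ℝ) < n := by positivity
  have hΔ := A.imbalance_nonneg
  have h1 : ‖(2 : ℝ) • (A.errF * A.errF)‖ ≤ 2 * ‖A.errF‖ ^ 2 := by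
    rw [norm_smul, Real.norm_of_nonneg zero_le_two, sq]
    exact mul_le_mul_of_nonneg_left (Matrix.l2_opNorm_mul _ _) zero_le_two
  have h2 : ‖(2 * A.imbalance) • (1 : Matrix (Fin n) (Fin n) ℝ)‖ ≤ 2 * A.imbalance := by
    rw [norm_smul, Real.norm_of_nonneg (by positivity)]
    exact mul_le_of_le_one_right (by positivity) Matrix.norm_one_le
  have h3 : ‖(2 * (n : ℝ)) • A.colMap A.errE‖ ≤ 2 * ((A.size + ‖A.errF‖) * ‖A.errE‖) := by
    rw [norm_smul, Real.norm_of_nonneg (by positivity), mul_assoc]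
    exact mul_le_mul_of_nonneg_left (A.norm_colMap_le hn A.transpose_errE) zero_le_two
  rw [forceF]
  refine (norm_sub_le _ _).trans (add_le_add ((norm_sub_le _ _).trans (add_le_add h1 h2)) h3)

theorem IsNearlyDoublyBalanced.abs_errE_le {ε : ℝ} {A : MatOperator m n k} (hm : 0 < m)
    (h : A.IsNearlyDoublyBalanced ε) (x : Fin m → ℝ) :
    |x ⬝ᵥ A.errE.mulVec x| ≤ ε * A.size * (x ⬝ᵥ x) := by
  have hm' : (0 : ℝ) < m := by positivity
  have h1 := h.1.dotProduct_mulVec_nonneg x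
  have h2 := h.2.1.dotProduct_mulVec_nonneg x
  have h3 := A.dotProduct_rowGram_mulVec x
  simp only [star_trivial, Matrix.sub_mulVec, dotProduct_sub, Matrix.smul_mulVec,
    Matrix.one_mulVec, dotProduct_smul, smul_eq_mul] at h1 h2
  have h1' := mul_nonneg hm'.le h1
  have h2' := mul_nonneg hm'.le h2
  have e : ∀ c y : ℝ, (m : ℝ) * (c * (A.size / m) * y) = c * A.size * y := by
    intro c y
    field_simp
  rw [mul_sub, e] at h1' h2'
  rw [abs_le]
  constructor <;> linarith

theorem IsNearlyDoublyBalanced.abs_errF_le {ε : ℝ} {A : MatOperator m n k} (hn : 0 < n)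
    (h : A.IsNearlyDoublyBalanced ε) (x : Fin n → ℝ) :
    |x ⬝ᵥ A.errF.mulVec x| ≤ ε * A.size * (x ⬝ᵥ x) := by
  have hn' : (0 : ℝ) < n := by positivity
  have h1 := h.2.2.1.dotProduct_mulVec_nonneg x
  have h2 := h.2.2.2.dotProduct_mulVec_nonneg x
  have h3 := A.dotProduct_colGram_mulVec x
  simp only [star_trivial, Matrix.sub_mulVec, dotProduct_sub, Matrix.smul_mulVec,
    Matrix.one_mulVec, dotProduct_smul, smul_eq_mul] at h1 h2
  have h1' := mul_nonneg hn'.le h1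
  have h2' := mul_nonneg hn'.le h2
  have e : ∀ c y : ℝ, (n : ℝ) * (c * (A.size / n) * y) = c * A.size * y := by
    intro c y
    field_simp
  rw [mul_sub, e] at h1' h2'
  rw [abs_le]
  constructor <;> linarith

theorem IsNearlyDoublyBalanced.nonneg {ε : ℝ} {A : MatOperator m n k} (hm : 0 < m)
    (hs : 0 < A.size) (h : A.IsNearlyDoublyBalanced ε) : 0 ≤ ε := by
  have h1 := (abs_nonneg _).trans (h.abs_errE_le hm (Pi.single ⟨0, hm⟩ 1))
  simp only [dotProduct_single_one, Pi.single_eq_same, mul_one] at h1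
  exact nonneg_of_mul_nonneg_left h1 hs

theorem IsNearlyDoublyBalanced.norm_errE_le {ε : ℝ} {A : MatOperator m n k} (hm : 0 < m)
    (hs : 0 < A.size) (h : A.IsNearlyDoublyBalanced ε) : ‖A.errE‖ ≤ ε * A.size :=
  Matrix.norm_le_of_abs_dotProduct_mulVec_le A.transpose_errE
    (mul_nonneg (h.nonneg hm hs) hs.le) (h.abs_errE_le hm)

theorem IsNearlyDoublyBalanced.norm_errF_le {ε : ℝ} {A : MatOperator m n k} (hm : 0 < m)
    (hn : 0 < n) (hs : 0 < A.size) (h : A.IsNearlyDoublyBalanced ε) : ‖A.errF‖ ≤ ε * A.size :=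
  Matrix.norm_le_of_abs_dotProduct_mulVec_le A.transpose_errF
    (mul_nonneg (h.nonneg hm hs) hs.le) (h.abs_errF_le hn)

theorem imbalance_le (hm : 0 < m) (hn : 0 < n) (A : MatOperator m n k) :
    A.imbalance ≤ ‖A.errE‖ ^ 2 + ‖A.errF‖ ^ 2 := by
  have hm' : (0 : ℝ) < m := by positivity
  have hn' : (0 : ℝ) < n := by positivity
  refine add_le_add ?_ ?_
  · rw [div_le_iff₀ hm', mul_comm]
    simpa using frobSq_le_card_mul A.errE
  · rw [div_le_iff₀ hn', mul_comm]
    simpa using frobSq_le_card_mul A.errF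

/-- Passing from the imbalance to the operator norm costs the factor m. After integration of an
exponentially decaying bound it becomes the ln m of the hypothesis. -/
theorem norm_errE_sq_le (hm : 0 < m) (A : MatOperator m n k) :
    ‖A.errE‖ ^ 2 ≤ m * A.imbalance := by
  have hm' : (0 : ℝ) < m := by positivity
  have h1 := A.errE.norm_sq_le_frobSq
  have h2 : 0 ≤ frobSq A.errF / n := div_nonneg (frobSq_nonneg _) (Nat.cast_nonneg _)
  have h3 : frobSq A.errE = m * (frobSq A.errE / m) := by field_simp
  have h4 := mul_nonneg hm'.le h2
  rw [imbalance, mul_add]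
  linarith

end MatOperator

/-! ### From the second singular value to a bound on the coupling of traceless matrices. -/

/-- Every two-dimensional space of vectors contains a vector that is stretched by at most the
second singular value. -/
theorem LinearMap.exists_norm_le_singularValues_one {V W : Type*} [NormedAddCommGroup V]
    [InnerProductSpace ℝ V] [FiniteDimensional ℝ V] [NormedAddCommGroup W]
    [InnerProductSpace ℝ W] [FiniteDimensional ℝ W] (T : V →ₗ[ℝ] W)
    (hV : 2 ≤ Module.finrank ℝ V) (x y : V) :
    ∃ α β : ℝ, (α ≠ 0 ∨ β ≠ 0) ∧
      ‖T (α • x + β • y)‖ ^ 2 ≤ T.singularValues 1 ^ 2 * ‖α • x + β • y‖ ^ 2 := by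
  set N := Module.finrank ℝ V with hN
  have hsym := T.isSymmetric_adjoint_comp_self
  set e := hsym.eigenvectorBasis hN.symm with he
  set i₀ : Fin N := ⟨0, by omega⟩
  have key : ∀ w : V, inner ℝ (e i₀) w = 0 → ‖T w‖ ^ 2 ≤ T.singularValues 1 ^ 2 * ‖w‖ ^ 2 := by
    intro w hw
    have h1 : ‖T w‖ ^ 2 = inner ℝ w ((LinearMap.adjoint T ∘ₗ T) w) := by
      rw [LinearMap.comp_apply, LinearMap.adjoint_inner_right, real_inner_self_eq_norm_sq]
    have h2 : inner ℝ w ((LinearMap.adjoint T ∘ₗ T) w) =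
        ∑ i, hsym.eigenvalues hN.symm i * inner ℝ (e i) w ^ 2 := by
      rw [← e.sum_inner_mul_inner]
      refine Finset.sum_congr rfl fun i _ => ?_
      rw [← hsym (e i) w, he, hsym.apply_eigenvectorBasis, ← he, real_inner_comm w]
      simp only [RCLike.ofReal_real_eq_id, id_eq, inner_smul_right]
      rw [real_inner_comm w (e i)]
      ring
    have h3 : ‖w‖ ^ 2 = ∑ i, inner ℝ (e i) w ^ 2 := by
      rw [← real_inner_self_eq_norm_sq, ← e.sum_inner_mul_inner]
      refine Finset.sum_congr rfl fun i _ => ?_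
      rw [real_inner_comm w, sq]
    rw [h1, h2, h3, Finset.mul_sum]
    refine Finset.sum_le_sum fun i _ => ?_
    by_cases hi : i = i₀
    · rw [hi, hw]
      simp
    · have h4 : 1 ≤ (i : ℕ) := by
        rcases Nat.eq_zero_or_pos (i : ℕ) with h5 | h5
        · exact absurd (Fin.ext h5) hi
        · exact h5
      refine mul_le_mul_of_nonneg_right ?_ (sq_nonneg _)
      rw [← T.sq_singularValues_fin hN.symm i]
      exact pow_le_pow_left₀ (T.singularValues_nonneg _) (T.singularValues_antitone h4) 2
  -- The combination is chosen orthogonal to the top eigenvector of T*T; on that complement T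
  -- stretches by at most the second singular value.
  by_cases h : inner ℝ (e i₀) x = 0
  · exact ⟨1, 0, Or.inl one_ne_zero, key _ (by simp [h])⟩
  · refine ⟨inner ℝ (e i₀) y, -inner ℝ (e i₀) x, Or.inr (neg_ne_zero.2 h), key _ ?_⟩
    rw [inner_add_right, inner_smul_right, inner_smul_right]
    ring

/-- Bessel's inequality for an orthonormal pair, from the nonnegativity of the squared distance of Z
to its projection. -/
theorem frobInner_sq_add_sq_le {α β : Type*} [Fintype α] [Fintype β] {U P : Matrix α β ℝ}
    (hU : frobSq U = 1) (hP : frobSq P = 1) (hUP : frobInner U P = 0) (Z : Matrix α β ℝ) :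
    frobInner U Z ^ 2 + frobInner P Z ^ 2 ≤ frobSq Z := by
  have h := frobSq_nonneg (Z + ((-frobInner U Z) • U + (-frobInner P Z) • P))
  rw [frobSq_add, frobSq_add, frobInner_add_right, frobSq_smul, frobSq_smul, hU, hP,
    frobInner_smul_right, frobInner_smul_right, frobInner_smul_right, frobInner_smul_left, hUP,
    frobInner_comm Z U, frobInner_comm Z P] at h
  linarith

/-- If both off-diagonal entries of a real `2 × 2` matrix with diagonal `(σ, μ)` are at most `δ`
in absolute value, then `min (σ, |μ|) - δ` bounds its smaller singular value from below. -/
theorem lt_sq_add_sq_of_small_offDiag {σ μ a b δ ρ α β : ℝ} (hδ : 0 ≤ δ) (hδρ : δ ≤ ρ)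
    (hσ : ρ < σ) (hμ : ρ < |μ|) (ha : |a| ≤ δ) (hb : |b| ≤ δ) (hαβ : α ≠ 0 ∨ β ≠ 0) :
    (ρ - δ) ^ 2 * (α ^ 2 + β ^ 2) < (α * σ + β * a) ^ 2 + (α * b + β * μ) ^ 2 := by
  have hρ : 0 ≤ ρ := hδ.trans hδρ
  -- The complex plane serves as the Euclidean plane: x is the image under the diagonal part and y
  -- under the off-diagonal part. The triangle inequality separates them.
  set x : ℂ := ⟨α * σ, β * μ⟩ with hx
  set y : ℂ := ⟨β * a, α * b⟩ with hy
  have hpos : 0 < α ^ 2 + β ^ 2 := by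
    rcases hαβ with h | h
    · have := sq_pos_of_ne_zero h
      positivity
    · have := sq_pos_of_ne_zero h
      positivity
  set q := √(α ^ 2 + β ^ 2) with hq
  have hq2 : q ^ 2 = α ^ 2 + β ^ 2 := Real.sq_sqrt hpos.le
  have hqpos : 0 < q := Real.sqrt_pos.2 hpos
  have nsq : ∀ z : ℂ, ‖z‖ ^ 2 = z.re ^ 2 + z.im ^ 2 := fun z => by
    rw [Complex.sq_norm, Complex.normSq_apply]
    ring
  have hσ2 : ρ ^ 2 < σ ^ 2 := pow_lt_pow_left₀ hσ hρ two_ne_zero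
  have hμ2 : ρ ^ 2 < μ ^ 2 := by
    rw [← sq_abs μ]
    exact pow_lt_pow_left₀ hμ hρ two_ne_zero
  have ha2 : a ^ 2 ≤ δ ^ 2 := by
    rw [← sq_abs a]
    exact pow_le_pow_left₀ (abs_nonneg _) ha 2
  have hb2 : b ^ 2 ≤ δ ^ 2 := by
    rw [← sq_abs b]
    exact pow_le_pow_left₀ (abs_nonneg _) hb 2
  have h1 : ρ * q < ‖x‖ := by
    refine lt_of_pow_lt_pow_left₀ 2 (norm_nonneg _) ?_
    rw [nsq, mul_pow, hq2]
    simp only [hx, mul_pow]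
    rcases hαβ with h | h
    · have h' := sq_pos_of_ne_zero h
      nlinarith [mul_lt_mul_of_pos_left hσ2 h', mul_le_mul_of_nonneg_left hμ2.le (sq_nonneg β)]
    · have h' := sq_pos_of_ne_zero h
      nlinarith [mul_lt_mul_of_pos_left hμ2 h', mul_le_mul_of_nonneg_left hσ2.le (sq_nonneg α)]
  have h2 : ‖y‖ ≤ δ * q := by
    refine le_of_sq_le_sq ?_ (by positivity)
    rw [nsq, mul_pow δ q 2, hq2]
    simp only [hy, mul_pow]
    nlinarith [mul_le_mul_of_nonneg_left ha2 (sq_nonneg β),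
      mul_le_mul_of_nonneg_left hb2 (sq_nonneg α)]
  have h3 : ‖x‖ ≤ ‖x + y‖ + ‖y‖ := by
    have := norm_sub_le (x + y) y
    rwa [add_sub_cancel_right] at this
  have h4 : (ρ - δ) * q < ‖x + y‖ := by linarith
  have h5 := pow_lt_pow_left₀ h4 (mul_nonneg (sub_nonneg.2 hδρ) hqpos.le) two_ne_zero
  rw [nsq, mul_pow, hq2] at h5
  simp only [hx, hy, Complex.add_re, Complex.add_im] at h5
  linarith

namespace MatOperator

variable {m n k : ℕ}

/-- After vectorisation `M_A` is the map Q ↦ ∑ Aᵢ Q Aᵢ*, so its singular values are those of this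
map for the Frobenius norms. -/
theorem repMatrix_mulVec (A : MatOperator m n k) (Q : Matrix (Fin n) (Fin n) ℝ) :
    A.repMatrix.mulVec (fun p => Q p.1 p.2) = fun p => A.rowMap Q p.1 p.2 := by
  ext ⟨a, a'⟩
  simp only [repMatrix, rowMap, Matrix.sum_mulVec, Finset.sum_apply, Matrix.sum_apply]
  refine Finset.sum_congr rfl fun i _ => ?_
  simp only [Matrix.mulVec, dotProduct, Fintype.sum_prod_type, Matrix.kronecker_apply,
    Matrix.mul_apply, Matrix.transpose_apply, Finset.sum_mul]
  rw [Finset.sum_comm]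
  refine Finset.sum_congr rfl fun b _ => Finset.sum_congr rfl fun c _ => ?_
  ring

theorem sigmaTwo_nonneg (A : MatOperator m n k) : 0 ≤ A.sigmaTwo :=
  LinearMap.singularValues_nonneg _ _

theorem exists_frobSq_rowMap_le_sigmaTwo (hn : 2 ≤ n) (A : MatOperator m n k)
    (V Q : Matrix (Fin n) (Fin n) ℝ) :
    ∃ α β : ℝ, (α ≠ 0 ∨ β ≠ 0) ∧
      frobSq (A.rowMap (α • V + β • Q)) ≤ A.sigmaTwo ^ 2 * frobSq (α • V + β • Q) := by
  have hfin : 2 ≤ Module.finrank ℝ (EuclideanSpace ℝ (Fin n × Fin n)) := by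
    simp only [finrank_euclideanSpace, Fintype.card_prod, Fintype.card_fin]
    nlinarith
  obtain ⟨α, β, h, hle⟩ := (Matrix.toEuclideanLin A.repMatrix).exists_norm_le_singularValues_one
    hfin (WithLp.toLp 2 fun p => V p.1 p.2) (WithLp.toLp 2 fun p => Q p.1 p.2)
  refine ⟨α, β, h, ?_⟩
  obtain ⟨W, hW⟩ : ∃ W, W = α • V + β • Q := ⟨_, rfl⟩
  have e1 : α • WithLp.toLp 2 (fun p : Fin n × Fin n => V p.1 p.2) +
      β • WithLp.toLp 2 (fun p : Fin n × Fin n => Q p.1 p.2) =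
      WithLp.toLp 2 (fun p : Fin n × Fin n => W p.1 p.2) := by
    ext p
    simp [hW]
  rw [← hW]
  rw [e1, Matrix.toLpLin_toLp, Matrix.toLin'_apply, repMatrix_mulVec, EuclideanSpace.norm_sq_eq,
    EuclideanSpace.norm_sq_eq] at hle
  simpa only [sigmaTwo, Fintype.sum_prod_type, Real.norm_eq_abs, sq_abs, ← frobSq_eq_sum] using hle

/-- The normalised identities U and V are nearly top singular vectors. Compress the map to span(V,
Q) → span(U, P): the diagonal entries are σ = s/√(mn) and the coupling of P and Q, and near balance
makes the off-diagonal ones at most εσ. A coupling above (1 - λ + ε)σ would put both singular values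
of the compression above (1 - λ)σ, against the bound on the second singular value. -/
theorem HasSpectralGap.abs_coupling_le_of_frobSq_eq_one {lam ε : ℝ}
    {A : MatOperator m n k} (hm : 0 < m)
    (hn : 2 ≤ n) (hs : 0 < A.size) (hgap : A.HasSpectralGap lam)
    (hA : A.IsNearlyDoublyBalanced ε) (hε : ε < lam)
    {P : Matrix (Fin m) (Fin m) ℝ} {Q : Matrix (Fin n) (Fin n) ℝ}
    (hP : P.trace = 0) (hQ : Q.trace = 0) (hP1 : frobSq P = 1) (hQ1 : frobSq Q = 1) :
    |A.coupling P Q| ≤ (1 - lam + ε) * (A.size / (√(m : ℝ) * √(n : ℝ))) := by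
  have hn0 : 0 < n := by omega
  have hm' : (0 : ℝ) < m := by positivity
  have hn' : (0 : ℝ) < n := by positivity
  have hε0 := hA.nonneg hm hs
  set p := √(m : ℝ) with hp
  set q := √(n : ℝ) with hq
  have hp0 : 0 < p := Real.sqrt_pos.2 hm'
  have hq0 : 0 < q := Real.sqrt_pos.2 hn'
  have hp2 : p ^ 2 = m := Real.sq_sqrt hm'.le
  have hq2 : q ^ 2 = n := Real.sq_sqrt hn'.le
  set σ := A.size / (p * q) with hσ
  have hσ0 : 0 < σ := by positivity
  have hgap' : A.sigmaTwo ≤ (1 - lam) * σ := by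
    have := hgap
    rwa [HasSpectralGap, Real.sqrt_mul hm'.le] at this
  have hlam : 0 ≤ 1 - lam := nonneg_of_mul_nonneg_left (A.sigmaTwo_nonneg.trans hgap') hσ0
  have hE : frobSq A.errE ≤ m * (ε * A.size) ^ 2 := by
    refine (frobSq_le_card_mul A.errE).trans ?_
    rw [Fintype.card_fin]
    exact mul_le_mul_of_nonneg_left
      (pow_le_pow_left₀ (norm_nonneg _) (hA.norm_errE_le hm hs) 2) hm'.le
  have hF : frobSq A.errF ≤ n * (ε * A.size) ^ 2 := by
    refine (frobSq_le_card_mul A.errF).trans ?_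
    rw [Fintype.card_fin]
    exact mul_le_mul_of_nonneg_left
      (pow_le_pow_left₀ (norm_nonneg _) (hA.norm_errF_le hm hn0 hs) 2) hn'.le
  by_contra! hlt
  set U : Matrix (Fin m) (Fin m) ℝ := p⁻¹ • 1 with hU
  set V : Matrix (Fin n) (Fin n) ℝ := q⁻¹ • 1 with hV
  have hU1 : frobSq U = 1 := by
    rw [hU, frobSq_smul, frobSq_one, Fintype.card_fin, inv_pow, hp2, inv_mul_cancel₀ hm'.ne']
  have hV1 : frobSq V = 1 := by
    rw [hV, frobSq_smul, frobSq_one, Fintype.card_fin, inv_pow, hq2, inv_mul_cancel₀ hn'.ne']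
  have hUP : frobInner U P = 0 := by
    rw [hU, frobInner_smul_left, frobInner_comm, frobInner_one_right, hP, mul_zero]
  have hVQ : frobInner V Q = 0 := by
    rw [hV, frobInner_smul_left, frobInner_comm, frobInner_one_right, hQ, mul_zero]
  have hrow : A.rowMap V = q⁻¹ • A.rowGram := by
    simp [rowMap, rowGram, hV, Finset.smul_sum]
  have hcol : A.colMap U = p⁻¹ • A.colGram := by
    simp [colMap, colGram, hU, Finset.smul_sum]
  have hUV : A.coupling U V = σ := by
    rw [← frobInner_rowMap, hrow, hU, frobInner_smul_left, frobInner_smul_right,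
      frobInner_comm, frobInner_one_right, trace_rowGram, hσ]
    field_simp
  have hR : (m : ℝ) * frobInner P A.rowGram = -frobInner P A.errE := by
    rw [← frobInner_smul_right, nat_smul_rowGram, frobInner_sub_right, frobInner_smul_right,
      frobInner_one_right, hP]
    ring
  have hC : (n : ℝ) * frobInner Q A.colGram = -frobInner Q A.errF := by
    rw [← frobInner_smul_right, nat_smul_colGram, frobInner_sub_right, frobInner_smul_right,
      frobInner_one_right, hQ]
    ring
  have hb : |A.coupling P V| ≤ ε * σ := by
    refine abs_le_of_sq_le_sq ?_ (by positivity)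
    have h1 := frobInner_sq_le P A.errE
    rw [hP1, one_mul] at h1
    have h2 : A.coupling P V = q⁻¹ * (-frobInner P A.errE / m) := by
      rw [← frobInner_rowMap, hrow, frobInner_smul_right, ← hR]
      field_simp
    have h3 : A.coupling P V ^ 2 = frobInner P A.errE ^ 2 / (p ^ 2 * q ^ 2 * m) := by
      rw [h2, hp2]
      field_simp
    rw [h3, div_le_iff₀ (by positivity), hσ]
    refine (h1.trans hE).trans_eq ?_
    field_simp
  have ha : |A.coupling U Q| ≤ ε * σ := by
    refine abs_le_of_sq_le_sq ?_ (by positivity)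
    have h1 := frobInner_sq_le Q A.errF
    rw [hQ1, one_mul] at h1
    have h2 : A.coupling U Q = p⁻¹ * (-frobInner Q A.errF / n) := by
      rw [← frobInner_colMap, hcol, frobInner_smul_right, ← hC]
      field_simp
    have h3 : A.coupling U Q ^ 2 = frobInner Q A.errF ^ 2 / (p ^ 2 * q ^ 2 * n) := by
      rw [h2, hq2]
      field_simp
    rw [h3, div_le_iff₀ (by positivity), hσ]
    refine (h1.trans hF).trans_eq ?_
    field_simp
  obtain ⟨α, β, hαβ, hle⟩ := A.exists_frobSq_rowMap_le_sigmaTwo hn V Q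
  have hbessel := frobInner_sq_add_sq_le hU1 hP1 hUP (A.rowMap (α • V + β • Q))
  have hlin : ∀ Z, frobInner Z (A.rowMap (α • V + β • Q)) =
      α * A.coupling Z V + β * A.coupling Z Q := by
    intro Z
    have : A.rowMap (α • V + β • Q) = α • A.rowMap V + β • A.rowMap Q := by
      simp only [rowMap, Matrix.mul_add, Matrix.add_mul, Matrix.mul_smul, Matrix.smul_mul,
        Finset.sum_add_distrib, Finset.smul_sum]
    rw [this, frobInner_add_right, frobInner_smul_right, frobInner_smul_right,
      frobInner_rowMap, frobInner_rowMap]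
  have hnorm : frobSq (α • V + β • Q) = α ^ 2 + β ^ 2 := by
    rw [frobSq_add, frobSq_smul α V, frobSq_smul β Q, hV1, hQ1, frobInner_smul_left,
      frobInner_smul_right, hVQ]
    ring
  rw [hlin, hlin, hUV] at hbessel
  rw [hnorm] at hle
  have h1 := lt_sq_add_sq_of_small_offDiag (mul_nonneg hε0 hσ0.le)
    (mul_le_mul_of_nonneg_right (by linarith) hσ0.le : ε * σ ≤ (1 - lam + ε) * σ)
    (mul_lt_of_lt_one_left hσ0 (by linarith)) hlt ha hb hαβ
  have h2 : A.sigmaTwo ^ 2 * (α ^ 2 + β ^ 2) ≤ ((1 - lam) * σ) ^ 2 * (α ^ 2 + β ^ 2) :=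
    mul_le_mul_of_nonneg_right (pow_le_pow_left₀ A.sigmaTwo_nonneg hgap' 2) (by positivity)
  have h3 : ((1 - lam + ε) * σ - ε * σ) ^ 2 * (α ^ 2 + β ^ 2) =
    ((1 - lam) * σ) ^ 2 * (α ^ 2 + β ^ 2) := by ring
  linarith

/-- The spectral gap bounds the coupling of traceless matrices. -/
theorem HasSpectralGap.coupling_sq_le {lam ε : ℝ}
    {A : MatOperator m n k} (hm : 0 < m)
    (hn : 2 ≤ n) (hs : 0 < A.size) (hgap : A.HasSpectralGap lam)
    (hA : A.IsNearlyDoublyBalanced ε) (hε : ε < lam)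
    {P : Matrix (Fin m) (Fin m) ℝ} {Q : Matrix (Fin n) (Fin n) ℝ}
    (hP : P.trace = 0) (hQ : Q.trace = 0) :
    A.coupling P Q ^ 2 ≤
      ((1 - lam + ε) * A.size) ^ 2 * (frobSq P / m) * (frobSq Q / n) := by
  have hn0 : 0 < n := by omega
  have hm' : (0 : ℝ) < m := by positivity
  have hn' : (0 : ℝ) < n := by positivity
  set p := √(m : ℝ) with hp
  set q := √(n : ℝ) with hq
  have hp0 : 0 < p := Real.sqrt_pos.2 hm'
  have hq0 : 0 < q := Real.sqrt_pos.2 hn'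
  have hp2 : p ^ 2 = m := Real.sq_sqrt hm'.le
  have hq2 : q ^ 2 = n := Real.sq_sqrt hn'.le
  set σ := A.size / (p * q) with hσ
  have hrhs : ((1 - lam + ε) * A.size) ^ 2 * (frobSq P / m) * (frobSq Q / n) =
      ((1 - lam + ε) * σ) ^ 2 * (frobSq P * frobSq Q) := by
    rw [hσ, ← hp2, ← hq2]
    field_simp
  rw [hrhs]
  rcases (frobSq_nonneg P).eq_or_lt with hP0 | hP0
  · rw [frobSq_eq_zero.1 hP0.symm]
    simp [coupling, frobInner, frobSq]
  rcases (frobSq_nonneg Q).eq_or_lt with hQ0 | hQ0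
  · rw [frobSq_eq_zero.1 hQ0.symm]
    simp [coupling, frobInner, frobSq]
  set x := √(frobSq P) with hx
  set y := √(frobSq Q) with hy
  have hx0 : 0 < x := Real.sqrt_pos.2 hP0
  have hy0 : 0 < y := Real.sqrt_pos.2 hQ0
  have hx2 : x ^ 2 = frobSq P := Real.sq_sqrt hP0.le
  have hy2 : y ^ 2 = frobSq Q := Real.sq_sqrt hQ0.le
  have h1 := hgap.abs_coupling_le_of_frobSq_eq_one hm hn hs hA hε (P := x⁻¹ • P) (Q := y⁻¹ • Q)
    (by rw [Matrix.trace_smul, hP, smul_zero])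
    (by rw [Matrix.trace_smul, hQ, smul_zero])
    (by rw [frobSq_smul, ← hx2]; field_simp) (by rw [frobSq_smul, ← hy2]; field_simp)
  have h2 : A.coupling (x⁻¹ • P) (y⁻¹ • Q) = x⁻¹ * (y⁻¹ * A.coupling P Q) := by
    simp only [coupling, Matrix.mul_smul, Matrix.smul_mul, frobInner_smul_left,
      frobInner_smul_right, Finset.mul_sum]
    exact Finset.sum_congr rfl fun i _ => mul_left_comm _ _ _
  have h3 := pow_le_pow_left₀ (abs_nonneg _) h1 2
  rw [sq_abs, h2, mul_pow, mul_pow, inv_pow, inv_pow, hx2, hy2, ← mul_assoc, ← mul_inv,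
    inv_mul_le_iff₀ (by positivity)] at h3
  linarith

end MatOperator

/-! ### Growth of the errors and drift of the coupling along the flow. -/

namespace MatOperator

variable {m n k : ℕ} {A : MatOperator m n k} {X : ℝ → MatOperator m n k}

/-- The larger of the operator norms of the two error matrices. -/
noncomputable def errNorm (A : MatOperator m n k) : ℝ := max ‖A.errE‖ ‖A.errF‖

theorem norm_errE_le_errNorm (A : MatOperator m n k) : ‖A.errE‖ ≤ A.errNorm := le_max_left _ _

theorem norm_errF_le_errNorm (A : MatOperator m n k) : ‖A.errF‖ ≤ A.errNorm := le_max_right _ _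

theorem errNorm_nonneg (A : MatOperator m n k) : 0 ≤ A.errNorm :=
  (norm_nonneg _).trans A.norm_errE_le_errNorm

theorem errNorm_le_add (A : MatOperator m n k) : A.errNorm ≤ ‖A.errE‖ + ‖A.errF‖ :=
  max_le (le_add_of_nonneg_right (norm_nonneg _)) (le_add_of_nonneg_left (norm_nonneg _))

theorem continuous_errNorm : Continuous fun A : MatOperator m n k => A.errNorm :=
  continuous_errE.norm.max continuous_errF.norm

/-- The comparison principle is applied to the pair (E, F) with the maximum norm N. The force 2(s +
N)N cancels the damping -2sN, so only 4N² + 2Δ remains, and 2Δ integrates to the loss of size. -/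
theorem IsGradientFlow.errNorm_le_integral (hm : 0 < m) (hn : 0 < n) (h : A.IsGradientFlow X)
    (hc : Continuous X) {T : ℝ} (hT : 0 ≤ T) :
    (X T).errNorm ≤ A.errNorm + (∫ τ in (0 : ℝ)..T, 4 * (X τ).errNorm ^ 2) +
      (A.size - (X T).size) := by
  have hcN : Continuous fun τ => 4 * (X τ).errNorm ^ 2 :=
    continuous_const.mul ((continuous_errNorm.comp hc).pow 2)
  have hcs : Continuous fun τ => (X τ).size := continuous_size.comp hc
  have hcI : Continuous fun t => ∫ τ in (0 : ℝ)..t, 4 * (X τ).errNorm ^ 2 :=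
    continuous_iff_continuousAt.2 fun t =>
      (hcN.integral_hasStrictDerivAt 0 t).hasDerivAt.continuousAt
  refine norm_le_of_damped (f := fun τ => ((X τ).errE, (X τ).errF))
    (g := fun τ => ((X τ).forceE, (X τ).forceF)) (a := fun τ => 2 * (X τ).size) (r := 0)
    (B := fun t => A.errNorm + (∫ τ in (0 : ℝ)..t, 4 * (X τ).errNorm ^ 2) +
      (A.size - (X t).size))
    (B' := fun t => 4 * (X t).errNorm ^ 2 + -(-2 * (X t).imbalance))
    ((continuous_errE.comp hc).prodMk (continuous_errF.comp hc)).continuousOn ?_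
    ((continuous_const.add hcI).add (continuous_const.sub hcs)).continuousOn ?_ ?_ ?_ T
    ⟨hT, le_rfl⟩
  · intro t ht
    exact ((h.hasDerivWithinAt_errE hm hn ht.1).prodMk
      (h.hasDerivWithinAt_errF hm hn ht.1)).mono (Set.Ici_subset_Ici.2 ht.1)
  · intro t ht
    exact ((hcN.integral_hasStrictDerivAt 0 t).hasDerivAt.hasDerivWithinAt.const_add _).add
      (((h.hasDerivWithinAt_size hm hn ht.1).mono (Set.Ici_subset_Ici.2 ht.1)).const_sub _)
  · rw [h.1, intervalIntegral.integral_same, add_zero, sub_self, add_zero]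
    exact le_rfl
  · intro t _
    have h1 := (X t).norm_forceE_le hm
    have h2 := (X t).norm_forceF_le hn
    have h3 := (X t).norm_errE_le_errNorm
    have h4 := (X t).norm_errF_le_errNorm
    have hs := (X t).size_nonneg
    have hN := (X t).errNorm_nonneg
    change -(2 * (X t).size) * (X t).errNorm + max ‖(X t).forceE‖ ‖(X t).forceF‖ ≤ _
    have h5 : max ‖(X t).forceE‖ ‖(X t).forceF‖ ≤ 2 * (X t).errNorm ^ 2 + 2 * (X t).imbalance +
        2 * (((X t).size + (X t).errNorm) * (X t).errNorm) := by
      refine max_le (h1.trans ?_) (h2.trans ?_) <;> gcongr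
    linarith

/-- Comparison for F alone, with its damping kept. Discarding ‖F(T)‖ leaves a bound of the integral
of ‖F‖ by that of ‖E‖, which avoids a dependence on n. -/
theorem IsGradientFlow.integral_norm_errF_le (hm : 0 < m) (hn : 0 < n) (h : A.IsGradientFlow X)
    (hc : Continuous X) {T : ℝ} (hT : 0 ≤ T) :
    0 ≤ ‖A.errF‖ + (∫ τ in (0 : ℝ)..T, (-(2 * (X τ).size) * ‖(X τ).errF‖ +
      2 * ‖(X τ).errF‖ ^ 2 + 2 * (((X τ).size + ‖(X τ).errF‖) * ‖(X τ).errE‖))) +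
      (A.size - (X T).size) := by
  have hcE : Continuous fun τ => ‖(X τ).errE‖ := (continuous_errE.comp hc).norm
  have hcF : Continuous fun τ => ‖(X τ).errF‖ := (continuous_errF.comp hc).norm
  have hcs : Continuous fun τ => (X τ).size := continuous_size.comp hc
  have hcN : Continuous fun τ => -(2 * (X τ).size) * ‖(X τ).errF‖ +
      2 * ‖(X τ).errF‖ ^ 2 + 2 * (((X τ).size + ‖(X τ).errF‖) * ‖(X τ).errE‖) := by fun_prop
  have hcI : Continuous fun t => ∫ τ in (0 : ℝ)..t, (-(2 * (X τ).size) * ‖(X τ).errF‖ +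
      2 * ‖(X τ).errF‖ ^ 2 + 2 * (((X τ).size + ‖(X τ).errF‖) * ‖(X τ).errE‖)) :=
    continuous_iff_continuousAt.2 fun t =>
      (hcN.integral_hasStrictDerivAt 0 t).hasDerivAt.continuousAt
  refine (norm_nonneg (X T).errF).trans ?_
  refine norm_le_of_damped (f := fun τ => (X τ).errF)
    (g := fun τ => (X τ).forceF) (a := fun τ => 2 * (X τ).size) (r := 0)
    (B := fun t => ‖A.errF‖ + (∫ τ in (0 : ℝ)..t, (-(2 * (X τ).size) * ‖(X τ).errF‖ +
      2 * ‖(X τ).errF‖ ^ 2 + 2 * (((X τ).size + ‖(X τ).errF‖) * ‖(X τ).errE‖))) +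
      (A.size - (X t).size))
    (B' := fun t => (-(2 * (X t).size) * ‖(X t).errF‖ +
      2 * ‖(X t).errF‖ ^ 2 + 2 * (((X t).size + ‖(X t).errF‖) * ‖(X t).errE‖)) +
      -(-2 * (X t).imbalance))
    (continuous_errF.comp hc).continuousOn ?_
    ((continuous_const.add hcI).add (continuous_const.sub hcs)).continuousOn ?_ ?_ ?_ T
    ⟨hT, le_rfl⟩
  · intro t ht
    exact (h.hasDerivWithinAt_errF hm hn ht.1).mono (Set.Ici_subset_Ici.2 ht.1)
  · intro t ht
    exact ((hcN.integral_hasStrictDerivAt 0 t).hasDerivAt.hasDerivWithinAt.const_add _).add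
      (((h.hasDerivWithinAt_size hm hn ht.1).mono (Set.Ici_subset_Ici.2 ht.1)).const_sub _)
  · simp [h.1]
  · intro t _
    have h2 := (X t).norm_forceF_le hn
    linarith

theorem abs_coupling_le (hm : 0 < m) (hn : 0 < n) (A : MatOperator m n k) {S : ℝ}
    (hS : A.size + A.errNorm ≤ S) (P : Matrix (Fin m) (Fin m) ℝ) (Q : Matrix (Fin n) (Fin n) ℝ) :
    |A.coupling P Q| ≤ S * (√(frobSq P / m) * √(frobSq Q / n)) := by
  have hm' : (0 : ℝ) < m := by positivity
  have hn' : (0 : ℝ) < n := by positivity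
  have hP : 0 ≤ frobSq P / m := div_nonneg (frobSq_nonneg _) hm'.le
  have hQ : 0 ≤ frobSq Q / n := div_nonneg (frobSq_nonneg _) hn'.le
  have hS0 : 0 ≤ S := (add_nonneg A.size_nonneg A.errNorm_nonneg).trans hS
  have hE : A.size + ‖A.errE‖ ≤ S := by linarith [A.norm_errE_le_errNorm]
  have hF : A.size + ‖A.errF‖ ≤ S := by linarith [A.norm_errF_le_errNorm]
  refine abs_le_of_sq_le_sq ?_ (by positivity)
  refine (A.coupling_sq_le hm hn P Q).trans ?_
  rw [mul_pow, mul_pow, Real.sq_sqrt hP, Real.sq_sqrt hQ, mul_div_assoc, mul_div_assoc]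
  calc (A.size + ‖A.errE‖) * (frobSq P / m) * ((A.size + ‖A.errF‖) * (frobSq Q / n))
      ≤ S * (frobSq P / m) * (S * (frobSq Q / n)) := by
        have := add_nonneg A.size_nonneg (norm_nonneg A.errF)
        gcongr
    _ = _ := by ring

theorem sqrt_frobSq_div_le {α : Type*} [Fintype α] {c N : ℝ} {P P' : Matrix α α ℝ}
    (hc : 0 ≤ c) (hN : 0 ≤ N) (h : frobSq P' ≤ N ^ 2 * frobSq P) :
    √(frobSq P' / c) ≤ N * √(frobSq P / c) := by
  rw [← Real.sqrt_sq hN, ← Real.sqrt_mul (sq_nonneg N), ← mul_div_assoc]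
  exact Real.sqrt_le_sqrt (div_le_div_of_nonneg_right h hc)

/-- The drift of the coupling form along the flow. -/
theorem IsGradientFlow.abs_coupling_sub_le (hm : 0 < m) (hn : 0 < n) (h : A.IsGradientFlow X)
    (hc : Continuous X) {T S : ℝ} (hT : 0 ≤ T)
    (hS : ∀ t, 0 ≤ t → t ≤ T → (X t).size + (X t).errNorm ≤ S)
    (P : Matrix (Fin m) (Fin m) ℝ) (Q : Matrix (Fin n) (Fin n) ℝ) :
    |(X T).coupling P Q - A.coupling P Q| ≤
      2 * S * (√(frobSq P / m) * √(frobSq Q / n)) *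
        ∫ τ in (0 : ℝ)..T, (‖(X τ).errE‖ + ‖(X τ).errF‖) := by
  have hm' : (0 : ℝ) < m := by positivity
  have hn' : (0 : ℝ) < n := by positivity
  have hcE : Continuous fun τ => ‖(X τ).errE‖ := (continuous_errE.comp hc).norm
  have hcF : Continuous fun τ => ‖(X τ).errF‖ := (continuous_errF.comp hc).norm
  have hcN : Continuous fun τ => ‖(X τ).errE‖ + ‖(X τ).errF‖ := hcE.add hcF
  have hcI : Continuous fun t => ∫ τ in (0 : ℝ)..t, (‖(X τ).errE‖ + ‖(X τ).errF‖) :=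
    continuous_iff_continuousAt.2 fun t =>
      (hcN.integral_hasStrictDerivAt 0 t).hasDerivAt.continuousAt
  set K := 2 * S * (√(frobSq P / m) * √(frobSq Q / n)) with hK
  rw [← Real.norm_eq_abs]
  refine norm_le_of_damped (f := fun τ => (X τ).coupling P Q - A.coupling P Q)
    (g := fun t => (X t).coupling ((X t).errE * P) Q + (X t).coupling (P * (X t).errE) Q +
        ((X t).coupling P ((X t).errF * Q) + (X t).coupling P (Q * (X t).errF)))
    (a := fun _ => 0) (r := 0)
    (B := fun t => K * ∫ τ in (0 : ℝ)..t, (‖(X τ).errE‖ + ‖(X τ).errF‖))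
    (B' := fun t => K * (‖(X t).errE‖ + ‖(X t).errF‖)) ?_ ?_
    (continuous_const.mul hcI).continuousOn ?_ ?_ ?_ T ⟨hT, le_rfl⟩
  · exact fun t ht => (((h.hasDerivWithinAt_coupling ht.1 P Q).mono
      Set.Icc_subset_Ici_self).sub_const _).continuousWithinAt
  · intro t ht
    rw [neg_zero, zero_smul, zero_add]
    exact ((h.hasDerivWithinAt_coupling ht.1 P Q).mono (Set.Ici_subset_Ici.2 ht.1)).sub_const _
  · intro t ht
    exact (hcN.integral_hasStrictDerivAt 0 t).hasDerivAt.hasDerivWithinAt.const_mul _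
  · simp [h.1]
  · intro t ht
    rw [neg_zero, zero_mul, zero_add]
    have hSt := hS t ht.1 ht.2.le
    have hS0 : 0 ≤ S := (add_nonneg (X t).size_nonneg (X t).errNorm_nonneg).trans hSt
    set x := √(frobSq P / m)
    set y := √(frobSq Q / n)
    have hx : 0 ≤ x := Real.sqrt_nonneg _
    have hy : 0 ≤ y := Real.sqrt_nonneg _
    have hE := norm_nonneg (X t).errE
    have hF := norm_nonneg (X t).errF
    have b1 : |(X t).coupling ((X t).errE * P) Q| ≤ S * (‖(X t).errE‖ * x * y) := by
      refine ((X t).abs_coupling_le hm hn hSt _ _).trans ?_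
      gcongr
      exact sqrt_frobSq_div_le hm'.le hE (frobSq_mul_le_left _ _)
    have b2 : |(X t).coupling (P * (X t).errE) Q| ≤ S * (‖(X t).errE‖ * x * y) := by
      refine ((X t).abs_coupling_le hm hn hSt _ _).trans ?_
      gcongr
      exact sqrt_frobSq_div_le hm'.le hE ((frobSq_mul_le_right _ _).trans_eq (mul_comm _ _))
    have b3 : |(X t).coupling P ((X t).errF * Q)| ≤ S * (x * (‖(X t).errF‖ * y)) := by
      refine ((X t).abs_coupling_le hm hn hSt _ _).trans ?_
      gcongr
      exact sqrt_frobSq_div_le hn'.le hF (frobSq_mul_le_left _ _)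
    have b4 : |(X t).coupling P (Q * (X t).errF)| ≤ S * (x * (‖(X t).errF‖ * y)) := by
      refine ((X t).abs_coupling_le hm hn hSt _ _).trans ?_
      gcongr
      exact sqrt_frobSq_div_le hn'.le hF ((frobSq_mul_le_right _ _).trans_eq (mul_comm _ _))
    rw [Real.norm_eq_abs]
    have t1 := abs_add_le ((X t).coupling ((X t).errE * P) Q + (X t).coupling (P * (X t).errE) Q)
      ((X t).coupling P ((X t).errF * Q) + (X t).coupling P (Q * (X t).errF))
    have t2 := abs_add_le ((X t).coupling ((X t).errE * P) Q) ((X t).coupling (P * (X t).errE) Q)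
    have t3 := abs_add_le ((X t).coupling P ((X t).errF * Q))
      ((X t).coupling P (Q * (X t).errF))
    rw [hK]
    linarith

/-- A bound of the coupling of the error matrices bounds the speed of the flow from below. -/
theorem le_size_flowField (hm : 0 < m) (hn : 0 < n) (A : MatOperator m n k) {G : ℝ} (hG : 0 ≤ G)
    (h : |A.coupling A.errE A.errF| ≤ G * (√(frobSq A.errE / m) * √(frobSq A.errF / n))) :
    (A.size - A.errNorm - G) * A.imbalance ≤ A.flowField.size := by
  have hm' : (0 : ℝ) < m := by positivity
  have hn' : (0 : ℝ) < n := by positivity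
  have hP : 0 ≤ frobSq A.errE / m := div_nonneg (frobSq_nonneg _) hm'.le
  have hQ : 0 ≤ frobSq A.errF / n := div_nonneg (frobSq_nonneg _) hn'.le
  rw [size_flowField, frobInner_mul_rowGram_eq hm, frobInner_colGram_mul_eq hn, imbalance,
    sub_div, sub_div, mul_div_assoc, mul_div_assoc]
  have h1 : frobInner A.errE (A.errE * A.errE) / m ≤ A.errNorm * (frobSq A.errE / m) := by
    rw [← mul_div_assoc]
    refine div_le_div_of_nonneg_right ?_ hm'.le
    refine ((le_abs_self _).trans (abs_frobInner_mul_left_le _ _)).trans ?_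
    exact mul_le_mul_of_nonneg_right A.norm_errE_le_errNorm (frobSq_nonneg _)
  have h2 : frobInner A.errF (A.errF * A.errF) / n ≤ A.errNorm * (frobSq A.errF / n) := by
    rw [← mul_div_assoc]
    refine div_le_div_of_nonneg_right ?_ hn'.le
    refine ((le_abs_self _).trans (abs_frobInner_mul_left_le _ _)).trans ?_
    exact mul_le_mul_of_nonneg_right A.norm_errF_le_errNorm (frobSq_nonneg _)
  have h3 := (abs_le.1 h).1
  -- The doubled coupling is bounded by G times the imbalance itself, as the two squares sum to Δ.
  have h4 := two_mul_le_add_sq √(frobSq A.errE / m) √(frobSq A.errF / n)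
  rw [Real.sq_sqrt hP, Real.sq_sqrt hQ] at h4
  have h5 := mul_le_mul_of_nonneg_left h4 hG
  linarith

end MatOperator

/-! ### The bootstrap for at least two rows. -/

namespace MatOperator

variable {m n k : ℕ} {A : MatOperator m n k} {X : ℝ → MatOperator m n k}

/-- The accumulated operator norms of the error matrices up to time `T`. -/
noncomputable def errIntegral (X : ℝ → MatOperator m n k) (T : ℝ) : ℝ :=
  ∫ τ in (0 : ℝ)..T, (‖(X τ).errE‖ + ‖(X τ).errF‖)

theorem continuous_norm_errE_add (hc : Continuous X) :
    Continuous fun τ => ‖(X τ).errE‖ + ‖(X τ).errF‖ :=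
  (continuous_errE.comp hc).norm.add (continuous_errF.comp hc).norm

theorem continuous_errIntegral (hc : Continuous X) : Continuous (errIntegral X) :=
  continuous_iff_continuousAt.2 fun t =>
    ((continuous_norm_errE_add hc).integral_hasStrictDerivAt 0 t).hasDerivAt.continuousAt

theorem monotone_errIntegral (hc : Continuous X) : Monotone (errIntegral X) := by
  refine monotone_of_hasDerivAt_nonneg (f' := fun t => ‖(X t).errE‖ + ‖(X t).errF‖)
    (fun t => ((continuous_norm_errE_add hc).integral_hasStrictDerivAt 0 t).hasDerivAt) ?_
  exact fun t => add_nonneg (norm_nonneg _) (norm_nonneg _)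

theorem IsGradientFlow.size_le (hm : 0 < m) (hn : 0 < n) (h : A.IsGradientFlow X) {t : ℝ}
    (ht : 0 ≤ t) : (X t).size ≤ A.size := by
  have := h.antitoneOn_size hm hn Set.self_mem_Ici ht ht
  simpa only [h.1] using this

/-- At a time where the error norm is maximal, the quadratic term is at most 4/64 of that maximum
and is absorbed into the left side; hence the ratio 16/15. -/
theorem IsGradientFlow.errNorm_le (hm : 0 < m) (hn : 0 < n) (h : A.IsGradientFlow X)
    (hc : Continuous X) {T : ℝ} (hT : 0 ≤ T) (hJ : errIntegral X T ≤ 1 / 64) {t : ℝ}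
    (ht : 0 ≤ t) (htT : t ≤ T) :
    15 * (X t).errNorm ≤ 16 * (A.errNorm + (A.size - (X T).size)) := by
  obtain ⟨r, hr, hmax⟩ := isCompact_Icc.exists_isMaxOn (Set.nonempty_Icc.2 hT)
    (continuous_errNorm.comp hc).continuousOn
  have hN0 := (X r).errNorm_nonneg
  have h1 := h.errNorm_le_integral hm hn hc hr.1
  have h2 : (∫ τ in (0 : ℝ)..r, 4 * (X τ).errNorm ^ 2) ≤ 4 * (X r).errNorm * errIntegral X r := by
    rw [errIntegral, ← intervalIntegral.integral_const_mul]
    refine intervalIntegral.integral_mono_on hr.1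
      ((continuous_const.mul ((continuous_errNorm.comp hc).pow 2)).intervalIntegrable _ _)
      ((continuous_const.mul (continuous_norm_errE_add hc)).intervalIntegrable _ _)
      fun τ hτ => ?_
    have h3 : (X τ).errNorm ≤ (X r).errNorm := hmax ⟨hτ.1, hτ.2.trans hr.2⟩
    have h4 := (X τ).errNorm_le_add
    have h5 := (X τ).errNorm_nonneg
    rw [mul_assoc, sq]
    exact mul_le_mul_of_nonneg_left (mul_le_mul h3 h4 h5 hN0) (by norm_num)
  have h3 : errIntegral X r ≤ 1 / 64 := (monotone_errIntegral hc hr.2).trans hJ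
  have h4 := mul_le_mul_of_nonneg_left h3 (mul_nonneg zero_le_four hN0)
  have h5 : (X T).size ≤ (X r).size := h.antitoneOn_size hm hn hr.1 hT hr.2
  have h6 : (X t).errNorm ≤ (X r).errNorm := hmax ⟨ht, htT⟩
  linarith

theorem IsNearlyDoublyBalanced.errNorm_le {ε : ℝ} (hm : 0 < m) (hn : 0 < n) (hs : 0 < A.size)
    (hA : A.IsNearlyDoublyBalanced ε) : A.errNorm ≤ ε * A.size :=
  max_le (hA.norm_errE_le hm hs) (hA.norm_errF_le hm hn hs)

theorem IsNearlyDoublyBalanced.imbalance_le {ε : ℝ} (hm : 0 < m) (hn : 0 < n) (hs : 0 < A.size)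
    (hA : A.IsNearlyDoublyBalanced ε) : A.imbalance ≤ 2 * (ε * A.size) ^ 2 := by
  have h1 := pow_le_pow_left₀ (norm_nonneg _) (hA.norm_errE_le hm hs) 2
  have h2 := pow_le_pow_left₀ (norm_nonneg _) (hA.norm_errF_le hm hn hs) 2
  linarith [MatOperator.imbalance_le hm hn A]

/-- As long as the accumulated error is small, the spectral gap persists. -/
theorem IsGradientFlow.le_size_flowField_of_errIntegral_le {lam ε : ℝ} (hm : 0 < m) (hn : 2 ≤ n)
    (h : A.IsGradientFlow X) (hc : Continuous X) (hs : 0 < A.size) (hlam : 0 < lam)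
    (hlam1 : lam ≤ 1) (hA : A.IsNearlyDoublyBalanced ε) (hgap : A.HasSpectralGap lam)
    (hε : ε ≤ lam / 5000) {T : ℝ} (hT : 0 ≤ T) (hJ : errIntegral X T ≤ lam / 64)
    (hsT : A.size - (X T).size ≤ lam / 64 * A.size) {t : ℝ} (ht : 0 ≤ t) (htT : t ≤ T) :
    lam * A.size / 2 * (X t).imbalance ≤ (X t).flowField.size := by
  have hn0 : 0 < n := by omega
  have hm' : (0 : ℝ) < m := by positivity
  have hn' : (0 : ℝ) < n := by positivity
  have hε0 := hA.nonneg hm hs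
  have hls : lam * A.size ≤ A.size := mul_le_of_le_one_left hs.le hlam1
  have hls0 : 0 < lam * A.size := by positivity
  have hεs : ε * A.size ≤ lam * A.size / 5000 := by
    have := mul_le_mul_of_nonneg_right hε hs.le
    linarith
  have hN : ∀ τ, 0 ≤ τ → τ ≤ T → (X τ).errNorm ≤ lam * A.size / 32 := by
    intro τ h0 h1
    have h2 := h.errNorm_le hm hn0 hc hT (by linarith) h0 h1
    have h3 := hA.errNorm_le hm hn0 hs
    linarith
  have hS : ∀ τ, 0 ≤ τ → τ ≤ t → (X τ).size + (X τ).errNorm ≤ 2 * A.size := by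
    intro τ h0 h1
    have h2 := hN τ h0 (h1.trans htT)
    have h3 := h.size_le hm hn0 h0
    linarith
  -- The gap bound at time 0 plus the drift, which is at most 2 · (2s) · λ/64 = λs/16.
  have hcoup : ∀ (P : Matrix (Fin m) (Fin m) ℝ) (Q : Matrix (Fin n) (Fin n) ℝ),
      P.trace = 0 → Q.trace = 0 → |(X t).coupling P Q| ≤
        ((1 - lam + ε) * A.size + lam * A.size / 16) *
          (√(frobSq P / m) * √(frobSq Q / n)) := by
    intro P Q hP hQ
    have h1 := h.abs_coupling_sub_le hm hn0 hc ht hS P Q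
    have h2 : |A.coupling P Q| ≤ (1 - lam + ε) * A.size * (√(frobSq P / m) * √(frobSq Q / n)) := by
      have hPn : 0 ≤ frobSq P / m := div_nonneg (frobSq_nonneg _) hm'.le
      have hQn : 0 ≤ frobSq Q / n := div_nonneg (frobSq_nonneg _) hn'.le
      refine abs_le_of_sq_le_sq ?_ (mul_nonneg (mul_nonneg (by linarith) hs.le) (by positivity))
      rw [mul_pow, mul_pow √_, Real.sq_sqrt hPn, Real.sq_sqrt hQn, ← mul_assoc]
      exact hgap.coupling_sq_le hm hn hs hA (by linarith) hP hQ
    have h3 : errIntegral X t ≤ lam / 64 := (monotone_errIntegral hc htT).trans hJ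
    rw [← errIntegral] at h1
    set q := √(frobSq P / m) * √(frobSq Q / n) with hq
    have hq0 : 0 ≤ q := by positivity
    have h4 : 2 * (2 * A.size) * q * errIntegral X t ≤ 2 * (2 * A.size) * q * (lam / 64) :=
      mul_le_mul_of_nonneg_left h3 (by positivity)
    have h5 := abs_add_le ((X t).coupling P Q - A.coupling P Q) (A.coupling P Q)
    rw [sub_add_cancel] at h5
    linarith
  have hG : 0 ≤ (1 - lam + ε) * A.size + lam * A.size / 16 :=
    add_nonneg (mul_nonneg (by linarith) hs.le) (by positivity)
  have h1 := (X t).le_size_flowField hm hn0 hG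
    (hcoup _ _ (X t).trace_errE (X t).trace_errF)
  -- The gain λs loses λs/64 to the decrease of size, λs/32 to the error norm, λs/16 to the drift
  -- and λs/5000 to ε; more than λs/2 is left.
  refine le_trans (mul_le_mul_of_nonneg_right ?_ (X t).imbalance_nonneg) h1
  have h2 := hN t ht htT
  have h3 : (X T).size ≤ (X t).size := h.antitoneOn_size hm hn0 ht hT htT
  linarith

/-- The loss of size is controlled by the imbalance at time zero. -/
theorem IsGradientFlow.size_sub_le (hm : 0 < m) (hn : 0 < n) (h : A.IsGradientFlow X)
    {κ T : ℝ} (hT : 0 ≤ T)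
    (hV : ∀ t, 0 ≤ t → t ≤ T → κ * (X t).imbalance ≤ 4 * (X t).flowField.size) :
    κ * (A.size - (X T).size) ≤ 2 * A.imbalance := by
  have hmono : MonotoneOn (fun t => κ * (X t).size - 2 * (X t).imbalance) (Set.Icc 0 T) := by
    refine monotoneOn_of_hasDerivWithinAt_nonneg (convex_Icc 0 T)
      ((continuousOn_const.mul (continuous_size.comp_continuousOn h.continuousOn)).sub
        (continuousOn_const.mul (continuous_imbalance.comp_continuousOn h.continuousOn)) |>.mono
          Set.Icc_subset_Ici_self)
      (f' := fun t => κ * (-2 * (X t).imbalance) - 2 * (-4 * (X t).flowField.size))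
      (fun t ht => ?_) fun t ht => ?_
    · rw [interior_Icc] at ht ⊢
      exact (((h.hasDerivWithinAt_size hm hn ht.1.le).const_mul κ).sub
        ((h.hasDerivWithinAt_imbalance hm hn ht.1.le).const_mul 2)).mono
        (Set.Ioo_subset_Icc_self.trans Set.Icc_subset_Ici_self)
    · rw [interior_Icc] at ht
      linarith [hV t ht.1.le ht.2.le]
  have h1 := hmono ⟨le_rfl, hT⟩ ⟨hT, le_rfl⟩ hT
  simp only [h.1] at h1
  linarith [(X T).imbalance_nonneg]

/-- The integral of `min (1, M e^{-κ t})` is logarithmic in `M`. -/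
theorem integral_le_log_of_le_min {f : ℝ → ℝ} (hf : Continuous f) {c κ M T : ℝ}
    (hc : 0 ≤ c) (hκ : 0 < κ) (hM : 0 ≤ M) (hT : 0 ≤ T) (h1 : ∀ t, 0 ≤ t → t ≤ T → f t ≤ c)
    (h2 : ∀ t, 0 ≤ t → t ≤ T → f t ≤ c * (M * Real.exp (-(κ * t)))) :
    ∫ t in (0 : ℝ)..T, f t ≤ 2 * c / κ * Real.log (1 + M) := by
  have hpos : ∀ t, 0 < 1 + M * Real.exp (-(κ * t)) := fun t => by positivity
  -- With y = M e^{-κt} one has min(1, y) ≤ 2y/(1 + y), and the right side has a logarithm as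
  -- primitive.
  have hd : ∀ t, HasDerivAt (fun t => -(2 * c / κ) * Real.log (1 + M * Real.exp (-(κ * t))))
      (-(2 * c / κ) * (M * (Real.exp (-(κ * t)) * -(κ * 1)) / (1 + M * Real.exp (-(κ * t)))))
      t := fun t =>
    ((((((hasDerivAt_id t).const_mul κ).neg).exp.const_mul M).const_add 1).log
      (hpos t).ne').const_mul _
  have hcont : Continuous fun t => -(2 * c / κ) *
      (M * (Real.exp (-(κ * t)) * -(κ * 1)) / (1 + M * Real.exp (-(κ * t)))) := by
    refine continuous_const.mul (Continuous.div (by fun_prop) (by fun_prop) fun t => (hpos t).ne')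
  have hle : ∫ t in (0 : ℝ)..T, f t ≤ ∫ t in (0 : ℝ)..T, -(2 * c / κ) *
      (M * (Real.exp (-(κ * t)) * -(κ * 1)) / (1 + M * Real.exp (-(κ * t)))) := by
    refine intervalIntegral.integral_mono_on hT (hf.intervalIntegrable _ _)
      (hcont.intervalIntegrable _ _) fun t ht => ?_
    have h3 := h1 t ht.1 ht.2
    have h4 := h2 t ht.1 ht.2
    set y := M * Real.exp (-(κ * t)) with hy
    have hy0 : 0 ≤ y := by positivity
    have e : -(2 * c / κ) * (M * (Real.exp (-(κ * t)) * -(κ * 1)) / (1 + y)) =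
        2 * c * y / (1 + y) := by
      rw [hy]
      field_simp
    rw [e, le_div_iff₀ (by positivity)]
    rcases le_total y 1 with hy1 | hy1
    · have h5 := mul_le_mul_of_nonneg_right h4 (by positivity : 0 ≤ 1 + y)
      have h6 := mul_le_mul_of_nonneg_left hy1 (mul_nonneg hc hy0)
      linarith
    · have h5 := mul_le_mul_of_nonneg_right h3 (by positivity : 0 ≤ 1 + y)
      have h6 := mul_le_mul_of_nonneg_left hy1 hc
      linarith
  refine hle.trans ?_
  rw [intervalIntegral.integral_eq_sub_of_hasDerivAt (fun t _ => hd t)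
    (hcont.intervalIntegrable _ _)]
  have h3 : 0 ≤ 2 * c / κ * Real.log (1 + M * Real.exp (-(κ * T))) :=
    mul_nonneg (by positivity) (Real.log_nonneg (by
      have := hpos T
      nlinarith [mul_nonneg hM (Real.exp_pos (-(κ * T))).le]))
  simp only [mul_zero, neg_zero, Real.exp_zero, mul_one]
  linarith

theorem log_one_add_sqrt_le {x : ℝ} (hx : 2 ≤ x) : Real.log (1 + √x) ≤ 2 * Real.log x := by
  have h0 : 0 ≤ √x := Real.sqrt_nonneg _
  have h1 : √x ≤ x := by
    rw [Real.sqrt_le_left (by linarith)]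
    nlinarith
  have h2 : Real.log (x ^ 2) = 2 * Real.log x := by
    rw [Real.log_pow]
    norm_num
  rw [← h2]
  exact Real.log_le_log (by positivity) (by nlinarith)

/-- The bootstrap step: small accumulated errors are in fact even smaller. -/
theorem IsGradientFlow.errIntegral_lt {lam ε : ℝ} (hm : 2 ≤ m) (hn : 2 ≤ n)
    (h : A.IsGradientFlow X) (hc : Continuous X) (hs : 0 < A.size) (hlam : 0 < lam)
    (hlam1 : lam ≤ 1) (hA : A.IsNearlyDoublyBalanced ε) (hgap : A.HasSpectralGap lam)
    (hε : ε ≤ lam / 5000) (hlog : 10000 * ε * Real.log m ≤ lam ^ 2) {T : ℝ} (hT : 0 ≤ T)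
    (hJ : errIntegral X T ≤ lam / 64) (hsT : A.size - (X T).size ≤ lam / 64 * A.size) :
    errIntegral X T < lam / 64 ∧ A.size - (X T).size < lam / 64 * A.size := by
  have hm0 : 0 < m := by omega
  have hn0 : 0 < n := by omega
  have hm' : (2 : ℝ) ≤ m := by exact_mod_cast hm
  have hε0 := hA.nonneg hm0 hs
  have hls : lam * A.size ≤ A.size := mul_le_of_le_one_left hs.le hlam1
  have hls0 : 0 < lam * A.size := by positivity
  have hεs0 : 0 ≤ ε * A.size := by positivity
  have hεs : ε * A.size ≤ lam * A.size / 5000 := by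
    have := mul_le_mul_of_nonneg_right hε hs.le
    linarith
  have hV : ∀ t, 0 ≤ t → t ≤ T →
      2 * (lam * A.size) * (X t).imbalance ≤ 4 * (X t).flowField.size := by
    intro t ht htT
    linarith [h.le_size_flowField_of_errIntegral_le hm0 hn hc hs hlam hlam1 hA hgap hε hT hJ hsT
      ht htT]
  have hΔ0 := hA.imbalance_le hm0 hn0 hs
  -- The loss is at most Δ(0)/(λs) ≤ 2ε²s/λ, and one factor ε is spent against λ/5000.
  have hloss : A.size - (X T).size ≤ ε * A.size / 2500 := by
    have h1 := h.size_sub_le hm0 hn0 hT hV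
    have h2 : lam * A.size * (A.size - (X T).size) ≤ lam * A.size * (ε * A.size / 2500) := by
      have h3 := mul_le_mul_of_nonneg_left hεs hεs0
      linarith
    exact le_of_mul_le_mul_left h2 hls0
  have hN : ∀ t, 0 ≤ t → t ≤ T → (X t).errNorm ≤ 2 * (ε * A.size) := by
    intro t ht htT
    have h2 := h.errNorm_le hm0 hn0 hc hT (by linarith) ht htT
    have h3 := hA.errNorm_le hm0 hn0 hs
    linarith
  have hcE : Continuous fun τ => ‖(X τ).errE‖ := (continuous_errE.comp hc).norm
  have hcF : Continuous fun τ => ‖(X τ).errF‖ := (continuous_errF.comp hc).norm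
  have hcs : Continuous fun τ => (X τ).size := continuous_size.comp hc
  -- Here ‖E‖ is at most 2εs times min(1, √m e^{-λst}). The integral is at most (4ε/λ) ln(1 + √m) ≤
  -- 8ε ln m / λ, and the logarithmic hypothesis finishes.
  have hE : ∫ τ in (0 : ℝ)..T, ‖(X τ).errE‖ ≤ 8 * lam / 10000 := by
    have h1 := integral_le_log_of_le_min hcE (c := 2 * (ε * A.size)) (κ := lam * A.size)
      (M := √m) (T := T) (by positivity) hls0 (Real.sqrt_nonneg _) hT
      (fun t ht htT => (X t).norm_errE_le_errNorm.trans (hN t ht htT)) fun t ht htT => by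
        have h2 := h.imbalance_le_exp hm0 hn0 hV ht htT
        refine le_of_sq_le_sq ?_ (by positivity)
        have h3 := (X t).norm_errE_sq_le hm0
        have h4 : (2 * (ε * A.size) * (√m * Real.exp (-(lam * A.size * t)))) ^ 2 =
            m * (4 * (ε * A.size) ^ 2 * Real.exp (-(2 * (lam * A.size) * t))) := by
          have h5 : Real.exp (-(2 * (lam * A.size) * t)) =
              Real.exp (-(lam * A.size * t)) ^ 2 := by
            rw [← Real.exp_nat_mul]
            congr 1
            push_cast
            ring
          rw [h5, mul_pow, mul_pow √_, Real.sq_sqrt (by positivity)]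
          ring
        rw [h4]
        refine h3.trans (mul_le_mul_of_nonneg_left (h2.trans ?_) (by positivity))
        refine mul_le_mul_of_nonneg_right (hΔ0.trans ?_) (Real.exp_pos _).le
        nlinarith [sq_nonneg (ε * A.size)]
    have h2 := log_one_add_sqrt_le hm'
    have h3 : 2 * (2 * (ε * A.size)) / (lam * A.size) = 4 * ε / lam := by
      field_simp
      ring
    rw [h3] at h1
    refine h1.trans ((mul_le_mul_of_nonneg_left h2 (by positivity)).trans ?_)
    rw [div_mul_eq_mul_div, div_le_iff₀ hlam]
    linarith
  -- Size stays close to s(0), so the net damping of ‖F‖ is at least s(0) and the force of E is at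
  -- most 4s(0)‖E‖. The term 2ε pays for ‖F(0)‖ and the loss of size.
  have hF : ∫ τ in (0 : ℝ)..T, ‖(X τ).errF‖ ≤ 2 * ε + 4 * ∫ τ in (0 : ℝ)..T, ‖(X τ).errE‖ := by
    have h1 := h.integral_norm_errF_le hm0 hn0 hc hT
    have h2 : (∫ τ in (0 : ℝ)..T, (-(2 * (X τ).size) * ‖(X τ).errF‖ +
        2 * ‖(X τ).errF‖ ^ 2 + 2 * (((X τ).size + ‖(X τ).errF‖) * ‖(X τ).errE‖))) ≤
        ∫ τ in (0 : ℝ)..T, (A.size * (4 * ‖(X τ).errE‖ - ‖(X τ).errF‖)) := by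
      refine intervalIntegral.integral_mono_on hT
        (Continuous.intervalIntegrable (by fun_prop) _ _)
        (Continuous.intervalIntegrable (by fun_prop) _ _) fun τ hτ => ?_
      have h3 := (X τ).norm_errF_le_errNorm.trans (hN τ hτ.1 hτ.2)
      have h4 : (X T).size ≤ (X τ).size := h.antitoneOn_size hm0 hn0 hτ.1 hT hτ.2
      have h5 := h.size_le hm0 hn0 hτ.1
      have h6 := norm_nonneg (X τ).errE
      have h7 := norm_nonneg (X τ).errF
      have h8 : (X τ).size + ‖(X τ).errF‖ ≤ 2 * A.size := by linarith
      have h9 : A.size ≤ 2 * (X τ).size - 2 * ‖(X τ).errF‖ := by linarith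
      have h10 := mul_le_mul_of_nonneg_right h8 h6
      have h11 := mul_le_mul_of_nonneg_right h9 h7
      linarith
    rw [intervalIntegral.integral_const_mul, intervalIntegral.integral_sub
      (Continuous.intervalIntegrable (by fun_prop) _ _) (hcF.intervalIntegrable _ _),
      intervalIntegral.integral_const_mul] at h2
    have h3 := hA.norm_errF_le hm0 hn0 hs
    set IE := ∫ τ in (0 : ℝ)..T, ‖(X τ).errE‖
    set IF := ∫ τ in (0 : ℝ)..T, ‖(X τ).errF‖
    have h4 : A.size * IF ≤ A.size * (2 * ε + 4 * IE) := by linarith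
    exact le_of_mul_le_mul_left h4 hs
  constructor
  · rw [errIntegral, intervalIntegral.integral_add (hcE.intervalIntegrable _ _)
      (hcF.intervalIntegrable _ _)]
    linarith
  · linarith

/-- The accumulated error stays small for all times. -/
theorem IsGradientFlow.errIntegral_le {lam ε : ℝ} (hm : 2 ≤ m) (hn : 2 ≤ n)
    (h : A.IsGradientFlow X) (hc : Continuous X) (hs : 0 < A.size) (hlam : 0 < lam)
    (hlam1 : lam ≤ 1) (hA : A.IsNearlyDoublyBalanced ε) (hgap : A.HasSpectralGap lam)
    (hε : ε ≤ lam / 5000) (hlog : 10000 * ε * Real.log m ≤ lam ^ 2) {T : ℝ} (hT : 0 ≤ T) :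
    errIntegral X T ≤ lam / 64 ∧ A.size - (X T).size ≤ lam / 64 * A.size := by
  -- Both bootstrap quantities are scaled to the common threshold λs/64 and joined by a maximum. If
  -- this exceeded the threshold, it would equal it at some time, where the bootstrap step gives
  -- strict inequality.
  set Ψ : ℝ → ℝ := fun t =>
    max (errIntegral X t * A.size) (A.size - (X t).size) with hΨ
  have hcΨ : Continuous Ψ := ((continuous_errIntegral hc).mul continuous_const).max
    (continuous_const.sub (continuous_size.comp hc))
  have hiff : ∀ t, Ψ t ≤ lam / 64 * A.size ↔
      errIntegral X t ≤ lam / 64 ∧ A.size - (X t).size ≤ lam / 64 * A.size := by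
    intro t
    rw [hΨ, max_le_iff, mul_le_mul_iff_left₀ hs]
  rw [← hiff]
  by_contra! hlt
  have h0 : Ψ 0 ≤ lam / 64 * A.size := by
    have : Ψ 0 = 0 := by simp [hΨ, errIntegral, h.1]
    rw [this]
    positivity
  obtain ⟨r, hr, hΨr⟩ := intermediate_value_Icc hT hcΨ.continuousOn ⟨h0, hlt.le⟩
  have h1 := (hiff r).1 hΨr.le
  have h2 := h.errIntegral_lt hm hn hc hs hlam hlam1 hA hgap hε hlog hr.1 h1.1 h1.2
  have h3 : Ψ r < lam / 64 * A.size := max_lt (mul_lt_mul_of_pos_right h2.1 hs) h2.2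
  exact h3.ne hΨr

theorem IsGradientFlow.exists_limit_of_hasSpectralGap {lam ε : ℝ} (hm : 2 ≤ m) (hn : 2 ≤ n)
    (h : A.IsGradientFlow X) (hc : Continuous X) (hs : 0 < A.size) (hlam : 0 < lam)
    (hlam1 : lam ≤ 1) (hA : A.IsNearlyDoublyBalanced ε) (hgap : A.HasSpectralGap lam)
    (hlog : 10000 * ε * Real.log m ≤ lam ^ 2) :
    ∃ B : MatOperator m n k, Tendsto X atTop (𝓝 B) ∧ B.IsDoublyBalanced ∧
      A.sqDist B ≤ A.size * ε ^ 2 / lam := by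
  have hm0 : 0 < m := by omega
  have hn0 : 0 < n := by omega
  have hε0 := hA.nonneg hm0 hs
  -- Since m ≥ 2, ln m ≥ 1/2, so the logarithmic hypothesis bounds ε too, using λ ≤ 1.
  have hε : ε ≤ lam / 5000 := by
    have h1 : (1 : ℝ) / 2 ≤ Real.log m := by
      have h2 : Real.log 2 ≤ Real.log m :=
        Real.log_le_log two_pos (by exact_mod_cast hm)
      linarith [Real.log_two_gt_d9]
    have h2 := mul_le_mul_of_nonneg_left h1 (by positivity : 0 ≤ 10000 * ε)
    have h3 : lam ^ 2 ≤ lam := by nlinarith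
    linarith
  have hκ : 0 < lam * A.size / 2 := by positivity
  obtain ⟨B, hB, hB0, hdist⟩ := h.exists_limit hm0 hn0 (Real.sqrt_pos.2 hκ) fun t ht => by
    rw [Real.sq_sqrt hκ.le]
    obtain ⟨h1, h2⟩ := h.errIntegral_le hm hn hc hs hlam hlam1 hA hgap hε hlog ht
    exact h.le_size_flowField_of_errIntegral_le hm0 hn hc hs hlam hlam1 hA hgap hε ht h1 h2 ht
      le_rfl
  refine ⟨B, hB, isDoublyBalanced_of_imbalance_eq_zero hm0 hn0 hB0, ?_⟩
  rw [Real.sq_sqrt hκ.le] at hdist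
  have h1 := hdist.trans (hA.imbalance_le hm0 hn0 hs)
  rw [le_div_iff₀ hlam]
  have h2 : A.size * (A.sqDist B * lam) ≤ A.size * (A.size * ε ^ 2) := by linarith
  exact le_of_mul_le_mul_left h2 hs

end MatOperator

/-! ### A single row: conserved products and the arithmetic-geometric mean inequality. -/

/-- The inequality of arithmetic and geometric means with uniform weights. -/
theorem Finset.prod_le_arith_mean_pow {n : ℕ} (hn : 0 < n) {z : Fin n → ℝ} (hz : ∀ i, 0 ≤ z i) :
    ∏ i, z i ≤ ((∑ i, z i) / n) ^ n := by
  have hn' : (n : ℝ) ≠ 0 := by positivity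
  have h := Real.geom_mean_le_arith_mean Finset.univ (fun _ : Fin n => (1 : ℝ)) z
    (fun _ _ => zero_le_one) (by simp [hn]) (fun i _ => hz i)
  simp only [Real.rpow_one, Finset.sum_const, Finset.card_univ, Fintype.card_fin, one_mul,
    nsmul_eq_mul, mul_one] at h
  have h0 : 0 ≤ ∏ i, z i := Finset.prod_nonneg fun i _ => hz i
  have h1 := pow_le_pow_left₀ (Real.rpow_nonneg h0 _) h n
  rwa [← Real.rpow_natCast, ← Real.rpow_mul h0, inv_mul_cancel₀ hn', Real.rpow_one] at h1

/-- The product of functions with logarithmic derivatives adding up to zero is constant. -/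
theorem prod_eq_of_sum_log_deriv_eq_zero {ι : Type*} [Fintype ι] [DecidableEq ι]
    {f c : ι → ℝ → ℝ}
    (hf : ∀ j t, 0 ≤ t → HasDerivWithinAt (f j) (f j t * c j t) (Set.Ici 0) t)
    (hc : ∀ t, 0 ≤ t → ∑ j, c j t = 0) {t : ℝ} (ht : 0 ≤ t) :
    ∏ j, f j t = ∏ j, f j 0 := by
  have hd : ∀ τ, 0 ≤ τ → HasDerivWithinAt (fun τ => ∏ j, f j τ) 0 (Set.Ici 0) τ := by
    intro τ hτ
    refine (HasDerivWithinAt.fun_finsetProd (u := Finset.univ)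
      fun j _ => hf j τ hτ).congr_deriv ?_
    rw [← mul_zero (∏ j, f j τ), ← hc τ hτ, Finset.mul_sum]
    refine Finset.sum_congr rfl fun j _ => ?_
    rw [smul_eq_mul, ← mul_assoc, Finset.prod_erase_mul _ _ (Finset.mem_univ j)]
  exact constant_of_has_deriv_right_zero (a := 0) (b := t) (f := fun τ => ∏ j, f j τ)
    (fun τ hτ => (hd τ hτ.1).continuousWithinAt.mono Set.Icc_subset_Ici_self)
    (fun τ hτ => (hd τ hτ.1).mono (Set.Ici_subset_Ici.2 hτ.1)) t ⟨ht, le_rfl⟩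

namespace MatOperator

variable {n k : ℕ}

theorem abs_colGram_le_size {m : ℕ} (A : MatOperator m n k) (j l : Fin n) :
    |A.colGram j l| ≤ A.size := by
  have h1 : A.colGram j l = ∑ i, ∑ a, A i a j * A i a l := by
    simp [colGram, Matrix.sum_apply, Matrix.mul_apply]
  rw [h1, size]
  refine (Finset.abs_sum_le_sum_abs _ _).trans (Finset.sum_le_sum fun i _ => ?_)
  refine (Finset.abs_sum_le_sum_abs _ _).trans (Finset.sum_le_sum fun a _ => ?_)
  have hj : (A i a j) ^ 2 ≤ ∑ b, (A i a b) ^ 2 :=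
    Finset.single_le_sum (fun b _ => sq_nonneg (A i a b)) (Finset.mem_univ j)
  have hl : (A i a l) ^ 2 ≤ ∑ b, (A i a b) ^ 2 :=
    Finset.single_le_sum (fun b _ => sq_nonneg (A i a b)) (Finset.mem_univ l)
  rw [abs_le]
  constructor <;> nlinarith [sq_nonneg (A i a j + A i a l), sq_nonneg (A i a j - A i a l)]

theorem colGram_diag_nonneg {m : ℕ} (A : MatOperator m n k) (j : Fin n) : 0 ≤ A.colGram j j := by
  have h1 : A.colGram j j = ∑ i, ∑ a, A i a j * A i a j := by
    simp [colGram, Matrix.sum_apply, Matrix.mul_apply]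
  rw [h1]
  exact Finset.sum_nonneg fun i _ => Finset.sum_nonneg fun a _ => mul_self_nonneg _

theorem errE_eq_zero (A : MatOperator 1 n k) : A.errE = 0 := by
  have h := A.trace_errE
  rw [Matrix.trace_fin_one] at h
  ext a b
  rw [Subsingleton.elim a 0, Subsingleton.elim b 0, h]
  rfl

theorem errF_apply_self {m : ℕ} (A : MatOperator m n k) (j : Fin n) :
    A.errF j j = A.size - n * A.colGram j j := by
  simp [errF]

theorem errF_apply_ne {m : ℕ} (A : MatOperator m n k) {j l : Fin n} (hjl : j ≠ l) :
    A.errF j l = -(n * A.colGram j l) := by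
  simp [errF, hjl]

section Row

variable {A : MatOperator 1 n k} {X : ℝ → MatOperator 1 n k}

theorem IsGradientFlow.hasDerivWithinAt_colGram_apply (h : A.IsGradientFlow X) {t : ℝ}
    (ht : 0 ≤ t) (j l : Fin n) :
    HasDerivWithinAt (fun τ => (X τ).colGram j l)
      (2 * ∑ p, (X t).errF j p * (X t).colGram p l) (Set.Ici 0) t := by
  refine (Matrix.HasDerivWithinAt.entry (h.hasDerivWithinAt_colGram ht) j l).congr_deriv ?_
  have h0 : (X t).colMap 0 = 0 := by simp [colMap]
  rw [errE_eq_zero, h0, smul_zero, add_zero, ← errF_mul_colGram, Matrix.add_apply,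
    Matrix.mul_apply, two_mul]

/-- A diagonal Gram matrix stays diagonal along the flow of a single row. -/
theorem IsGradientFlow.colGram_apply_ne (hn : 0 < n) (h : A.IsGradientFlow X)
    (hdiag : ∀ j l, j ≠ l → A.colGram j l = 0) {t : ℝ} (ht : 0 ≤ t) {j l : Fin n} (hjl : j ≠ l) :
    (X t).colGram j l = 0 := by
  set v : ℝ → Fin n × Fin n → ℝ := fun τ p => if p.1 = p.2 then 0 else (X τ).colGram p.1 p.2
  set v' : ℝ → Fin n × Fin n → ℝ := fun τ p => if p.1 = p.2 then 0 else
    2 * ∑ q, (X τ).errF p.1 q * (X τ).colGram q p.2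
  have hv : ∀ τ, 0 ≤ τ → HasDerivWithinAt v (v' τ) (Set.Ici 0) τ := by
    intro τ hτ
    refine hasDerivWithinAt_pi.2 fun p => ?_
    by_cases hp : p.1 = p.2
    · simp only [v, v', hp, if_true]
      exact hasDerivWithinAt_const _ _ _
    · simp only [v, v', hp, if_false]
      exact h.hasDerivWithinAt_colGram_apply hτ _ _
  have hle : ∀ (τ : ℝ) (a b : Fin n), a ≠ b → |(X τ).colGram a b| ≤ ‖v τ‖ := by
    intro τ a b hab
    have := norm_le_pi_norm (v τ) (a, b)
    simpa [v, hab] using this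
  have hbound : ∀ τ ∈ Set.Ico 0 t,
      ‖v' τ‖ ≤ 2 * (n * (((1 + n) * A.size) + n * A.size)) * ‖v τ‖ := by
    intro τ hτ
    have hs := h.size_le one_pos hn hτ.1
    have hs0 := (X τ).size_nonneg
    have hs0' := A.size_nonneg
    refine (pi_norm_le_iff_of_nonneg (by positivity)).2 fun p => ?_
    by_cases hp : p.1 = p.2
    · simp only [v', hp, if_true, norm_zero]
      positivity
    · simp only [v', hp, if_false]
      rw [Real.norm_eq_abs, abs_mul, abs_two, mul_assoc, mul_assoc]
      refine mul_le_mul_of_nonneg_left ?_ zero_le_two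
      refine (Finset.abs_sum_le_sum_abs _ _).trans ?_
      have hterm : ∀ q, |(X τ).errF p.1 q * (X τ).colGram q p.2| ≤
          ((1 + n) * A.size + n * A.size) * ‖v τ‖ := by
        intro q
        have hv0 := norm_nonneg (v τ)
        rw [abs_mul]
        -- Every term has an off-diagonal Gram entry as a factor: the second factor when q is the
        -- row index, the first otherwise. The off-diagonal part thus satisfies a linear
        -- differential inequality and remains zero.
        by_cases hq : p.1 = q
        · rw [← hq, errF_apply_self]
          have h1 := hle τ p.1 p.2 hp
          have h2 : |(X τ).size - n * (X τ).colGram p.1 p.1| ≤ (1 + n) * A.size := by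
            have h3 := (X τ).abs_colGram_le_size p.1 p.1
            refine (abs_sub _ _).trans ?_
            rw [abs_of_nonneg hs0, abs_mul, Nat.abs_cast]
            have h4 : (n : ℝ) * |(X τ).colGram p.1 p.1| ≤ n * A.size := by
              gcongr
              exact h3.trans hs
            linarith
          have h5 := mul_le_mul h2 h1 (abs_nonneg _) (by positivity)
          have h6 : 0 ≤ n * A.size * ‖v τ‖ := by positivity
          linarith
        · rw [errF_apply_ne _ hq, abs_neg, abs_mul, Nat.abs_cast]
          have h1 := hle τ p.1 q hq
          have h2 := ((X τ).abs_colGram_le_size q p.2).trans hs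
          have h3 : n * |(X τ).colGram p.1 q| * |(X τ).colGram q p.2| ≤ n * ‖v τ‖ * A.size := by
            gcongr
          have h4 : 0 ≤ (1 + n) * A.size * ‖v τ‖ := by positivity
          linarith
      refine (Finset.sum_le_sum fun q _ => hterm q).trans_eq ?_
      simp
  have hzero := eq_zero_of_abs_deriv_le_mul_abs_self_of_eq_zero_right (a := 0) (b := t)
    (fun τ hτ => (hv τ hτ.1).continuousWithinAt.mono Set.Icc_subset_Ici_self)
    (fun τ hτ => (hv τ hτ.1).mono (Set.Ici_subset_Ici.2 hτ.1)) ?_ hbound t ⟨ht, le_rfl⟩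
  · have := congrFun hzero (j, l)
    simpa [v, hjl] using this
  · ext p
    by_cases hp : p.1 = p.2
    · simp [v, hp]
    · simp [v, hp, h.1, hdiag _ _ hp]

theorem IsGradientFlow.errF_apply_ne_eq_zero (hn : 0 < n) (h : A.IsGradientFlow X)
    (hdiag : ∀ j l, j ≠ l → A.colGram j l = 0) {t : ℝ} (ht : 0 ≤ t) {j l : Fin n} (hjl : j ≠ l) :
    (X t).errF j l = 0 := by
  rw [errF_apply_ne _ hjl, h.colGram_apply_ne hn hdiag ht hjl, mul_zero, neg_zero]

theorem IsGradientFlow.hasDerivWithinAt_colGram_self (hn : 0 < n) (h : A.IsGradientFlow X)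
    (hdiag : ∀ j l, j ≠ l → A.colGram j l = 0) (j : Fin n) {t : ℝ} (ht : 0 ≤ t) :
    HasDerivWithinAt (fun τ => (X τ).colGram j j)
      ((X t).colGram j j * (2 * (X t).errF j j)) (Set.Ici 0) t := by
  refine (h.hasDerivWithinAt_colGram_apply ht j j).congr_deriv ?_
  rw [Finset.sum_eq_single j (fun p _ hp => by
    rw [h.errF_apply_ne_eq_zero hn hdiag ht hp.symm, zero_mul]) (by simp)]
  ring

/-- The inner product of the `j`-th columns of two operators with a single row. -/
def colInner (A B : MatOperator 1 n k) (j : Fin n) : ℝ := ∑ i, A i 0 j * B i 0 j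

theorem colInner_self (A : MatOperator 1 n k) (j : Fin n) : A.colInner A j = A.colGram j j := by
  simp [colInner, colGram, Matrix.sum_apply, Matrix.mul_apply]

theorem sqDist_eq (A B : MatOperator 1 n k) :
    A.sqDist B = A.size - 2 * ∑ j, A.colInner B j + B.size := by
  simp only [sqDist, size, colInner, Finset.univ_unique, Finset.sum_singleton, Fin.default_eq_zero]
  rw [Finset.sum_comm (s := Finset.univ (α := Fin n)), Finset.mul_sum, ← Finset.sum_sub_distrib,
    ← Finset.sum_add_distrib]
  refine Finset.sum_congr rfl fun i _ => ?_
  rw [Finset.mul_sum, ← Finset.sum_sub_distrib, ← Finset.sum_add_distrib]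
  refine Finset.sum_congr rfl fun b _ => ?_
  ring

/-- With orthogonal columns F is diagonal, so each column is merely rescaled at the rate given by
its diagonal entry of F. These rates sum to zero, which makes the product of the pairings with the
initial columns conserved. -/
theorem IsGradientFlow.hasDerivWithinAt_colInner (hn : 0 < n) (h : A.IsGradientFlow X)
    (hdiag : ∀ j l, j ≠ l → A.colGram j l = 0) (j : Fin n) {t : ℝ} (ht : 0 ≤ t) :
    HasDerivWithinAt (fun τ => A.colInner (X τ) j)
      (A.colInner (X t) j * (X t).errF j j) (Set.Ici 0) t := by
  have h1 : HasDerivWithinAt (fun τ => A.colInner (X τ) j)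
      (∑ i, A i 0 j * (X t).flowField i 0 j) (Set.Ici 0) t :=
    HasDerivWithinAt.fun_sum fun i _ => (h.2 t ht i 0 j).const_mul _
  refine h1.congr_deriv ?_
  rw [colInner, Finset.sum_mul]
  refine Finset.sum_congr rfl fun i _ => ?_
  rw [flowField, errE_eq_zero, Matrix.zero_mul, zero_add, Matrix.mul_apply,
    Finset.sum_eq_single j (fun p _ hp => by
      rw [h.errF_apply_ne_eq_zero hn hdiag ht hp, mul_zero]) (by simp), mul_assoc]

theorem sum_errF_apply_self {m : ℕ} (A : MatOperator m n k) : ∑ j, A.errF j j = 0 := A.trace_errF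

/-- A vanishing column drives the whole operator to zero. -/
theorem IsGradientFlow.tendsto_zero (hn : 0 < n) (h : A.IsGradientFlow X)
    (hdiag : ∀ j l, j ≠ l → A.colGram j l = 0) {j : Fin n} (hj : A.colGram j j = 0) :
    Tendsto X atTop (𝓝 0) := by
  have hn' : (0 : ℝ) < n := by positivity
  have hzero : ∀ t, 0 ≤ t → (X t).colGram j j = 0 := by
    intro t ht
    refine eq_zero_of_abs_deriv_le_mul_abs_self_of_eq_zero_right (a := 0) (b := t)
      (f := fun τ => (X τ).colGram j j) (K := 2 * ((1 + n) * A.size))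
      (fun τ hτ => (h.hasDerivWithinAt_colGram_self hn hdiag j
        hτ.1).continuousWithinAt.mono Set.Icc_subset_Ici_self)
      (fun τ hτ => (h.hasDerivWithinAt_colGram_self hn hdiag j
        hτ.1).mono (Set.Ici_subset_Ici.2 hτ.1)) (by simpa only [h.1] using hj)
      (fun τ hτ => ?_) t ⟨ht, le_rfl⟩
    have hs := h.size_le one_pos hn hτ.1
    have hs0 := (X τ).size_nonneg
    have h3 := (X τ).abs_colGram_le_size j j
    rw [Real.norm_eq_abs, Real.norm_eq_abs, abs_mul, mul_comm, abs_mul, abs_two,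
      errF_apply_self]
    gcongr
    refine (abs_sub _ _).trans ?_
    rw [abs_of_nonneg hs0, abs_mul, Nat.abs_cast]
    have h4 : (n : ℝ) * |(X τ).colGram j j| ≤ n * A.size := by
      gcongr
      exact h3.trans hs
    linarith
  -- At the vanishing column the diagonal entry of F equals s. So s' ≤ -2s²/n, which drives s to
  -- zero.
  have hΔ : ∀ t, 0 ≤ t → (X t).size ^ 2 / n ≤ (X t).imbalance := by
    intro t ht
    have h1 : (X t).errF j j = (X t).size := by rw [errF_apply_self, hzero t ht]; ring
    have h2 : (X t).size ^ 2 ≤ frobSq (X t).errF := by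
      rw [← h1, frobSq_eq_sum]
      exact (Finset.single_le_sum (f := fun b => (X t).errF j b ^ 2)
        (fun b _ => sq_nonneg _) (Finset.mem_univ j)).trans
        (Finset.single_le_sum (f := fun a => ∑ b, (X t).errF a b ^ 2)
          (fun a _ => Finset.sum_nonneg fun b _ => sq_nonneg _) (Finset.mem_univ j))
    have h3 := div_le_div_of_nonneg_right h2 hn'.le
    have h4 : 0 ≤ frobSq (X t).errE / ((1 : ℕ) : ℝ) :=
      div_nonneg (frobSq_nonneg _) (Nat.cast_nonneg _)
    rw [imbalance]
    linarith
  have hsmall : ∀ δ : ℝ, 0 < δ → ∃ T, 0 ≤ T ∧ (X T).size < δ := by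
    intro δ hδ
    by_contra! hge
    set κ := 2 * (δ ^ 2 / n) with hκ
    have hκ0 : 0 < κ := by positivity
    have hanti : AntitoneOn (fun t => (X t).size + κ * t) (Set.Ici 0) := by
      refine antitoneOn_of_hasDerivWithinAt_nonpos (convex_Ici 0)
        ((continuous_size.comp_continuousOn h.continuousOn).add (by fun_prop))
        (f' := fun t => -2 * (X t).imbalance + κ * 1) (fun t ht => ?_) fun t ht => ?_
      · rw [interior_Ici] at ht ⊢
        exact ((h.hasDerivWithinAt_size one_pos hn (le_of_lt ht)).add
          ((hasDerivWithinAt_id t _).const_mul κ)).mono Set.Ioi_subset_Ici_self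
      · rw [interior_Ici] at ht
        have ht0 : 0 ≤ t := le_of_lt ht
        have h1 := hΔ t ht0
        have h2 : δ ^ 2 / n ≤ (X t).size ^ 2 / n :=
          div_le_div_of_nonneg_right (pow_le_pow_left₀ hδ.le (hge t ht0) 2) hn'.le
        linarith
    have hT : 0 ≤ (A.size + 1) / κ := div_nonneg (by linarith [A.size_nonneg]) hκ0.le
    have h1 := hanti Set.self_mem_Ici hT hT
    simp only [h.1, mul_zero, add_zero, mul_div_cancel₀ _ hκ0.ne'] at h1
    linarith [(X ((A.size + 1) / κ)).size_nonneg]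
  refine tendsto_zero_iff_norm_tendsto_zero.2 (Metric.tendsto_atTop.2 fun δ hδ => ?_)
  obtain ⟨T, hT0, hT⟩ := hsmall ((δ / 2) ^ 2) (by positivity)
  refine ⟨T, fun t ht => ?_⟩
  have h1 : (X t).size ≤ (X T).size :=
    h.antitoneOn_size one_pos hn hT0 (hT0.trans ht) ht
  have h2 := norm_le_of_size_le (by positivity : 0 ≤ δ / 2) (h1.trans hT.le)
  rw [dist_zero_right, norm_norm]
  linarith

/-- Convergence when all columns are orthogonal and nonzero. -/
theorem IsGradientFlow.exists_limit_of_orthogonal (hn : 0 < n) (h : A.IsGradientFlow X)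
    (hdiag : ∀ j l, j ≠ l → A.colGram j l = 0) (hpos : ∀ j, 0 < A.colGram j j)
    (hs : 0 < A.size) {ε : ℝ} (hε : ∀ j, |A.errF j j| ≤ ε * A.size) :
    ∃ B : MatOperator 1 n k, Tendsto X atTop (𝓝 B) ∧ B.imbalance = 0 ∧
      A.sqDist B ≤ A.size * ε ^ 2 := by
  have hn' : (0 : ℝ) < n := by positivity
  set G := ∏ j, A.colGram j j with hG
  have hG0 : 0 < G := Finset.prod_pos fun j _ => hpos j
  have hprod : ∀ t, 0 ≤ t → ∏ j, (X t).colGram j j = G := by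
    intro t ht
    have := prod_eq_of_sum_log_deriv_eq_zero (f := fun j τ => (X τ).colGram j j)
      (c := fun j τ => 2 * (X τ).errF j j)
      (fun j τ hτ => h.hasDerivWithinAt_colGram_self hn hdiag j hτ)
      (fun τ _ => by rw [← Finset.mul_sum, sum_errF_apply_self, mul_zero]) ht
    simpa only [h.1] using this
  have hprodw : ∀ t, 0 ≤ t → ∏ j, A.colInner (X t) j = G := by
    intro t ht
    have := prod_eq_of_sum_log_deriv_eq_zero (f := fun j τ => A.colInner (X τ) j)
      (c := fun j τ => (X τ).errF j j)
      (fun j τ hτ => h.hasDerivWithinAt_colInner hn hdiag j hτ)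
      (fun τ _ => sum_errF_apply_self _) ht
    simpa only [h.1, colInner_self] using this
  -- A pairing that became negative would pass through zero, contradicting the conserved positive
  -- product.
  have hwpos : ∀ t, 0 ≤ t → ∀ j, 0 ≤ A.colInner (X t) j := by
    intro t ht j
    by_contra! hneg
    have hcont : ContinuousOn (fun τ => A.colInner (X τ) j) (Set.Icc 0 t) := fun τ hτ =>
      (h.hasDerivWithinAt_colInner hn hdiag j hτ.1).continuousWithinAt.mono
        Set.Icc_subset_Ici_self
    have h0 : (0 : ℝ) ≤ A.colInner (X 0) j := by
      rw [h.1, colInner_self]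
      exact (hpos j).le
    obtain ⟨r, hr, hr0⟩ := intermediate_value_Icc' ht hcont ⟨hneg.le, h0⟩
    have h1 := hprodw r hr.1
    rw [Finset.prod_eq_zero (Finset.mem_univ j) hr0] at h1
    exact hG0.ne h1
  -- The product of the squared column norms is fixed and each of the other n - 1 is at most s(0),
  -- so none falls below μ. This bounds the speed from below; the resulting distance bound depends
  -- on μ and is discarded.
  set μ := G / A.size ^ (n - 1) with hμ
  have hμ0 : 0 < μ := by positivity
  have hge : ∀ t, 0 ≤ t → ∀ j, μ ≤ (X t).colGram j j := by
    intro t ht j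
    rw [hμ, div_le_iff₀ (by positivity), ← hprod t ht,
      ← Finset.mul_prod_erase _ _ (Finset.mem_univ j)]
    refine mul_le_mul_of_nonneg_left ?_ ((X t).colGram_diag_nonneg j)
    have h1 : ∏ l ∈ Finset.univ.erase j, (X t).colGram l l ≤
        ∏ _l ∈ Finset.univ.erase j, A.size :=
      Finset.prod_le_prod (fun l _ => (X t).colGram_diag_nonneg l) fun l _ =>
        ((le_abs_self _).trans ((X t).abs_colGram_le_size l l)).trans (h.size_le one_pos hn ht)
    refine h1.trans_eq ?_
    rw [Finset.prod_const, Finset.card_erase_of_mem (Finset.mem_univ j), Finset.card_univ,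
      Fintype.card_fin]
  have hV : ∀ t, 0 ≤ t → √(μ * n) ^ 2 * (X t).imbalance ≤ (X t).flowField.size := by
    intro t ht
    have h0 : (X t).coupling 0 (X t).errF = 0 := by simp [coupling, frobInner]
    have h1 : frobInner (0 : Matrix (Fin 1) (Fin 1) ℝ) (0 * (X t).rowGram) = 0 := by
      simp [frobInner]
    rw [Real.sq_sqrt (by positivity), imbalance, size_flowField, errE_eq_zero, h0, h1,
      frobSq_eq_zero.2 rfl, zero_div, zero_add, zero_add, mul_zero, add_zero, mul_assoc,
      mul_div_cancel₀ _ hn'.ne', frobSq_eq_sum, frobInner, Finset.mul_sum]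
    refine Finset.sum_le_sum fun j _ => ?_
    rw [Finset.sum_eq_single j (fun l _ hl => by
        rw [h.errF_apply_ne_eq_zero hn hdiag ht hl.symm]; ring) (by simp),
      Finset.sum_eq_single j (fun l _ hl => by
        rw [h.errF_apply_ne_eq_zero hn hdiag ht hl.symm, zero_mul]) (by simp),
      Matrix.mul_apply, Finset.sum_eq_single j (fun l _ hl => by
        rw [h.colGram_apply_ne hn hdiag ht hl.symm, zero_mul]) (by simp)]
    have h2 := mul_le_mul_of_nonneg_right (hge t ht j) (sq_nonneg ((X t).errF j j))
    linarith
  obtain ⟨B, hB, hB0, -⟩ := h.exists_limit one_pos hn (Real.sqrt_pos.2 (by positivity)) hV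
  refine ⟨B, hB, hB0, ?_⟩
  have hBF : B.errF = 0 := by
    have h1 : 0 ≤ frobSq B.errE / ((1 : ℕ) : ℝ) :=
      div_nonneg (frobSq_nonneg _) (Nat.cast_nonneg _)
    have h2 : 0 ≤ frobSq B.errF / n := div_nonneg (frobSq_nonneg _) hn'.le
    rw [imbalance] at hB0
    have h3 : frobSq B.errF / n = 0 := by linarith
    rw [div_eq_zero_iff, or_iff_left hn'.ne'] at h3
    exact frobSq_eq_zero.1 h3
  have hBg : ∀ j, B.colGram j j = B.size / n := by
    intro j
    have h1 := B.errF_apply_self j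
    rw [hBF, Matrix.zero_apply] at h1
    rw [eq_div_iff hn'.ne']
    linarith
  have hBprod : (B.size / n) ^ n = G := by
    have hcont : Continuous fun Y : MatOperator 1 n k => ∏ j, Y.colGram j j :=
      continuous_finsetProd _ fun j _ => continuous_colGram.matrix_elem j j
    have h1 := (hcont.tendsto B).comp hB
    have h2 : Tendsto (fun t => ∏ j, (X t).colGram j j) atTop (𝓝 G) :=
      tendsto_const_nhds.congr' (by
        filter_upwards [eventually_ge_atTop 0] with t ht
        exact (hprod t ht).symm)
    have h3 := tendsto_nhds_unique h1 h2
    simpa only [hBg, Finset.prod_const, Finset.card_univ, Fintype.card_fin] using h3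
  have hcontw : ∀ j, Continuous fun Y : MatOperator 1 n k => A.colInner Y j := by
    intro j
    unfold colInner
    fun_prop
  have hBw : ∀ j, 0 ≤ A.colInner B j := fun j =>
    ge_of_tendsto (((hcontw j).tendsto B).comp hB) (by
      filter_upwards [eventually_ge_atTop 0] with t ht
      exact hwpos t ht j)
  have hBwprod : ∏ j, A.colInner B j = G := by
    have hcont : Continuous fun Y : MatOperator 1 n k => ∏ j, A.colInner Y j :=
      continuous_finsetProd _ fun j _ => hcontw j
    have h1 := (hcont.tendsto B).comp hB
    have h2 : Tendsto (fun t => ∏ j, A.colInner (X t) j) atTop (𝓝 G) :=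
      tendsto_const_nhds.congr' (by
        filter_upwards [eventually_ge_atTop 0] with t ht
        exact (hprodw t ht).symm)
    exact tendsto_nhds_unique h1 h2
  have hBs := B.size_nonneg
  -- In the limit all squared column norms equal s(B)/n and have the same product G as the pairings.
  -- The mean inequality then bounds the sum of pairings below by s(B), so the distance is at most
  -- the loss of size.
  have hW : B.size ≤ ∑ j, A.colInner B j := by
    have h1 := Finset.prod_le_arith_mean_pow hn hBw
    rw [hBwprod, ← hBprod] at h1
    have h2 : 0 ≤ ∑ j, A.colInner B j := Finset.sum_nonneg fun j _ => hBw j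
    have h3 := le_of_pow_le_pow_left₀ hn.ne' (by positivity) h1
    exact (div_le_div_iff_of_pos_right hn').1 h3
  have hloss : A.sqDist B ≤ A.size - B.size := by
    rw [sqDist_eq]
    linarith
  refine hloss.trans ?_
  rcases le_total 1 (ε ^ 2) with hε1 | hε1
  · have := mul_le_mul_of_nonneg_left hε1 hs.le
    linarith
  -- The squared column norms are u - xⱼ with xⱼ of zero sum and |xⱼ| ≤ εu. Multiplying each by u +
  -- xⱼ gives at least (1 - ε²)u², while the product of the factors u + xⱼ is at most uⁿ. Hence G ≥
  -- ((1 - ε²)u)ⁿ, that is, s(B) ≥ (1 - ε²)s(A).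
  · set u := A.size / n with hu
    have hu0 : 0 < u := by positivity
    have hgu : ∀ j, A.colGram j j = u - A.errF j j / n := by
      intro j
      rw [errF_apply_self, hu]
      field_simp
      ring
    have hsq : ∀ j, (A.errF j j / n) ^ 2 ≤ ε ^ 2 * u ^ 2 := by
      intro j
      have h1 := pow_le_pow_left₀ (abs_nonneg _) (hε j) 2
      rw [sq_abs] at h1
      rw [hu, div_pow, div_pow, ← mul_div_assoc, ← mul_pow]
      exact div_le_div_of_nonneg_right h1 (by positivity)
    have hmul : ∀ j, (1 - ε ^ 2) * u ^ 2 ≤ A.colGram j j * (u + A.errF j j / n) := by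
      intro j
      rw [hgu]
      linarith [hsq j]
    have hcomp : ∀ j, 0 ≤ u + A.errF j j / n := by
      intro j
      have h1 : (A.errF j j / n) ^ 2 ≤ u ^ 2 := (hsq j).trans
        (mul_le_of_le_one_left (sq_nonneg u) hε1)
      have h2 := (abs_le.1 (abs_le_of_sq_le_sq h1 hu0.le)).1
      linarith
    have h1 : ∏ j, (u + A.errF j j / n) ≤ u ^ n := by
      refine (Finset.prod_le_arith_mean_pow hn hcomp).trans_eq ?_
      have hmean : ∑ j, A.errF j j / n = 0 := by
        rw [← Finset.sum_div, sum_errF_apply_self, zero_div]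
      rw [Finset.sum_add_distrib, hmean, add_zero, Finset.sum_const, Finset.card_univ,
        Fintype.card_fin, nsmul_eq_mul, mul_div_cancel_left₀ _ hn'.ne']
    have h2 : ((1 - ε ^ 2) * u ^ 2) ^ n ≤ G * u ^ n := by
      calc ((1 - ε ^ 2) * u ^ 2) ^ n = ∏ _j : Fin n, ((1 - ε ^ 2) * u ^ 2) := by
            rw [Finset.prod_const, Finset.card_univ, Fintype.card_fin]
        _ ≤ ∏ j, (A.colGram j j * (u + A.errF j j / n)) :=
            Finset.prod_le_prod (fun j _ => mul_nonneg (by linarith) (sq_nonneg u))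
              fun j _ => hmul j
        _ = G * ∏ j, (u + A.errF j j / n) := Finset.prod_mul_distrib
        _ ≤ G * u ^ n := mul_le_mul_of_nonneg_left h1 hG0.le
    rw [← hBprod, ← mul_pow] at h2
    have h3 := le_of_pow_le_pow_left₀ hn.ne' (by positivity) h2
    have h4 : u * ((1 - ε ^ 2) * u) ≤ u * (B.size / n) := by linarith
    have h5 := le_of_mul_le_mul_left h4 hu0
    rw [hu, ← mul_div_assoc, div_le_div_iff_of_pos_right hn'] at h5
    linarith

/-- A vanishing column forces ε ≥ 1, and then even the limit zero, at squared distance s, is within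
the bound. -/
theorem IsGradientFlow.exists_limit_of_colGram_diagonal (hn : 0 < n) (h : A.IsGradientFlow X)
    (hdiag : ∀ j l, j ≠ l → A.colGram j l = 0) (hs : 0 < A.size) {ε : ℝ}
    (hε : ∀ j, |A.errF j j| ≤ ε * A.size) :
    ∃ B : MatOperator 1 n k, Tendsto X atTop (𝓝 B) ∧ B.errF = 0 ∧
      A.sqDist B ≤ A.size * ε ^ 2 := by
  have hn' : (0 : ℝ) < n := by positivity
  by_cases hpos : ∀ j, 0 < A.colGram j j
  · obtain ⟨B, hB, hB0, hd⟩ := h.exists_limit_of_orthogonal hn hdiag hpos hs hε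
    refine ⟨B, hB, ?_, hd⟩
    rw [imbalance, errE_eq_zero, frobSq_eq_zero.2 rfl, zero_div, zero_add, div_eq_zero_iff,
      or_iff_left hn'.ne'] at hB0
    exact frobSq_eq_zero.1 hB0
  · push Not at hpos
    obtain ⟨j, hj⟩ := hpos
    have hj0 : A.colGram j j = 0 := le_antisymm hj (A.colGram_diag_nonneg j)
    refine ⟨0, h.tendsto_zero hn hdiag hj0, ?_, ?_⟩
    · simp [errF, size, colGram]
    · have h1 := hε j
      rw [errF_apply_self, hj0, mul_zero, sub_zero, abs_of_pos hs] at h1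
      have h2 : 1 ≤ ε := by
        by_contra! hlt
        exact absurd h1 (not_le.2 (mul_lt_of_lt_one_left hs hlt))
      have h3 : A.sqDist 0 = A.size := by simp [sqDist, size]
      rw [h3]
      exact le_mul_of_one_le_right hs.le (one_le_pow₀ h2)

end Row

end MatOperator

/-! ### Orthogonal invariance and reduction of one row to orthogonal columns. -/

/-- A real symmetric matrix is diagonal in a suitable orthonormal basis. -/
theorem Matrix.exists_orthogonal_diagonal {n : ℕ} {M : Matrix (Fin n) (Fin n) ℝ}
    (hM : M.IsHermitian) :
    ∃ U : Matrix (Fin n) (Fin n) ℝ, U.transpose * U = 1 ∧ U * U.transpose = 1 ∧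
      ∀ j l, j ≠ l → (U.transpose * M * U) j l = 0 := by
  have h1 := Unitary.coe_star_mul_self hM.eigenvectorUnitary
  have h2 := Unitary.coe_mul_star_self hM.eigenvectorUnitary
  have h3 := hM.conjStarAlgAut_star_eigenvectorUnitary
  rw [Unitary.conjStarAlgAut_star_apply] at h3
  simp only [Matrix.star_eq_conjTranspose, Matrix.conjTranspose_eq_transpose_of_trivial]
    at h1 h2 h3
  refine ⟨_, h1, h2, fun j l hjl => ?_⟩
  rw [h3, Matrix.diagonal_apply_ne _ hjl]

namespace MatOperator

variable {m n k : ℕ}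

section RightMultiplication

variable {U V : Matrix (Fin n) (Fin n) ℝ}

/-- The operator `(A₁ U, …, A_k U)`. -/
def mulRight (A : MatOperator m n k) (U : Matrix (Fin n) (Fin n) ℝ) : MatOperator m n k :=
  fun i => A i * U

theorem rowGram_mulRight (A : MatOperator m n k) (hU : U * U.transpose = 1) :
    (A.mulRight U).rowGram = A.rowGram := by
  refine Finset.sum_congr rfl fun i _ => ?_
  rw [mulRight, Matrix.transpose_mul, Matrix.mul_assoc, ← Matrix.mul_assoc U, hU, Matrix.one_mul]

theorem size_mulRight (A : MatOperator m n k) (hU : U * U.transpose = 1) :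
    (A.mulRight U).size = A.size := by
  rw [← trace_rowGram, rowGram_mulRight A hU, trace_rowGram]

theorem sqDist_mulRight (A B : MatOperator m n k) (hU : U * U.transpose = 1) :
    (A.mulRight U).sqDist (B.mulRight U) = A.sqDist B := by
  have h : A.mulRight U - B.mulRight U = (A - B).mulRight U :=
    funext fun i => (Matrix.sub_mul (A i) (B i) U).symm
  exact (congrArg size h).trans (size_mulRight (A - B) hU)

theorem errE_mulRight (A : MatOperator m n k) (hU : U * U.transpose = 1) :
    (A.mulRight U).errE = A.errE := by
  rw [errE, size_mulRight A hU, rowGram_mulRight A hU, errE]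

theorem colGram_mulRight (A : MatOperator m n k) :
    (A.mulRight U).colGram = U.transpose * A.colGram * U := by
  simp only [colGram, mulRight, Matrix.transpose_mul, Matrix.mul_sum, Matrix.sum_mul,
    Matrix.mul_assoc]

theorem errF_mulRight (A : MatOperator m n k) (hU : U * U.transpose = 1)
    (hU' : U.transpose * U = 1) :
    (A.mulRight U).errF = U.transpose * A.errF * U := by
  rw [errF, size_mulRight A hU, colGram_mulRight, errF, Matrix.mul_sub, Matrix.sub_mul,
    Matrix.mul_smul, Matrix.smul_mul, Matrix.mul_one, hU', Matrix.mul_smul, Matrix.smul_mul]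

theorem flowField_mulRight (A : MatOperator m n k) (hU : U * U.transpose = 1)
    (hU' : U.transpose * U = 1) :
    (A.mulRight U).flowField = A.flowField.mulRight U := by
  funext i
  rw [flowField, errE_mulRight A hU, errF_mulRight A hU hU', mulRight, mulRight, flowField,
    Matrix.add_mul]
  congr 1
  · rw [Matrix.mul_assoc]
  · rw [Matrix.mul_assoc, Matrix.mul_assoc, ← Matrix.mul_assoc U, hU,
      Matrix.one_mul, Matrix.mul_assoc]

theorem mulRight_mulRight_of_mul_eq_one (A : MatOperator m n k) (h : U * V = 1) :
    (A.mulRight U).mulRight V = A :=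
  funext fun i => by rw [mulRight, mulRight, Matrix.mul_assoc, h, Matrix.mul_one]

theorem continuous_mulRight : Continuous fun A : MatOperator m n k => A.mulRight U :=
  continuous_pi fun i => (continuous_apply i).matrix_mul continuous_const

theorem IsGradientFlow.mulRight {A : MatOperator m n k} {X : ℝ → MatOperator m n k}
    (h : A.IsGradientFlow X) (hU : U * U.transpose = 1) (hU' : U.transpose * U = 1) :
    (A.mulRight U).IsGradientFlow fun t => (X t).mulRight U := by
  refine ⟨by simp only [h.1], fun t ht i a b => ?_⟩
  rw [flowField_mulRight _ hU hU']
  simp only [MatOperator.mulRight, Matrix.mul_apply]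
  exact HasDerivWithinAt.fun_sum fun c _ => (h.2 t ht i a c).mul_const (U c b)

end RightMultiplication

/-- The flow, the size and the distance are compatible with orthogonal multiplication on the right.
One rotates so that the column Gram matrix becomes diagonal and rotates the limit back. -/
theorem IsGradientFlow.exists_limit_of_one_row {A : MatOperator 1 n k}
    {X : ℝ → MatOperator 1 n k} (hn : 0 < n) (h : A.IsGradientFlow X) (hs : 0 < A.size) {ε : ℝ}
    (hA : A.IsNearlyDoublyBalanced ε) :
    ∃ B : MatOperator 1 n k, Tendsto X atTop (𝓝 B) ∧ B.IsDoublyBalanced ∧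
      A.sqDist B ≤ A.size * ε ^ 2 := by
  have hsymm : A.colGram.IsHermitian := by
    simp [Matrix.IsHermitian, colGram, Matrix.transpose_sum, Matrix.transpose_mul]
  obtain ⟨U, hU', hU, hdiag⟩ := Matrix.exists_orthogonal_diagonal hsymm
  have hε : ∀ j, |(A.mulRight U).errF j j| ≤ ε * (A.mulRight U).size := by
    intro j
    have h1 := hA.abs_errF_le hn (fun l => U l j)
    have h2 : (fun l => U l j) ⬝ᵥ (fun l => U l j) = 1 := by
      have := congrFun (congrFun hU' j) j
      rwa [Matrix.mul_apply, Matrix.one_apply_eq] at this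
    have h3 : (A.mulRight U).errF j j = (fun l => U l j) ⬝ᵥ A.errF.mulVec fun l => U l j := by
      rw [errF_mulRight A hU hU', Matrix.mul_assoc]
      rfl
    rwa [h2, mul_one, ← h3, ← size_mulRight A hU] at h1
  obtain ⟨B, hB, hF, hd⟩ := (h.mulRight hU hU').exists_limit_of_colGram_diagonal hn
    (by rwa [colGram_mulRight]) (by rwa [size_mulRight A hU]) hε
  have hV : U.transpose * U.transpose.transpose = 1 := by rwa [Matrix.transpose_transpose]
  have hV' : U.transpose.transpose * U.transpose = 1 := by rwa [Matrix.transpose_transpose]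
  refine ⟨B.mulRight U.transpose, ?_, ?_, ?_⟩
  · have h1 := (continuous_mulRight (U := U.transpose)).tendsto B |>.comp hB
    refine h1.congr fun t => ?_
    exact mulRight_mulRight_of_mul_eq_one _ hU
  · refine isDoublyBalanced_of_errE_errF one_pos hn (errE_eq_zero _) ?_
    rw [errF_mulRight B hV hV', hF, Matrix.mul_zero, Matrix.zero_mul]
  · rw [← sqDist_mulRight _ _ hU, mulRight_mulRight_of_mul_eq_one _ hU', ← size_mulRight A hU]
    exact hd

end MatOperator

/-! ### The zero operator and the assembly of the theorem. -/

namespace MatOperator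

variable {m n k : ℕ}

theorem size_eq_zero {A : MatOperator m n k} : A.size = 0 ↔ A = 0 := by
  rw [size_eq_sum_frobSq, Finset.sum_eq_zero_iff_of_nonneg fun i _ => frobSq_nonneg _]
  simp only [Finset.mem_univ, true_imp_iff, frobSq_eq_zero]
  exact funext_iff.symm

theorem size_pos_dims {A : MatOperator m n k} (hs : 0 < A.size) : 0 < m ∧ 0 < n := by
  constructor <;> refine Nat.pos_of_ne_zero fun h0 => ?_ <;> subst h0 <;> simp [size] at hs

theorem isGradientFlow_zero : (0 : MatOperator m n k).IsGradientFlow fun _ => 0 := by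
  refine ⟨rfl, fun t _ i a b => ?_⟩
  have h : (0 : MatOperator m n k).flowField i a b = 0 := by simp [flowField]
  rw [h]
  exact hasDerivWithinAt_const _ _ _

theorem IsGradientFlow.eq_zero {X : ℝ → MatOperator m n k}
    (h : (0 : MatOperator m n k).IsGradientFlow X) {t : ℝ} (ht : 0 ≤ t) : X t = 0 := by
  refine size_eq_zero.1 (le_antisymm ?_ (X t).size_nonneg)
  by_contra! hpos
  obtain ⟨hm, hn⟩ := size_pos_dims hpos
  exact absurd (h.size_le hm hn ht) (not_le.2 (by rwa [size_eq_zero.2 rfl]))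

theorem isDoublyBalanced_zero : (0 : MatOperator m n k).IsDoublyBalanced := by
  have hs : (0 : MatOperator m n k).size = 0 := size_eq_zero.2 rfl
  have hr : (0 : MatOperator m n k).rowGram = 0 := by simp [rowGram]
  have hc : (0 : MatOperator m n k).colGram = 0 := by simp [colGram]
  simp only [IsDoublyBalanced, IsNearlyDoublyBalanced, hs, hr, hc, zero_div, mul_zero, zero_smul,
    sub_zero]
  exact ⟨Matrix.PosSemidef.zero, Matrix.PosSemidef.zero, Matrix.PosSemidef.zero,
    Matrix.PosSemidef.zero⟩

theorem HasSpectralGap.le_one {A : MatOperator m n k} {lam : ℝ} (h : A.HasSpectralGap lam)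
    (hs : 0 < A.size) : lam ≤ 1 := by
  obtain ⟨hm, hn⟩ := size_pos_dims hs
  have hσ : 0 < A.size / √((m : ℝ) * n) := by positivity
  linarith [nonneg_of_mul_nonneg_left (A.sigmaTwo_nonneg.trans h) hσ]

/-- Freezing the solution at negative times makes it continuous on the whole line, as the integral
estimates require. -/
theorem IsGradientFlow.comp_max_zero {A : MatOperator m n k} {X : ℝ → MatOperator m n k}
    (h : A.IsGradientFlow X) : A.IsGradientFlow fun t => X (max t 0) := by
  refine ⟨by simpa using h.1, fun t ht i a b => ?_⟩
  simp only [max_eq_left ht]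
  refine (h.2 t ht i a b).congr (fun τ hτ => ?_) ?_
  · rw [max_eq_left (Set.mem_Ici.1 hτ)]
  · rw [max_eq_left ht]

end MatOperator

theorem lemmal :
    ∃ C : ℝ, 0 < C ∧
      ∀ (m n k : ℕ) (A : MatOperator m n k) (ε lam : ℝ),
        m ≤ n → 0 < lam →
        A.IsNearlyDoublyBalanced ε → A.HasSpectralGap lam →
        C * ε * Real.log m ≤ lam ^ 2 →
        (∃ X : ℝ → MatOperator m n k, A.IsGradientFlow X) ∧
        ∀ X : ℝ → MatOperator m n k, A.IsGradientFlow X →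
          ∃ B : MatOperator m n k,
            Tendsto X atTop (𝓝 B) ∧ B.IsDoublyBalanced ∧
              A.sqDist B ≤ A.size * ε ^ 2 / lam := by
  refine ⟨10000, by norm_num, fun m n k A ε lam hmn hlam hA hgap hlog => ?_⟩
  -- Size zero covers empty dimensions as well; beyond it m and n are positive.
  rcases A.size_nonneg.eq_or_lt with hs | hs
  · obtain rfl := MatOperator.size_eq_zero.1 hs.symm
    refine ⟨⟨_, MatOperator.isGradientFlow_zero⟩, fun X hX =>
      ⟨0, ?_, MatOperator.isDoublyBalanced_zero, ?_⟩⟩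
    · refine tendsto_const_nhds.congr' ?_
      filter_upwards [eventually_ge_atTop 0] with t ht
      exact (hX.eq_zero ht).symm
    · rw [← hs]
      simp [MatOperator.sqDist]
  obtain ⟨hm, hn⟩ := MatOperator.size_pos_dims hs
  have hlam1 := hgap.le_one hs
  refine ⟨A.exists_isGradientFlow hm hn, fun X hX => ?_⟩
  -- For m = 1 the logarithm is 0 and the hypothesis says nothing about ε. The one-row bound sε² is
  -- stronger than required, because λ ≤ 1.
  rcases Nat.eq_or_lt_of_le hm with rfl | hm2
  · obtain ⟨B, hB, hB', hd⟩ := hX.exists_limit_of_one_row hn hs hA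
    exact ⟨B, hB, hB', hd.trans (le_div_self (by positivity) hlam hlam1)⟩
  · have hc : Continuous fun t => X (max t 0) :=
      hX.continuousOn.comp_continuous (by fun_prop) fun t => le_max_right t 0
    obtain ⟨B, hB, hB', hd⟩ := hX.comp_max_zero.exists_limit_of_hasSpectralGap hm2
      (hm2.trans_le hmn) hc hs hlam hlam1 hA hgap hlog
    refine ⟨B, hB.congr' ?_, hB', hd⟩
    filter_upwards [eventually_ge_atTop 0] with t ht
    rw [max_eq_left ht]
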